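/- Let $M$ be a lattice (a free abelian group of finite rank), $T=\operatorname{Spec}\mathbb C[M]$, $N=\operatorname{Hom}(M,\mathbb Z)$, let $\sigma\subset N_{\mathbb Q}$ be a pointed polyhedral cone, and let $\omega\subset M_{\mathbb Q}$ be its dual cone. Let $Y$ be a nonsingular curve over $\mathbb C$, contained as an open subset in a complete nonsingular curve $C$. Let $\mathcal D=\sum_{P}\Delta_P\otimes P$ be a proper polyhedral divisor on $Y$: for each closed point $P\in Y$ the coefficient $\Delta_P\subset N_{\mathbb Q}$ is the Minkowski sum of a nonempty polytope and $\sigma$, one has $\Delta_P=\sigma$ for all but finitely many $P$, and the $\mathbb Q$-divisor $\mathcal D(u)=\sum_P\min\langle u,\Delta_P\rangle\cdot P$ is semiample for every $u\in\omega\cap M$ and big for every $u\in M$ in the relative interior of $\omega$. (Here, for a $\mathbb Q$-divisor $E$, let $\Gamma(V,\mathcal O_Y(E))$ be the set of rational functions $f$ with $f=0$ or $\operatorname{div}f+E\ge0$ on $V$, and for $f\neq0$ put $Y_f=Y\setminus\operatorname{Supp}(\operatorname{div}f+nE)$ when $f\in\Gamma(Y,\mathcal O_Y(nE))$; $E$ is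 semiample if for some $n>0$ the sets $Y_f$ with $0\ne f\in\Gamma(Y,\mathcal O_Y(nE))$ cover $Y$, and big if for some $n>0$ and some $0\neq f\in\Gamma(Y,\mathcal O_Y(nE))$ the set $Y_f$ is affine.) Put $\mathcal A=\bigoplus_{u\in\omega\cap M}\mathcal O_Y(\mathcal D(u))\,\chi^u$, a quasi-coherent sheaf of $\mathcal O_Y$-algebras, let $\pi\colon\widetilde X=\operatorname{Spec}_Y(\mathcal A)\to Y$ be its relative spectrum, $X=\operatorname{Spec}\Gamma(Y,\mathcal A)$, and let $r\colon\widetilde X\to X$ be the canonical contraction morphism. Then there is exactly one rational map $p\colon X\dashrightarrow C$ over $\mathbb C$ (the rational quotient map) such that, for some nonempty affine open $U\subset Y$ with $\Delta_P=\sigma$ for all $P\in U$, the natural morphism $U\times T\to X$ (given by the inclusion $\Gamma(Y,\mathcal A)\subset\Gamma(U,\mathcal O_Y)[M]$) is an open immersion, and $p$ restricts on $U\times T$ to the projection $U\times T\to U\subset C$. Let $X'$ be the closure of the graph of $p$ in $X\times C$, with its reduced structure, and let $X''$ be the normalization of $X'$. Then $\widetilde X$ is canonically isomorphic to $X''$: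 there is exactly one isomorphism $\widetilde X\to X''$ which is compatible with the morphisms $r\colon\widetilde X\to X$ and $X''\to X$ and with the morphisms $\pi\colon\widetilde X\to Y\subset C$ and $X''\to C$. -/

import Mathlib

open CategoryTheory CategoryTheory.Limits AlgebraicGeometry TopologicalSpace

noncomputable section

namespace PolyDiv

/-- The base scheme `Spec ℂ`. -/
abbrev SpecC : Scheme.{0} := Spec (CommRingCat.of ℂ)

/-! ## Curves -/

/-- A nonsingular curve over `ℂ`: an integral separated scheme of finite type over `ℂ` whose local
rings at closed points are regular of dimension one, i.e. discrete valuation rings. -/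
class IsNonsingularCurve (Y : Scheme.{0}) [Y.Over SpecC] : Prop where
  isIntegral : IsIntegral Y
  isSeparated : IsSeparated (Y ↘ SpecC)
  locallyOfFiniteType : LocallyOfFiniteType (Y ↘ SpecC)
  quasiCompact : QuasiCompact (Y ↘ SpecC)
  isDVR : ∀ x ∈ closedPoints Y, IsDiscreteValuationRing (Y.presheaf.stalk x)

attribute [instance] IsNonsingularCurve.isIntegral IsNonsingularCurve.isSeparated
  IsNonsingularCurve.locallyOfFiniteType IsNonsingularCurve.quasiCompact

section Curve

variable (Y : Scheme.{0}) [Y.Over SpecC] [IsNonsingularCurve Y]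

instance isNoetherian_curve : IsNoetherian Y where
  toIsLocallyNoetherian := LocallyOfFiniteType.isLocallyNoetherian (Y ↘ SpecC)
  toCompactSpace := QuasiCompact.compactSpace_of_compactSpace (Y ↘ SpecC)

instance isSeparated_curve : Y.IsSeparated :=
  ⟨by rw [← terminal.comp_from (Y ↘ SpecC)]; infer_instance⟩

instance isDVR_curve (x : closedPoints Y) : IsDiscreteValuationRing (Y.presheaf.stalk x.1) :=
  IsNonsingularCurve.isDVR _ x.2

variable {Y} in
theorem mem_closedPoints_of_ne {t : Y} (ht : t ≠ genericPoint Y) : t ∈ closedPoints Y := by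
  obtain ⟨y, hy, hyc⟩ := (isClosed_closure (s := {t})).exists_closed_singleton ⟨t, subset_closure rfl⟩
  have hty : t ⤳ y := specializes_iff_mem_closure.mpr hy
  have key (q : PrimeSpectrum (Y.presheaf.stalk y)) :
      q.asIdeal = ⊥ ∨ q = IsLocalRing.closedPoint (Y.presheaf.stalk y) := by
    have : IsDiscreteValuationRing (Y.presheaf.stalk y) := isDVR_curve Y ⟨y, hyc⟩
    by_cases h : q.asIdeal = ⊥
    · exact .inl h
    · right
      ext1
      exact IsLocalRing.eq_maximalIdeal (q.2.isMaximal h)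
  have hr (s : Y) (hs : s ⤳ y) : ∃ q, Y.fromSpecStalk y q = s := by
    change s ∈ Set.range (Y.fromSpecStalk y)
    rw [Scheme.range_fromSpecStalk]; exact hs
  obtain ⟨q, rfl⟩ := hr t hty
  rcases key q with hq | rfl
  · exfalso
    have hη := (genericPoint_spec Y).specializes (Set.mem_univ y)
    obtain ⟨q', hq'⟩ := hr _ hη
    rcases key q' with h' | rfl
    · exact ht (by rw [← hq', PrimeSpectrum.ext (hq.trans h'.symm)])
    · rw [Scheme.fromSpecStalk_closedPoint] at hq'
      have h1 := (genericPoint_spec Y).def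
      rw [← hq', (mem_closedPoints_iff.mp hyc).closure_eq] at h1
      apply ht
      rw [← hq', ← Set.mem_singleton_iff, h1]
      trivial
  · rwa [Scheme.fromSpecStalk_closedPoint]

variable {Y} in
theorem finite_compl {W : Y.Opens} (hW : genericPoint Y ∈ W) : ((W : Set Y)ᶜ).Finite := by
  obtain ⟨S, hS, hS', hS''⟩ := NoetherianSpace.exists_finite_set_isClosed_irreducible
    (s := (W : Set Y)ᶜ) W.isOpen.isClosed_compl
  rw [hS''.2]
  refine Set.Finite.sUnion hS fun T hT ↦ ?_
  obtain ⟨t, ht⟩ := QuasiSober.sober (hS''.1 T hT) (hS' T hT)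
  have htT : t ∈ T := by rw [← ht.def]; exact subset_closure rfl
  have htW : t ∈ (W : Set Y)ᶜ := by rw [hS''.2]; exact ⟨T, hT, htT⟩
  have htc := mem_closedPoints_of_ne (t := t) (by rintro rfl; exact htW hW)
  rw [← ht.def, (mem_closedPoints_iff.mp htc).closure_eq]
  exact Set.finite_singleton _

end Curve

/-! ## Sections of `ℚ`-divisors

A `ℚ`-divisor on a curve is given by its coefficients at the closed points. -/

section Divisors

variable {Y : Scheme.{0}} [Y.Over SpecC] [IsNonsingularCurve Y]

/-- `Γ(V, 𝒪_Y(E))` for a `ℚ`-divisor `E`: the rational functions `f` with `f = 0` or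
`div f + E ≥ 0` on `V`. -/
def divisorSections (E : closedPoints Y → ℚ) (V : Y.Opens) : AddSubgroup Y.functionField where
  carrier := {f | f ≠ 0 → ∀ P : closedPoints Y, P.1 ∈ V → 0 ≤ (Scheme.ord f P.1 : ℚ) + E P}
  zero_mem' h := absurd rfl h
  add_mem' {f g} hf hg hfg P hP := by
    by_cases hf0 : f = 0
    · subst hf0; simp only [zero_add] at hfg ⊢; exact hg hfg P hP
    by_cases hg0 : g = 0
    · subst hg0; simp only [add_zero] at hfg ⊢; exact hf hfg P hP
    have h1 := hf hf0 P hP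
    have h2 := hg hg0 P hP
    have h3 : ((min (Scheme.ord f P.1) (Scheme.ord g P.1) : ℤ) : ℚ) ≤
      Scheme.ord (f + g) P.1 := by exact_mod_cast Scheme.ord_add hfg
    rcases min_choice (Scheme.ord f P.1) (Scheme.ord g P.1) with h | h <;>
      (rw [h] at h3; linarith)
  neg_mem' {f} hf hf0 P hP := by
    have hf0' : f ≠ 0 := by simpa using hf0
    have h1 := hf hf0' P hP
    have : Nonempty (⊤ : Y.Opens) := ⟨⟨P.1, trivial⟩⟩
    have h2 := Scheme.ord_le_smul (U := ⊤) (x := P.1) trivial (a := -1) (by simp) f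
    rw [neg_smul, one_smul] at h2
    have h3 : (Scheme.ord f P.1 : ℚ) ≤ Scheme.ord (-f) P.1 := by exact_mod_cast h2
    linarith

theorem mul_mem_divisorSections {E E' E'' : closedPoints Y → ℚ} {V : Y.Opens}
    (h : ∀ P, E P + E' P ≤ E'' P) {f g : Y.functionField}
    (hf : f ∈ divisorSections E V) (hg : g ∈ divisorSections E' V) :
    f * g ∈ divisorSections E'' V := by
  intro hfg P hP
  have hf0 := left_ne_zero_of_mul hfg
  have hg0 := right_ne_zero_of_mul hfg
  rw [Scheme.ord_mul hf0 hg0]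
  push_cast
  linarith [hf hf0 P hP, hg hg0 P hP, h P]

theorem divisorSections_anti (E : closedPoints Y → ℚ) {V W : Y.Opens} (h : V ≤ W) :
    divisorSections E W ≤ divisorSections E V :=
  fun _ hf hf0 P hP ↦ hf hf0 P (h hP)

theorem ord_germ_nonneg {V : Y.Opens} {x : Y} (hx : x ∈ V) (f : Γ(Y, V)) :
    0 ≤ Scheme.ord (algebraMap (Y.presheaf.stalk x) Y.functionField (Y.presheaf.germ V x hx f)) x := by
  have : Nonempty V := ⟨⟨x, hx⟩⟩
  rw [Scheme.algebraMap_germ_eq_germToFunctionField]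
  by_cases hf : f = 0
  · simp [hf]
  have h := Scheme.ord_le_smul hx hf (1 : Y.functionField)
  rw [Algebra.smul_def, mul_one] at h
  refine le_trans ?_ h
  have h1 := Scheme.ord_of_isUnit (f := (1 : Γ(Y, V))) isUnit_one hx
  rw [map_one] at h1
  exact h1.ge

/-- The complement `Y_f` of the support of `div f + E`. -/
def nonvanishingLocus (E : closedPoints Y → ℚ) (f : Y.functionField) : Set Y :=
  {x | ∀ h : x ∈ closedPoints Y, (Scheme.ord f x : ℚ) + E ⟨x, h⟩ = 0}

/-- A `ℚ`-divisor `E` is semiample if for some positive multiple `nE` the curve is covered by the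
sets `Y_f` with `f` a nonzero global section of `𝒪_Y(nE)`. -/
def IsSemiample (E : closedPoints Y → ℚ) : Prop :=
  ∃ n : ℕ, 0 < n ∧ ∀ x : Y, ∃ f : Y.functionField, f ≠ 0 ∧ f ∈ divisorSections (n • E) ⊤ ∧
    x ∈ nonvanishingLocus (n • E) f

/-- A `ℚ`-divisor `E` is big if some positive multiple `nE` has a nonzero global section `f` such
that `Y_f` is affine. -/
def IsBig (E : closedPoints Y → ℚ) : Prop :=
  ∃ n : ℕ, 0 < n ∧ ∃ f : Y.functionField, f ≠ 0 ∧ f ∈ divisorSections (n • E) ⊤ ∧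
    ∃ W : Y.Opens, (W : Set Y) = nonvanishingLocus (n • E) f ∧ IsAffineOpen W

variable {M : Type} [AddCommGroup M]

open AddMonoidAlgebra in
/-- The ring `⨁_{u ∈ S} Γ(V, 𝒪_Y(E u)) χ^u ⊆ K(Y)[M]` attached to a submonoid `S ⊆ M` and a
superadditive family of `ℚ`-divisors `E u`. -/
def gradedSections (S : AddSubmonoid M) (E : M → closedPoints Y → ℚ)
    (h0 : ∀ P, 0 ≤ E 0 P) (hE : ∀ u ∈ S, ∀ w ∈ S, ∀ P, E u P + E w P ≤ E (u + w) P)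
    (V : Y.Opens) : Subring (AddMonoidAlgebra Y.functionField M) where
  carrier := {a | ∀ u, a.coeff u ≠ 0 → u ∈ S ∧ a.coeff u ∈ divisorSections (E u) V}
  zero_mem' u hu := by simp at hu
  add_mem' {a b} ha hb u hu := by
    rw [coeff_add, Finsupp.add_apply] at hu ⊢
    have ha' : a.coeff u ∈ divisorSections (E u) V := by
      by_cases h : a.coeff u = 0
      · rw [h]; exact zero_mem _
      · exact (ha u h).2
    have hb' : b.coeff u ∈ divisorSections (E u) V := by
      by_cases h : b.coeff u = 0
      · rw [h]; exact zero_mem _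
      · exact (hb u h).2
    refine ⟨?_, add_mem ha' hb'⟩
    by_cases h : a.coeff u = 0
    · exact (hb u (by intro h'; simp [h, h'] at hu)).1
    · exact (ha u h).1
  neg_mem' {a} ha u hu := by
    rw [coeff_neg, Finsupp.neg_apply] at hu ⊢
    have := ha u (by simpa using hu)
    exact ⟨this.1, neg_mem this.2⟩
  one_mem' u hu := by
    classical
    rw [AddMonoidAlgebra.one_def, coeff_single, Finsupp.single_apply] at hu ⊢
    split_ifs at hu ⊢ with h
    · subst h
      refine ⟨zero_mem _, fun _ P hP ↦ ?_⟩
      have := ord_germ_nonneg (V := ⊤) (x := P.1) trivial (1 : Γ(Y, ⊤))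
      rw [map_one, map_one] at this
      have h2 : (0 : ℚ) ≤ Scheme.ord (1 : Y.functionField) P.1 := by exact_mod_cast this
      linarith [h0 P]
    · exact absurd rfl hu
  mul_mem' {a b} ha hb u hu := by
    classical
    have key (v w : M) (hv : v ∈ a.coeff.support) (hw : w ∈ b.coeff.support) (h : v + w = u) :
        u ∈ S ∧ a.coeff v * b.coeff w ∈ divisorSections (E u) V := by
      have h1 := ha v (Finsupp.mem_support_iff.mp hv)
      have h2 := hb w (Finsupp.mem_support_iff.mp hw)
      subst h
      exact ⟨add_mem h1.1 h2.1, mul_mem_divisorSections (hE v h1.1 w h2.1) h1.2 h2.2⟩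
    rw [coeff_mul, Finsupp.sum] at hu ⊢
    constructor
    · by_contra hS
      apply hu
      refine Finset.sum_eq_zero fun v hv ↦ Finset.sum_eq_zero fun w hw ↦ ?_
      dsimp only
      split_ifs with h
      · exact absurd (key v w hv hw h).1 hS
      · rfl
    · refine sum_mem fun v hv ↦ sum_mem fun w hw ↦ ?_
      dsimp only
      split_ifs with h
      · exact (key v w hv hw h).2
      · exact zero_mem _


variable (M) in
/-- The coordinate ring `Γ(U, 𝒪_Y)[M] ⊆ K(Y)[M]` of `U × T`, for `U ⊆ Y` affine open and nonempty,
where `T = Spec ℂ[M]`. As `Y` is normal, a rational function is regular on `U` if and only if it has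
no poles on `U`, that is, if and only if it is a section of `𝒪_Y(0)` over `U`. -/
def torusSections (U : Y.Opens) : Subring (AddMonoidAlgebra Y.functionField M) :=
  gradedSections ⊤ 0 (fun _ ↦ le_rfl) (fun _ _ _ _ _ ↦ by simp) U

variable (M) in
/-- `U × T` for `U ⊆ Y` affine open and nonempty. -/
def torus (U : Y.Opens) : Scheme.{0} := Spec (CommRingCat.of (torusSections M U))

variable (M) in
/-- The inclusion `Γ(U, 𝒪_Y) ⟶ Γ(U, 𝒪_Y)[M]`. -/
def toTorusSections (U : Y.Opens) [Nonempty U] : Γ(Y, U) →+* torusSections M U :=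
  ((AddMonoidAlgebra.singleZeroRingHom (R := Y.functionField) (M := M)).comp
    (Y.germToFunctionField U).hom).codRestrict _ (fun f u hu ↦ by
      classical
      change (AddMonoidAlgebra.single (0 : M) (Y.germToFunctionField U f)).coeff u ≠ 0 at hu
      change u ∈ (⊤ : AddSubmonoid M) ∧
        (AddMonoidAlgebra.single (0 : M) (Y.germToFunctionField U f)).coeff u ∈
          divisorSections _ U
      rw [AddMonoidAlgebra.coeff_single, Finsupp.single_apply] at hu ⊢
      split_ifs at hu ⊢ with h
      · refine ⟨trivial, fun _ P hP ↦ ?_⟩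
        have h1 := ord_germ_nonneg hP f
        rw [Scheme.algebraMap_germ_eq_germToFunctionField] at h1
        simp only [Pi.zero_apply, add_zero]
        exact_mod_cast h1
      · exact absurd rfl hu)

variable (M) in
/-- The projection `U × T ⟶ U ⊆ Y`. -/
def torusProj {U : Y.Opens} (hU : IsAffineOpen U) [Nonempty U] : torus M U ⟶ Y :=
  Spec.map (CommRingCat.ofHom (toTorusSections M U)) ≫ hU.fromSpec


end Divisors

/-! ## Polyhedral divisors

`M` is the character lattice. The vector space `N_ℚ = Hom(M, ℤ) ⊗ ℚ` is represented by
`Hom(M, ℚ)`, so the pairing `⟨u, v⟩` is `v u`. -/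

section Polyhedral

/-- The rational vector space `N_ℚ`. -/
abbrev NQ (M : Type) [AddCommGroup M] : Type := M →ₗ[ℤ] ℚ

variable {M : Type} [AddCommGroup M]

open scoped Pointwise in
/-- `Δ` is a polyhedron with tail cone `σ`: the Minkowski sum of `σ` and a (nonempty) polytope. -/
def IsPolyhedronWithTail (σ : PointedCone ℚ (NQ M)) (Δ : Set (NQ M)) : Prop :=
  ∃ F : Finset (NQ M), F.Nonempty ∧ Δ = convexHull ℚ (F : Set (NQ M)) + (σ : Set (NQ M))

/-- `min ⟨u, Δ⟩`. -/
def minPairing (u : M) (Δ : Set (NQ M)) : ℚ :=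
  Classical.epsilon (IsLeast ((fun v : NQ M ↦ v u) '' Δ))

/-- The weight monoid `ω ∩ M`, where `ω` is the dual cone of `σ`. -/
def weightMonoid (σ : PointedCone ℚ (NQ M)) : AddSubmonoid M where
  carrier := {u | ∀ v ∈ σ, 0 ≤ v u}
  zero_mem' v _ := by simp
  add_mem' {u w} hu hw v hv := by rw [map_add]; exact add_nonneg (hu v hv) (hw v hv)

/-- The lattice points of the relative interior of `ω`: those `u ∈ ω ∩ M` such that for every
`w ∈ ω ∩ M` one can move from `u` a little in the direction `-w` without leaving `ω`. -/
def interiorWeights (σ : PointedCone ℚ (NQ M)) : Set M :=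
  {u | u ∈ weightMonoid σ ∧ ∀ w ∈ weightMonoid σ, ∃ n : ℕ, n • u - w ∈ weightMonoid σ}

theorem IsPolyhedronWithTail.isLeast {σ : PointedCone ℚ (NQ M)} {Δ : Set (NQ M)}
    (h : IsPolyhedronWithTail σ Δ) {u : M} (hu : u ∈ weightMonoid σ) :
    IsLeast ((fun v : NQ M ↦ v u) '' Δ) (minPairing u Δ) := by
  refine Classical.epsilon_spec (p := IsLeast ((fun v : NQ M ↦ v u) '' Δ)) ?_
  obtain ⟨F, hF, rfl⟩ := h
  obtain ⟨v₀, hv₀, hmin⟩ := F.exists_min_image (fun v ↦ v u) hF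
  refine ⟨v₀ u, ⟨v₀, ⟨v₀, subset_convexHull _ _ hv₀, 0, σ.zero_mem, add_zero _⟩, rfl⟩, ?_⟩
  rintro _ ⟨_, ⟨v, hv, w, hw, rfl⟩, rfl⟩
  have hsub : convexHull ℚ (F : Set (NQ M)) ⊆ {v | v₀ u ≤ v u} := by
    refine convexHull_min (fun v hv ↦ hmin v hv) ?_
    intro x hx y hy a b ha hb hab
    simp only [Set.mem_ofPred_eq, LinearMap.add_apply, LinearMap.smul_apply, smul_eq_mul] at *
    have : v₀ u = a * v₀ u + b * v₀ u := by rw [← add_mul, hab, one_mul]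
    rw [this]
    gcongr
  have h1 : v₀ u ≤ v u := hsub hv
  have h2 : 0 ≤ w u := hu w hw
  simp only [LinearMap.add_apply]
  linarith

/-- A polyhedral divisor `𝒟 = ∑ Δ_P ⊗ P` on the curve `Y` whose coefficients are polyhedra with
tail cone `σ`, all but finitely many of them equal to `σ`. -/
structure PolyhedralDivisor (Y : Scheme.{0}) (σ : PointedCone ℚ (NQ M)) where
  coeff : closedPoints Y → Set (NQ M)
  isPolyhedron : ∀ P, IsPolyhedronWithTail σ (coeff P)
  finite_nontrivial : {P | coeff P ≠ (σ : Set (NQ M))}.Finite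

namespace PolyhedralDivisor

variable {Y : Scheme.{0}} {σ : PointedCone ℚ (NQ M)} (D : PolyhedralDivisor Y σ)

/-- The `ℚ`-divisor `𝒟(u) = ∑ min ⟨u, Δ_P⟩ · P`. -/
def eval (u : M) : closedPoints Y → ℚ := fun P ↦ minPairing u (D.coeff P)

theorem eval_zero (P : closedPoints Y) : D.eval 0 P = 0 := by
  obtain ⟨v, -, hv⟩ := ((D.isPolyhedron P).isLeast (zero_mem _)).1
  rw [eval, ← hv]
  simp

theorem eval_add_le {u w : M} (hu : u ∈ weightMonoid σ) (hw : w ∈ weightMonoid σ)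
    (P : closedPoints Y) : D.eval u P + D.eval w P ≤ D.eval (u + w) P := by
  obtain ⟨v, hv, hv'⟩ := ((D.isPolyhedron P).isLeast (add_mem hu hw)).1
  have h1 := ((D.isPolyhedron P).isLeast hu).2 ⟨v, hv, rfl⟩
  have h2 := ((D.isPolyhedron P).isLeast hw).2 ⟨v, hv, rfl⟩
  simp only [map_add] at hv'
  rw [eval, eval, eval, ← hv']
  exact add_le_add h1 h2

variable [Y.Over SpecC] [IsNonsingularCurve Y]

/-- `𝒟` is proper: `𝒟(u)` is semiample for all `u ∈ ω ∩ M` and big for all `u` in the relative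
interior of `ω`. -/
structure IsProper : Prop where
  semiample : ∀ u ∈ weightMonoid σ, IsSemiample (D.eval u)
  big : ∀ u ∈ interiorWeights σ, IsBig (D.eval u)

/-- The ring `Γ(V, 𝒜) = ⨁_{u ∈ ω ∩ M} Γ(V, 𝒪_Y(𝒟(u))) χ^u ⊆ K(Y)[M]` for nonempty open `V`. -/
def sections (V : Y.Opens) : Subring (AddMonoidAlgebra Y.functionField M) :=
  gradedSections (weightMonoid σ) D.eval (fun P ↦ (D.eval_zero P).ge)
    (fun _ hu _ hw P ↦ D.eval_add_le hu hw P) V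

theorem sections_anti {V W : Y.Opens} (h : V ≤ W) : D.sections W ≤ D.sections V :=
  fun _ ha u hu ↦ ⟨(ha u hu).1, divisorSections_anti _ h (ha u hu).2⟩

theorem structureMap_mem (V : Y.Opens) (f : Γ(Y, V)) :
    (fun x : V ↦ AddMonoidAlgebra.single (0 : M) (algebraMap (Y.presheaf.stalk x.1) Y.functionField
      (Y.presheaf.germ V x.1 x.2 f))) ∈ (D.sections V).map (Pi.constRingHom V _) := by
  classical
  rcases isEmpty_or_nonempty V with hV | hV
  · exact ⟨0, (D.sections V).zero_mem, Subsingleton.elim _ _⟩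
  refine ⟨AddMonoidAlgebra.single (0 : M) (Y.germToFunctionField V f), fun u hu ↦ ?_, ?_⟩
  · rw [AddMonoidAlgebra.coeff_single, Finsupp.single_apply] at hu ⊢
    split_ifs at hu ⊢ with h
    · subst h
      refine ⟨zero_mem _, fun _ P hP ↦ ?_⟩
      have h1 := ord_germ_nonneg hP f
      rw [Scheme.algebraMap_germ_eq_germToFunctionField] at h1
      rw [D.eval_zero, add_zero]
      exact_mod_cast h1
    · exact absurd rfl hu
  · funext x
    simp only [Scheme.algebraMap_germ_eq_germToFunctionField, Pi.constRingHom_apply]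
    rfl


/-! ### The sheaf of algebras and its relative spectrum -/



/-- The ring `Γ(V, 𝒜)` for every open `V`. Its elements are the constant functions on `V` with
value in `D.sections V`; thus it is a copy of `D.sections V` if `V` is nonempty, and it is the zero
ring if `V` is empty. -/
def sheafSections (V : Y.Opens) : Subring (V → AddMonoidAlgebra Y.functionField M) :=
  (D.sections V).map (Pi.constRingHom V _)

/-- The restriction maps of `𝒜`. -/
def res {V W : Y.Opens} (h : V ≤ W) : D.sheafSections W →+* D.sheafSections V :=
  (RingHom.pi fun x : V ↦ Pi.evalRingHom (fun _ : W ↦ AddMonoidAlgebra Y.functionField M)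
    ⟨x.1, h x.2⟩).restrict _ _ (by
      rintro _ ⟨a, ha, rfl⟩
      exact ⟨a, D.sections_anti h ha, rfl⟩)

/-- The structure maps `Γ(V, 𝒪_Y) ⟶ Γ(V, 𝒜)`, onto the part of degree `0`. -/
def structureMap (V : Y.Opens) : Γ(Y, V) →+* D.sheafSections V :=
  (RingHom.pi fun x : V ↦ (AddMonoidAlgebra.singleZeroRingHom (R := Y.functionField) (M := M)).comp
    ((algebraMap (Y.presheaf.stalk x.1) Y.functionField).comp
      (Y.presheaf.germ V x.1 x.2).hom)).codRestrict _ (D.structureMap_mem V)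

/-- The sheaf `𝒜` as a presheaf of rings on `Y`. -/
def sheaf : Y.Opensᵒᵖ ⥤ CommRingCat where
  obj V := .of (D.sheafSections V.unop)
  map i := CommRingCat.ofHom (D.res i.unop.le)
  map_id _ := rfl
  map_comp _ _ := rfl

/-- The `𝒪_Y`-algebra structure of `𝒜`. -/
def structureHom : Y.presheaf ⟶ D.sheaf where
  app V := CommRingCat.ofHom (D.structureMap V.unop)
  naturality {V W} i := by
    ext f
    apply Subtype.ext
    funext x
    change AddMonoidAlgebra.single 0 (algebraMap (Y.presheaf.stalk x.1) Y.functionField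
      (Y.presheaf.germ W.unop x.1 x.2 (Y.presheaf.map i f))) = AddMonoidAlgebra.single 0
      (algebraMap (Y.presheaf.stalk x.1) Y.functionField
        (Y.presheaf.germ V.unop x.1 (i.unop.le x.2) f))
    rw [TopCat.Presheaf.germ_res_apply']

theorem exists_mul_mem {V : Y.Opens} [Nonempty V] {f : Γ(Y, V)} (hf : f ≠ 0)
    {a : AddMonoidAlgebra Y.functionField M} (ha : a ∈ D.sections (Y.basicOpen f)) :
    ∃ n : ℕ, AddMonoidAlgebra.single (0 : M) (Y.germToFunctionField V f ^ n) * a ∈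
      D.sections V := by
  set φ := Y.germToFunctionField V f with hφ
  have hφ0 : φ ≠ 0 := by
    rw [hφ, Ne, map_eq_zero_iff _ (Y.germToFunctionField_injective V)]; exact hf
  have hfin : ((Y.basicOpen f : Set Y)ᶜ).Finite := by
    refine finite_compl ?_
    rw [Scheme.mem_basicOpen _ _ _ (((genericPoint_spec Y).mem_open_set_iff V.isOpen).mpr
      (by simpa using ‹Nonempty V›))]
    exact isUnit_iff_ne_zero.mpr hφ0
  have hpos (x : closedPoints Y) (hx : x.1 ∈ V) (hxf : x.1 ∉ Y.basicOpen f) :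
      1 ≤ Scheme.ord φ x.1 := by
    have h0 := ord_germ_nonneg hx f
    rw [Scheme.algebraMap_germ_eq_germToFunctionField, ← hφ] at h0
    by_contra hlt
    have hz : Scheme.ord φ x.1 = 0 := by lia
    have hco : Order.coheight x.1 = 1 := by
      have h1 := ringKrullDim_stalk_eq_coheight x.1
      rw [IsDiscreteValuationRing.ringKrullDim_eq_one] at h1
      exact_mod_cast h1.symm
    rw [Scheme.ord_eq_iff hco hφ0] at hz
    refine hxf ((Y.mem_basicOpen f x.1 hx).mpr ?_)
    rw [Ring.isUnit_iff_ordFrac_one_of_isDiscreteValuationRing (K := Y.functionField),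
      Scheme.algebraMap_germ_eq_germToFunctionField]
    exact hz
  have hpow (n : ℕ) (x : Y) : Scheme.ord (φ ^ n) x = n * Scheme.ord φ x := by
    induction n with
    | zero =>
      have := Scheme.ord_mul (x := x) (one_ne_zero (α := Y.functionField)) one_ne_zero
      simp at this ⊢
      exact this
    | succ n ih =>
      rw [pow_succ, Scheme.ord_mul (pow_ne_zero _ hφ0) hφ0, ih]; push_cast; ring
  -- a bound for all relevant poles
  obtain ⟨n, hn⟩ : ∃ n : ℕ, ∀ u ∈ a.coeff.support, ∀ P : closedPoints Y, P.1 ∉ Y.basicOpen f →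
      -((Scheme.ord (a.coeff u) P.1 : ℚ) + D.eval u P) ≤ n := by
    have hfin' : {P : closedPoints Y | P.1 ∉ Y.basicOpen f}.Finite :=
      hfin.preimage Subtype.val_injective.injOn
    obtain ⟨B, hB⟩ := ((a.coeff.support.finite_toSet.prod hfin').image
      (fun q ↦ -((Scheme.ord (a.coeff q.1) q.2.1 : ℚ) + D.eval q.1 q.2))).bddAbove
    obtain ⟨n, hn⟩ := exists_nat_ge B
    exact ⟨n, fun u hu P hP ↦ (hB ⟨(u, P), ⟨hu, hP⟩, rfl⟩).trans hn⟩
  refine ⟨n, fun u hu ↦ ?_⟩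
  rw [AddMonoidAlgebra.coeff_single_zero_mul] at hu ⊢
  have hu' := right_ne_zero_of_mul hu
  obtain ⟨h1, h2⟩ := ha u hu'
  refine ⟨h1, fun _ P hP ↦ ?_⟩
  rw [Scheme.ord_mul (left_ne_zero_of_mul hu) hu', hpow]
  push_cast
  by_cases hPf : P.1 ∈ Y.basicOpen f
  · have h3 := ord_germ_nonneg hP f
    rw [Scheme.algebraMap_germ_eq_germToFunctionField, ← hφ] at h3
    have h3' : (0 : ℚ) ≤ Scheme.ord φ P.1 := by exact_mod_cast h3
    have h4 := h2 hu' P hPf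
    have : (0 : ℚ) ≤ n * Scheme.ord φ P.1 := by positivity
    linarith
  · have h3 := hn u (Finsupp.mem_support_iff.mpr hu') P hPf
    have h4 : (1 : ℚ) ≤ Scheme.ord φ P.1 := by exact_mod_cast hpos P hP hPf
    have : (n : ℚ) * 1 ≤ n * Scheme.ord φ P.1 := by gcongr
    linarith

/-- `𝒜` is quasi-coherent: `Γ(V_f, 𝒜) = Γ(V, 𝒜)_f` for affine open `V` and `f ∈ Γ(V, 𝒪_Y)`. -/
theorem coequifibered_structureHom :
    ((Scheme.AffineZariskiSite.toOpensFunctor Y).op.whiskerLeft D.structureHom).Coequifibered := by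
  refine Scheme.AffineZariskiSite.coequifibered_iff_forall_isLocalizationAway.mpr fun V f ↦ ?_
  let ρ : D.sheafSections V.1 →+* D.sheafSections (Y.basicOpen f) := D.res (Y.basicOpen_le f)
  let : Algebra (D.sheafSections V.1) (D.sheafSections (Y.basicOpen f)) := ρ.toAlgebra
  change IsLocalization.Away (D.structureMap V.1 f) (D.sheafSections (Y.basicOpen f))
  have hnat : ρ (D.structureMap V.1 f) = D.structureMap (Y.basicOpen f)
      (Y.presheaf.map (homOfLE (Y.basicOpen_le f)).op f) :=
    congr($(D.structureHom.naturality (homOfLE (Y.basicOpen_le f)).op).hom f).symm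
  have hval (x : V.1) [Nonempty V.1] : (D.structureMap V.1 f).1 x =
      AddMonoidAlgebra.single 0 (Y.germToFunctionField V.1 f) := by
    rw [← Scheme.algebraMap_germ_eq_germToFunctionField (X := Y) x.2]
    rfl
  refine IsLocalization.Away.mk _ ?_ ?_ ?_
  · change IsUnit (ρ (D.structureMap V.1 f))
    rw [hnat]
    exact (Y.toRingedSpace.isUnit_res_basicOpen f).map _
  · rintro ⟨_, a, ha, rfl⟩
    rcases isEmpty_or_nonempty (Y.basicOpen f) with hE | hE
    · exact ⟨0, 0, Subtype.ext (funext fun x ↦ hE.elim x)⟩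
    have : Nonempty V.1 := ⟨⟨hE.some.1, Y.basicOpen_le f hE.some.2⟩⟩
    have hf : f ≠ 0 := by
      intro h
      obtain ⟨x, hx⟩ := hE
      rw [h, Scheme.basicOpen_zero] at hx
      exact hx
    obtain ⟨n, hn⟩ := D.exists_mul_mem hf ha
    refine ⟨n, ⟨_, _, hn, rfl⟩, Subtype.ext (funext fun x ↦ ?_)⟩
    change a * (D.structureMap V.1 f).1 ⟨x.1, Y.basicOpen_le f x.2⟩ ^ n = _ * a
    rw [hval, AddMonoidAlgebra.single_pow, nsmul_zero, mul_comm]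
  · rintro ⟨_, a, ha, rfl⟩ ⟨_, b, hb, rfl⟩ hab
    rcases isEmpty_or_nonempty (Y.basicOpen f) with hE | hE
    · have hf : f = 0 := by
        rw [← basicOpen_eq_bot_iff]
        ext x
        exact ⟨fun hx ↦ hE.elim ⟨x, hx⟩, fun hx ↦ hx.elim⟩
      exact ⟨1, by rw [hf, map_zero]; simp⟩
    · have h1 : a = b := congrFun (congrArg Subtype.val hab) hE.some
      subst h1
      exact ⟨0, rfl⟩

/-- The gluing datum of the affine schemes `Spec Γ(V, 𝒜)`, with `V ⊆ Y` affine open. -/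
def glueData := Scheme.AffineZariskiSite.relativeGluingData D.coequifibered_structureHom

instance : (D.glueData.functor ⋙ Scheme.forget).IsLocallyDirected :=
  Scheme.Cover.RelativeGluingData.instIsLocallyDirectedI₀CompFunctorForgetOfIsThin ..

/-- `X̃ = Spec_Y 𝒜`, the relative spectrum of `𝒜`. -/
def Xtilde : Scheme.{0} := D.glueData.glued

/-- The structure morphism `π : X̃ ⟶ Y`. -/
def π : D.Xtilde ⟶ Y := D.glueData.toBase

/-- `X = Spec Γ(Y, 𝒜)`. -/
def X : Scheme.{0} := Spec (CommRingCat.of (D.sheafSections ⊤))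

/-- The contraction morphism `X̃ ⟶ X`, induced by the maps `Γ(Y, 𝒜) ⟶ Γ(V, 𝒜)`. -/
def contraction : D.Xtilde ⟶ D.X :=
  colimit.desc D.glueData.functor
    { pt := D.X
      ι :=
        { app := fun V ↦ Spec.map (CommRingCat.ofHom (D.res (le_top : V.1 ≤ ⊤)))
          naturality := fun V W i ↦ by
            change Spec.map (CommRingCat.ofHom (D.res (Scheme.AffineZariskiSite.toOpens_mono i.le)))
              ≫ Spec.map (CommRingCat.ofHom (D.res (le_top : W.1 ≤ ⊤))) =
              Spec.map (CommRingCat.ofHom (D.res (le_top : V.1 ≤ ⊤))) ≫ 𝟙 _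
            rw [Category.comp_id, ← Spec.map_comp]
            rfl } }

/-- `X` as a scheme over `ℂ`, through `ℂ ⟶ Γ(Y, 𝒪_Y) ⟶ Γ(Y, 𝒜)`. -/
instance : D.X.Over SpecC :=
  ⟨Spec.map ((Scheme.ΓSpecIso (CommRingCat.of ℂ)).inv ≫ (Y ↘ SpecC).appTop ≫
    CommRingCat.ofHom (D.structureMap ⊤))⟩

instance : IsAffine D.X := inferInstanceAs (IsAffine (Spec _))

/-! ### The rational quotient map -/

/-- All coefficients of `𝒟` at the points of `U` are trivial. -/
def IsTrivialOn (U : Y.Opens) : Prop :=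
  ∀ P : closedPoints Y, P.1 ∈ U → D.coeff P = (σ : Set (NQ M))

theorem IsTrivialOn.mem_torusSections {D : PolyhedralDivisor Y σ} {U : Y.Opens}
    (h : D.IsTrivialOn U) {a : AddMonoidAlgebra Y.functionField M} (ha : a ∈ D.sections ⊤) :
    a ∈ torusSections M U := by
  intro u hu
  refine ⟨trivial, fun h0 P hP ↦ ?_⟩
  obtain ⟨h1, h2⟩ := ha u hu
  have h3 := h2 h0 P trivial
  have h4 : D.eval u P ≤ 0 := by
    refine ((D.isPolyhedron P).isLeast h1).2 ⟨0, ?_, by simp⟩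
    rw [h P hP]
    exact σ.zero_mem
  simp only [Pi.zero_apply, add_zero]
  linarith

/-- The morphism `U × T ⟶ X` for an open subset `U` of `Y` on which `𝒟` is trivial: on rings it is
the inclusion `Γ(Y, 𝒜) ⊆ Γ(U, 𝒪_Y)[M]`. -/
def torusToX {U : Y.Opens} (h : D.IsTrivialOn U) : torus M U ⟶ D.X :=
  Spec.map (CommRingCat.ofHom ((Pi.evalRingHom
    (fun _ : (⊤ : Y.Opens) ↦ AddMonoidAlgebra Y.functionField M) ⟨genericPoint Y, trivial⟩).restrict
      (D.sheafSections ⊤) (torusSections M U) (by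
        rintro _ ⟨a, ha, rfl⟩
        exact h.mem_torusSections ha)))

/-- `p : X ⤏ C` is the rational quotient map: for some nonempty affine open `U ⊆ Y` on which `𝒟` is
trivial, `U × T` is an open subscheme of `X`, and on it `p` is the projection
`U × T ⟶ U ⊆ Y ⊆ C`. Here `j : Y ⟶ C` is the inclusion. -/
def IsRationalQuotientMap {C : Scheme.{0}} (j : Y ⟶ C) (p : D.X ⤏ C) : Prop :=
  ∃ (U : Y.Opens) (hU : IsAffineOpen U) (_ : Nonempty U) (h : D.IsTrivialOn U),
    IsOpenImmersion (D.torusToX h) ∧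
    ∃ f : D.X.PartialMap C, f.toRationalMap = p ∧ ∃ g : torus M U ⟶ f.domain,
      g ≫ f.domain.ι = D.torusToX h ∧ g ≫ f.hom = torusProj M hU ≫ j

instance isIntegral_X [Module.Free ℤ M] : IsIntegral D.X := by
  have : TwoUniqueSums M := by
    let b := Module.Free.chooseBasis ℤ M
    exact b.repr.toAddEquiv.twoUniqueSums_iff.mpr inferInstance
  have : IsDomain (D.sheafSections ⊤) := by
    let e : D.sheafSections ⊤ →+* AddMonoidAlgebra Y.functionField M :=
      (Pi.evalRingHom (fun _ : (⊤ : Y.Opens) ↦ AddMonoidAlgebra Y.functionField M)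
        ⟨genericPoint Y, trivial⟩).comp (D.sheafSections ⊤).subtype
    have he : Function.Injective e := by
      rintro ⟨_, a, ha, rfl⟩ ⟨_, b, hb, rfl⟩ hab
      have h1 : a = b := hab
      subst h1
      rfl
    have : IsDomain (AddMonoidAlgebra Y.functionField M) := { }
    exact he.isDomain e
  exact inferInstanceAs (IsIntegral (Spec _))

end PolyhedralDivisor

end Polyhedral

/-! ## Graphs of rational maps and normalization -/

section Graph

variable {X C : Scheme.{0}} [X.Over SpecC] [C.Over SpecC] [IsIntegral X] [C.IsSeparated]
  (p : X ⤏ C) [p.IsOver SpecC]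

/-- The graph `x ↦ (x, p(x))` of a rational map `p : X ⤏ C` over `ℂ`, as a morphism from the domain
of definition of `p` to `X × C`. -/
def graph : (p.toPartialMap.domain : Scheme.{0}) ⟶ pullback (X ↘ SpecC) (C ↘ SpecC) :=
  pullback.lift p.toPartialMap.domain.ι p.toPartialMap.hom (by
    have := p.toPartialMap.isOver_iff (S := SpecC) |>.mp inferInstance
    exact this.symm)

/-- The closure of the graph of `p` in `X × C`, as a closed subset. -/
def graphClosureSet : Closeds (pullback (X ↘ SpecC) (C ↘ SpecC) : Scheme.{0}) :=
  Closeds.closure (Set.range (graph p))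

/-- The closure of the graph of `p` in `X × C`, with its reduced scheme structure. -/
def graphClosure : Scheme.{0} :=
  (Scheme.IdealSheafData.vanishingIdeal (graphClosureSet p)).subscheme

/-- The inclusion of the closure of the graph into `X × C`. -/
def graphClosureι : graphClosure p ⟶ pullback (X ↘ SpecC) (C ↘ SpecC) :=
  (Scheme.IdealSheafData.vanishingIdeal (graphClosureSet p)).subschemeι

instance : IsClosedImmersion (graphClosureι p) :=
  inferInstanceAs (IsClosedImmersion
    (Scheme.IdealSheafData.vanishingIdeal (graphClosureSet p)).subschemeι)

instance : IrreducibleSpace (graphClosure p) := by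
  have : Nonempty p.toPartialMap.domain := p.toPartialMap.dense_domain.nonempty.to_subtype
  have h : IsIrreducible (graphClosureSet p : Set (pullback (X ↘ SpecC) (C ↘ SpecC) : Scheme.{0})) := by
    rw [graphClosureSet, Closeds.coe_closure]
    refine IsIrreducible.closure ?_
    rw [← Set.image_univ]
    exact (IrreducibleSpace.isIrreducible_univ _).image _ (graph p).continuous.continuousOn
  exact Subtype.irreducibleSpace h

instance : IsReduced (graphClosure p) := by
  let I := Scheme.IdealSheafData.vanishingIdeal (graphClosureSet p)
  have (U : I.subschemeCover.openCover.I₀) : IsReduced (I.subschemeCover.openCover.X U) := by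
    have : _root_.IsReduced (_ ⧸ I.ideal U) :=
      (Ideal.isRadical_iff_quotient_reduced _).mp (PrimeSpectrum.isRadical_vanishingIdeal _)
    exact inferInstanceAs (IsReduced (Spec (CommRingCat.of (_ ⧸ I.ideal U))))
  exact IsReduced.of_openCover I.subscheme I.subschemeCover.openCover

instance : IsIntegral (graphClosure p) := isIntegral_of_irreducibleSpace_of_isReduced _

end Graph

/-- The morphism `Spec K(Z) ⟶ Z` from the generic point of an integral scheme. -/
abbrev fromGenericPoint (Z : Scheme.{0}) [IsIntegral Z] : Spec Z.functionField ⟶ Z :=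
  Z.fromSpecStalk (genericPoint Z)

/-- The normalization of an integral scheme `Z`: the relative normalization of `Z` in its function
field. -/
def normalization (Z : Scheme.{0}) [IsIntegral Z] [QuasiSeparatedSpace Z] : Scheme.{0} :=
  (fromGenericPoint Z).normalization

/-- The normalization morphism. -/
def fromNormalization (Z : Scheme.{0}) [IsIntegral Z] [QuasiSeparatedSpace Z] :
    normalization Z ⟶ Z :=
  (fromGenericPoint Z).fromNormalization

section Xdoubleprime

variable {X C : Scheme.{0}} [X.Over SpecC] [C.Over SpecC] [IsIntegral X] [IsAffine X]
  [C.IsSeparated] (p : X ⤏ C) [p.IsOver SpecC]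

instance : QuasiSeparatedSpace (graphClosure p) := by
  have : IsSeparated (C ↘ SpecC) := inferInstance
  exact quasiSeparatedSpace_of_quasiSeparated
    (graphClosureι p ≫ pullback.fst (X ↘ SpecC) (C ↘ SpecC))

/-- `X''`, the normalization of the closure `X'` of the graph of `p`. -/
def Xdd : Scheme.{0} := normalization (graphClosure p)

/-- The morphism `X'' ⟶ X' ⊆ X × C ⟶ X`. -/
def XddToX : Xdd p ⟶ X := fromNormalization _ ≫ graphClosureι p ≫ pullback.fst _ _

/-- The morphism `X'' ⟶ X' ⊆ X × C ⟶ C`. -/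
def XddToC : Xdd p ⟶ C := fromNormalization _ ≫ graphClosureι p ≫ pullback.snd _ _

end Xdoubleprime


end PolyDiv

end

/-!
Write `K` for the function field of `Y`. The generic torus `Spec K[M]` maps compatibly to `X̃`, `X`
and `C`, with dense image in `X̃` and `X`. Bigness provides a homogeneous section whose inversion
turns `Γ(Y, 𝒜)` into `Γ(U, 𝒪)[M]`, so that `U × T` is open in `X` and `X̃ ⟶ X` is birational; as two
rational maps out of `X` agree once they agree on the generic torus, the rational quotient map
exists and is unique.

The morphism `X̃ ⟶ X × C` factors through the graph closure, since it does so on the generic torus.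
It is integral for two reasons. By semiampleness, over each small affine open `V` of `Y` the ring
`Γ(V, 𝒜)` is integral over the ring generated by `Γ(Y, 𝒜)` and `Γ(V, 𝒪)`. Near a point of `C`
outside `Y`, every function on `V ∩ Y` is integral over the ring generated by global functions on
`Y` and functions on `V`, because there are functions on `Y` with their only pole at that point.

Finally `Γ(V, 𝒜)` is cut out of `K[M]` by inequalities on Gauss valuations, and `K[M]` is integrally
closed, so `X̃` is normal. An integral birational morphism from a normal scheme is the normalization
of its target, and two morphisms to `X̃` that agree after composition with a birational morphism
agree when they are dominant.
-/

universe u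

noncomputable section

namespace PolyDiv

/-! ## Gauss valuations on group algebras -/

section GaussValuation

theorem coeff_mul_add_eq_add_sum_erase {R M : Type*} [Semiring R] [AddMonoid M] [DecidableEq M]
    {a b : AddMonoidAlgebra R M} {x y : M} (hx : x ∈ a.coeff.support) (hy : y ∈ b.coeff.support) :
    (a * b).coeff (x + y) = a.coeff x * b.coeff y +
      ∑ z ∈ (a.coeff.support ×ˢ b.coeff.support).erase (x, y),
        if z.1 + z.2 = x + y then a.coeff z.1 * b.coeff z.2 else 0 := by
  have hsum : (a * b).coeff (x + y) = ∑ z ∈ a.coeff.support ×ˢ b.coeff.support,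
      if z.1 + z.2 = x + y then a.coeff z.1 * b.coeff z.2 else 0 := by
    rw [AddMonoidAlgebra.coeff_mul, Finset.sum_product]
    simp only [Finsupp.sum]
  rw [hsum, ← Finset.add_sum_erase _ _ (Finset.mk_mem_product hx hy), if_pos rfl]

variable {K M G : Type*} [Field K] [AddCommMonoid M]
  [AddCommGroup G] [LinearOrder G] [IsOrderedAddMonoid G]

/-- The value of the Gauss valuation attached to a valuation `ν` of `K` and an additive map
`v : M → G` at an element `a = ∑ a_u χ^u` of `K[M]`: the minimum of `ν (a_u) + v u`. -/
def gaussMin (ν : AddValuation K (WithTop G)) (v : M →+ G) (a : AddMonoidAlgebra K M) : WithTop G :=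
  a.coeff.support.inf fun u ↦ ν (a.coeff u) + (v u : G)

variable {ν : AddValuation K (WithTop G)} {v : M →+ G}

theorem le_gaussMin_iff {a : AddMonoidAlgebra K M} {c : WithTop G} :
    c ≤ gaussMin ν v a ↔ ∀ u, c ≤ ν (a.coeff u) + (v u : G) := by
  rw [gaussMin, Finset.le_inf_iff]
  refine ⟨fun h u ↦ ?_, fun h u _ ↦ h u⟩
  by_cases hu : a.coeff u = 0
  · rw [hu, AddValuation.map_zero, WithTop.top_add]
    exact le_top
  · exact h u (Finsupp.mem_support_iff.mpr hu)

theorem gaussMin_le (a : AddMonoidAlgebra K M) (u : M) :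
    gaussMin ν v a ≤ ν (a.coeff u) + (v u : G) :=
  le_gaussMin_iff.mp le_rfl u

variable (ν v) in
theorem gaussMin_zero : gaussMin ν v (0 : AddMonoidAlgebra K M) = ⊤ := by
  simp [gaussMin]

variable (ν v) in
theorem gaussMin_one : gaussMin ν v (1 : AddMonoidAlgebra K M) = 0 := by
  classical
  refine le_antisymm ?_ (le_gaussMin_iff.mpr fun u ↦ ?_)
  · refine (gaussMin_le 1 0).trans ?_
    simp [AddMonoidAlgebra.one_def]
  · rw [AddMonoidAlgebra.one_def, AddMonoidAlgebra.coeff_single, Finsupp.single_apply]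
    split_ifs with h
    · subst h; simp
    · simp

theorem min_gaussMin_le_gaussMin_add (a b : AddMonoidAlgebra K M) :
    min (gaussMin ν v a) (gaussMin ν v b) ≤ gaussMin ν v (a + b) := by
  refine le_gaussMin_iff.mpr fun u ↦ ?_
  rw [AddMonoidAlgebra.coeff_add, Finsupp.add_apply]
  calc min (gaussMin ν v a) (gaussMin ν v b)
      ≤ min (ν (a.coeff u) + (v u : G)) (ν (b.coeff u) + (v u : G)) :=
        min_le_min (gaussMin_le a u) (gaussMin_le b u)
    _ = min (ν (a.coeff u)) (ν (b.coeff u)) + (v u : G) := min_add_add_right _ _ _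
    _ ≤ _ := by gcongr; exact ν.map_add _ _

theorem gaussMin_ne_top {a : AddMonoidAlgebra K M} (ha : a ≠ 0) : gaussMin ν v a ≠ ⊤ := by
  obtain ⟨u, hu⟩ : ∃ u, a.coeff u ≠ 0 := by
    by_contra! h
    exact ha (AddMonoidAlgebra.ext (Finsupp.ext h))
  intro h
  have h1 := gaussMin_le (ν := ν) (v := v) a u
  rw [h, top_le_iff, WithTop.add_eq_top] at h1
  exact h1.elim (fun h ↦ hu (ν.top_iff.mp h)) WithTop.coe_ne_top

variable (ν v) in
/-- The exponents `u` at which the minimum defining `gaussMin ν v a` is attained. -/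
def gaussSupport (a : AddMonoidAlgebra K M) : Finset M :=
  {u ∈ a.coeff.support | ν (a.coeff u) + (v u : G) = gaussMin ν v a}

theorem gaussSupport_nonempty {a : AddMonoidAlgebra K M} (ha : a ≠ 0) :
    (gaussSupport ν v a).Nonempty := by
  have hne : a.coeff.support.Nonempty :=
    Finsupp.support_nonempty_iff.mpr fun h ↦ ha (AddMonoidAlgebra.ext h)
  obtain ⟨u, hu, hmin⟩ := Finset.exists_mem_eq_inf a.coeff.support hne
    fun u ↦ ν (a.coeff u) + ((v u : G) : WithTop G)
  exact ⟨u, Finset.mem_filter.mpr ⟨hu, hmin.symm⟩⟩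

theorem gaussMin_add_gaussMin_le (a b : AddMonoidAlgebra K M) (x y : M) :
    gaussMin ν v a + gaussMin ν v b ≤ ν (a.coeff x * b.coeff y) + (v (x + y) : G) := by
  rw [AddValuation.map_mul, map_add, WithTop.coe_add, add_add_add_comm]
  exact add_le_add (gaussMin_le a x) (gaussMin_le b y)

theorem gaussMin_add_gaussMin_lt {a b : AddMonoidAlgebra K M} {x y : M}
    (hx : x ∈ a.coeff.support) (hy : y ∈ b.coeff.support)
    (hxy : ¬ (x ∈ gaussSupport ν v a ∧ y ∈ gaussSupport ν v b)) :
    gaussMin ν v a + gaussMin ν v b < ν (a.coeff x * b.coeff y) + (v (x + y) : G) := by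
  have ha0 : a ≠ 0 := by rintro rfl; simp at hx
  have hb0 : b ≠ 0 := by rintro rfl; simp at hy
  have ha : gaussMin ν v a ≠ ⊤ := gaussMin_ne_top ha0
  have hb : gaussMin ν v b ≠ ⊤ := gaussMin_ne_top hb0
  rw [AddValuation.map_mul, map_add, WithTop.coe_add, add_add_add_comm]
  by_cases hxa : x ∈ gaussSupport ν v a
  · have hlt := (gaussMin_le (ν := ν) (v := v) b y).lt_of_ne fun h ↦
      hxy ⟨hxa, Finset.mem_filter.mpr ⟨hy, h.symm⟩⟩
    exact WithTop.add_lt_add_of_le_of_lt ha (gaussMin_le a x) hlt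
  · have hlt := (gaussMin_le (ν := ν) (v := v) a x).lt_of_ne fun h ↦
      hxa (Finset.mem_filter.mpr ⟨hx, h.symm⟩)
    exact WithTop.add_lt_add_of_lt_of_le hb hlt (gaussMin_le b y)

theorem gaussMin_add_gaussMin_le_gaussMin_mul (a b : AddMonoidAlgebra K M) :
    gaussMin ν v a + gaussMin ν v b ≤ gaussMin ν v (a * b) := by
  classical
  refine le_gaussMin_iff.mpr fun u ↦ ?_
  have hneg : ((v u : G) : WithTop G) + ((-v u : G) : WithTop G) = 0 := by
    rw [← WithTop.coe_add, add_neg_cancel, WithTop.coe_zero]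
  suffices gaussMin ν v a + gaussMin ν v b + ((-v u : G) : WithTop G) ≤ ν ((a * b).coeff u) by
    calc gaussMin ν v a + gaussMin ν v b
        = gaussMin ν v a + gaussMin ν v b + ((-v u : G) : WithTop G) + (v u : G) := by
          rw [add_assoc, add_comm ((-v u : G) : WithTop G), hneg, add_zero]
      _ ≤ _ := by gcongr
  rw [AddMonoidAlgebra.coeff_mul, Finsupp.sum]
  simp only [Finsupp.sum]
  refine AddValuation.map_le_sum _ fun x _ ↦ AddValuation.map_le_sum _ fun y _ ↦ ?_
  split_ifs with h
  · subst h
    calc gaussMin ν v a + gaussMin ν v b + ((-v (x + y) : G) : WithTop G)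
        ≤ ν (a.coeff x * b.coeff y) + (v (x + y) : G) + ((-v (x + y) : G) : WithTop G) := by
          exact add_le_add (gaussMin_add_gaussMin_le (ν := ν) (v := v) a b x y) le_rfl
      _ = ν (a.coeff x * b.coeff y) := by rw [add_assoc, hneg, add_zero]
  · rw [AddValuation.map_zero]
    exact le_top

/-- Gauss's lemma: since `M` has unique sums, some pair of exponents of minimal value of `a` and `b`
has a sum that no other such pair has, so that the corresponding term of `a * b` cannot cancel. -/
theorem gaussMin_mul [UniqueSums M] (a b : AddMonoidAlgebra K M) :
    gaussMin ν v (a * b) = gaussMin ν v a + gaussMin ν v b := by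
  classical
  refine le_antisymm ?_ (gaussMin_add_gaussMin_le_gaussMin_mul a b)
  obtain rfl | ha := eq_or_ne a 0
  · simp [gaussMin_zero]
  obtain rfl | hb := eq_or_ne b 0
  · simp [gaussMin_zero]
  obtain ⟨x, hx, y, hy, hunique⟩ := UniqueSums.uniqueAdd_of_nonempty
    (gaussSupport_nonempty (ν := ν) (v := v) ha) (gaussSupport_nonempty (ν := ν) (v := v) hb)
  obtain ⟨hxa, hxmin⟩ := Finset.mem_filter.mp hx
  obtain ⟨hyb, hymin⟩ := Finset.mem_filter.mp hy
  have hxy : ν (a.coeff x * b.coeff y) + (v (x + y) : G) = gaussMin ν v a + gaussMin ν v b := by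
    rw [AddValuation.map_mul, map_add, WithTop.coe_add, add_add_add_comm, hxmin, hymin]
  have hfinite : ν (a.coeff x * b.coeff y) ≠ ⊤ :=
    ν.ne_top_iff.mpr
      (mul_ne_zero (Finsupp.mem_support_iff.mp hxa) (Finsupp.mem_support_iff.mp hyb))
  have hcoeff : ν ((a * b).coeff (x + y)) = ν (a.coeff x * b.coeff y) := by
    rw [coeff_mul_add_eq_add_sum_erase hxa hyb]
    refine AddValuation.map_add_eq_of_lt_left _ (AddValuation.map_lt_sum _ hfinite fun z hz ↦ ?_)
    obtain ⟨hz, hzs⟩ := Finset.mem_erase.mp hz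
    obtain ⟨hza, hzb⟩ := Finset.mem_product.mp hzs
    split_ifs with h
    · have hlt := gaussMin_add_gaussMin_lt (ν := ν) (v := v) hza hzb fun ⟨hza', hzb'⟩ ↦
        hz (Prod.ext_iff.mpr (hunique hza' hzb' h))
      rw [← hxy, h] at hlt
      exact lt_of_add_lt_add_right hlt
    · rw [AddValuation.map_zero]
      exact lt_top_iff_ne_top.mpr hfinite
  calc gaussMin ν v (a * b) ≤ ν ((a * b).coeff (x + y)) + (v (x + y) : G) := gaussMin_le _ _
    _ = gaussMin ν v a + gaussMin ν v b := by rw [hcoeff, hxy]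

variable (ν v) in
/-- The Gauss valuation on `K[M]` attached to a valuation of `K` and an additive map `M → G`. -/
def gaussValuation [UniqueSums M] : AddValuation (AddMonoidAlgebra K M) (WithTop G) :=
  AddValuation.of (gaussMin ν v) (gaussMin_zero ν v) (gaussMin_one ν v)
    min_gaussMin_le_gaussMin_add gaussMin_mul

theorem gaussMin_nonneg_of_isIntegral [UniqueSums M] {R : Subring (AddMonoidAlgebra K M)}
    (hR : ∀ a ∈ R, 0 ≤ gaussMin ν v a) {a : AddMonoidAlgebra K M} (ha : IsIntegral R a) :
    0 ≤ gaussMin ν v a := by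
  let V := AddValuation.toValuation (gaussValuation ν v)
  have hle : R ≤ V.integer := hR
  have haV : IsIntegral V.integer a := by
    obtain ⟨p, hp, hpa⟩ := ha
    refine ⟨p.map (Subring.inclusion hle), hp.map _, ?_⟩
    rw [Polynomial.eval₂_map]
    exact hpa
  exact (Valuation.integer.integers V).mem_of_integral haV

end GaussValuation

/-! ## Interior points of the dual of a pointed polyhedral cone -/

section PositivelyIndependent

variable {𝕜 E ι : Type*} [Field 𝕜] [LinearOrder 𝕜] [AddCommGroup E] [Module 𝕜 E]
  {s : Finset ι} {f : ι → E}

variable (𝕜) in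
/-- The vectors `f i` with `i ∈ s` satisfy no nontrivial linear relation with nonnegative
coefficients, as in Gordan's theorem of the alternative. -/
def IsPositivelyIndependent (s : Finset ι) (f : ι → E) : Prop :=
  ∀ c : ι → 𝕜, (∀ i ∈ s, 0 ≤ c i) → ∑ i ∈ s, c i • f i = 0 → ∀ i ∈ s, c i = 0

theorem IsPositivelyIndependent.eq_zero_of_insert [DecidableEq ι] {a : ι}
    (h : IsPositivelyIndependent 𝕜 (insert a s) f) (ha : a ∉ s) {c : ι → 𝕜} {d : 𝕜}
    (hc : ∀ i ∈ s, 0 ≤ c i) (hd : 0 ≤ d) (hsum : d • f a + ∑ i ∈ s, c i • f i = 0) :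
    d = 0 ∧ ∀ i ∈ s, c i = 0 := by
  have hne {i : ι} (hi : i ∈ s) : i ≠ a := ne_of_mem_of_not_mem hi ha
  have hzero := h (Function.update c a d)
    (Finset.forall_mem_insert _ _ _ |>.mpr
      ⟨by simpa using hd, fun i hi ↦ by simpa [hne hi] using hc i hi⟩)
    (by
      rw [Finset.sum_insert ha, ← hsum, Function.update_self]
      congr 1
      exact Finset.sum_congr rfl fun i hi ↦ by rw [Function.update_of_ne (hne hi)])
  rw [Finset.forall_mem_insert, Function.update_self] at hzero
  exact ⟨hzero.1, fun i hi ↦ by simpa [hne hi] using hzero.2 i hi⟩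

theorem IsPositivelyIndependent.of_insert [DecidableEq ι] {a : ι}
    (h : IsPositivelyIndependent 𝕜 (insert a s) f) (ha : a ∉ s) :
    IsPositivelyIndependent 𝕜 s f := fun _ hc hsum ↦
  (h.eq_zero_of_insert ha hc le_rfl (by rwa [zero_smul, zero_add])).2

variable [IsStrictOrderedRing 𝕜]

theorem IsPositivelyIndependent.ne_zero_of_insert [DecidableEq ι] {a : ι}
    (h : IsPositivelyIndependent 𝕜 (insert a s) f) (ha : a ∉ s) : f a ≠ 0 := fun h0 ↦
  one_ne_zero (h.eq_zero_of_insert (c := 0) (d := 1) ha (fun _ _ ↦ le_rfl) zero_le_one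
    (by simp [h0])).1

/-- Fourier–Motzkin elimination of the vector `f a`. -/
theorem IsPositivelyIndependent.eliminate [DecidableEq ι] {a : ι}
    (h : IsPositivelyIndependent 𝕜 (insert a s) f) (ha : a ∉ s) {φ : E →ₗ[𝕜] 𝕜}
    (hφ : ∀ i ∈ s, 0 < φ (f i)) (hφa : φ (f a) ≤ 0) :
    IsPositivelyIndependent 𝕜 s fun i ↦ (-φ (f a)) • f i + φ (f i) • f a := by
  intro c hc hsum
  have hnonneg : ∀ i ∈ s, 0 ≤ c i * φ (f i) := fun i hi ↦ mul_nonneg (hc i hi) (hφ i hi).le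
  have hzero := h.eq_zero_of_insert (c := fun i ↦ c i * -φ (f a)) (d := ∑ i ∈ s, c i * φ (f i)) ha
    (fun i hi ↦ mul_nonneg (hc i hi) (neg_nonneg.mpr hφa)) (Finset.sum_nonneg hnonneg) (by
      rw [← hsum, Finset.sum_smul, ← Finset.sum_add_distrib]
      refine Finset.sum_congr rfl fun i _ ↦ ?_
      rw [smul_add, smul_smul, smul_smul, add_comm])
  intro i hi
  have hi0 := (Finset.sum_eq_zero_iff_of_nonneg hnonneg).mp hzero.1 i hi
  exact (mul_eq_zero.mp hi0).resolve_right (hφ i hi).ne'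

theorem isPositivelyIndependent_id_of_salient {C : PointedCone 𝕜 E}
    (hC : (C : ConvexCone 𝕜 E).Salient) {s : Finset E} (hs : ∀ v ∈ s, v ∈ C ∧ v ≠ 0) :
    IsPositivelyIndependent 𝕜 s id := by
  classical
  intro c hc hsum v hv
  by_contra hcv
  have hpos : 0 < c v := (hc v hv).lt_of_ne' hcv
  have hrest : ∑ w ∈ s.erase v, c w • w ∈ C := Submodule.sum_mem _ fun w hw ↦
    C.smul_mem (hc w (Finset.mem_of_mem_erase hw)) (hs w (Finset.mem_of_mem_erase hw)).1
  have hneg : -v = (c v)⁻¹ • ∑ w ∈ s.erase v, c w • w := by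
    simp only [id_eq] at hsum
    rw [← Finset.add_sum_erase _ _ hv, ← neg_eq_iff_add_eq_zero] at hsum
    rw [← hsum, smul_neg, inv_smul_smul₀ hcv]
  refine hC v (hs v hv).1 (hs v hv).2 ?_
  rw [hneg]
  exact C.smul_mem (inv_nonneg.mpr hpos.le) hrest

end PositivelyIndependent

section Cones

variable {M : Type} [AddCommGroup M]

theorem exists_lattice_combination (x y : M) (t : ℚ) :
    ∃ w : M, ∃ q : ℚ, 0 < q ∧ ∀ g : NQ M, g w = q * (g x + t * g y) := by
  refine ⟨t.den • x + t.num • y, t.den, by exact_mod_cast t.pos, fun g ↦ ?_⟩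
  rw [map_add, map_nsmul, map_zsmul, nsmul_eq_mul, zsmul_eq_mul, mul_add, ← mul_assoc,
    Rat.den_mul_eq_num]

theorem exists_pos_of_ne_zero {g : NQ M} (hg : g ≠ 0) : ∃ u : M, 0 < g u := by
  obtain ⟨u, hu⟩ := DFunLike.ne_iff.mp hg
  obtain hlt | hgt := lt_or_gt_of_ne hu
  · exact ⟨-u, by simpa using hlt⟩
  · exact ⟨u, hgt⟩

variable {ι : Type*} {s : Finset ι} {f : ι → NQ M}

theorem exists_forall_insert_pos_of_eq_zero [DecidableEq ι] {a : ι} {u : M}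
    (hu : ∀ i ∈ s, 0 < f i u) (hau : f a u = 0) (ha : f a ≠ 0) :
    ∃ w : M, ∀ i ∈ insert a s, 0 < f i w := by
  obtain ⟨x, hx⟩ := exists_pos_of_ne_zero ha
  obtain ⟨t, ht, -⟩ := Order.exists_between_finsets (s.image fun i ↦ -(f i x) / f i u) ∅ (by simp)
  obtain ⟨w, q, hq, hw⟩ := exists_lattice_combination x u t
  refine ⟨w, Finset.forall_mem_insert _ _ _ |>.mpr ⟨?_, fun i hi ↦ ?_⟩⟩
  · rw [hw, hau, mul_zero, add_zero]
    exact mul_pos hq hx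
  · have hi' := (div_lt_iff₀ (hu i hi)).mp (ht _ (Finset.mem_image_of_mem _ hi))
    rw [hw]
    exact mul_pos hq (by linarith)

theorem exists_forall_insert_pos_of_neg [DecidableEq ι] {a : ι} {u x : M}
    (hu : ∀ i ∈ s, 0 < f i u) (hau : f a u < 0)
    (hx : ∀ i ∈ s, 0 < -(f a u) * f i x + f i u * f a x) :
    ∃ w : M, ∀ i ∈ insert a s, 0 < f i w := by
  have hau' : 0 < -(f a u) := neg_pos.mpr hau
  obtain ⟨t, hlow, hhigh⟩ := Order.exists_between_finsets (s.image fun i ↦ -(f i x) / f i u)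
    {f a x / -(f a u)} (by
      simp only [Finset.mem_image, Finset.mem_singleton]
      rintro _ ⟨i, hi, rfl⟩ _ rfl
      rw [div_lt_div_iff₀ (hu i hi) hau']
      linarith [hx i hi])
  obtain ⟨w, q, hq, hw⟩ := exists_lattice_combination x u t
  refine ⟨w, Finset.forall_mem_insert _ _ _ |>.mpr ⟨?_, fun i hi ↦ ?_⟩⟩
  · have ha := (lt_div_iff₀ hau').mp (hhigh _ (Finset.mem_singleton_self _))
    rw [hw]
    exact mul_pos hq (by linarith)
  · have hi' := (div_lt_iff₀ (hu i hi)).mp (hlow _ (Finset.mem_image_of_mem _ hi))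
    rw [hw]
    exact mul_pos hq (by linarith)

theorem IsPositivelyIndependent.exists_forall_pos (hs : IsPositivelyIndependent ℚ s f) :
    ∃ u : M, ∀ i ∈ s, 0 < f i u := by
  classical
  induction s using Finset.induction generalizing f with
  | empty => exact ⟨0, by simp⟩
  | insert a s ha ih =>
    obtain ⟨u, hu⟩ := ih (hs.of_insert ha)
    obtain hau | hau | hau := lt_trichotomy (f a u) 0
    · let φ : NQ M →ₗ[ℚ] ℚ := LinearMap.applyₗ' ℚ u
      obtain ⟨x, hx⟩ := ih (hs.eliminate ha (φ := φ) hu hau.le)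
      exact exists_forall_insert_pos_of_neg hu hau hx
    · exact exists_forall_insert_pos_of_eq_zero hu hau (hs.ne_zero_of_insert ha)
    · exact ⟨u, Finset.forall_mem_insert _ _ _ |>.mpr ⟨hau, hu⟩⟩

theorem mem_weightMonoid_span_iff {s : Set (NQ M)} {u : M} :
    u ∈ weightMonoid (Submodule.span {c : ℚ // 0 ≤ c} s : PointedCone ℚ (NQ M)) ↔
      ∀ v ∈ s, 0 ≤ v u := by
  refine ⟨fun h v hv ↦ h v (Submodule.subset_span hv), fun h v hv ↦ ?_⟩
  induction hv using Submodule.span_induction with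
  | mem v hv => exact h v hv
  | zero => simp
  | add v w _ _ hv hw => exact add_nonneg hv hw
  | smul c v _ hv => exact mul_nonneg c.2 hv

theorem eventually_nonneg_nsmul_add {v : NQ M} {u : M} (hv : v ≠ 0 → 0 < v u) (w : M) :
    ∀ᶠ k : ℕ in Filter.atTop, 0 ≤ v (k • u + w) := by
  obtain rfl | hv0 := eq_or_ne v 0
  · simp
  obtain ⟨n, hn⟩ := exists_nat_ge (-(v w) / v u)
  filter_upwards [Filter.eventually_ge_atTop n] with k hk
  have hle : -(v w) / v u ≤ k := hn.trans (by exact_mod_cast hk)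
  rw [div_le_iff₀ (hv hv0)] at hle
  rw [map_add, map_nsmul, nsmul_eq_mul]
  linarith

theorem exists_mem_interiorWeights {σ : PointedCone ℚ (NQ M)} (hσ : σ.FG)
    (hσ' : (σ : ConvexCone ℚ (NQ M)).Salient) :
    ∃ u ∈ interiorWeights σ, ∀ w : M, ∀ᶠ k : ℕ in Filter.atTop, k • u + w ∈ weightMonoid σ := by
  classical
  obtain ⟨s, rfl⟩ := hσ
  obtain ⟨u, hu⟩ := (isPositivelyIndependent_id_of_salient hσ' (s := s.erase 0) fun v hv ↦
    ⟨Submodule.subset_span (Finset.mem_of_mem_erase hv),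
      Finset.ne_of_mem_erase hv⟩).exists_forall_pos
  have hpos (v : NQ M) (hv : v ∈ s) (hv0 : v ≠ 0) : 0 < v u := hu v (Finset.mem_erase.mpr ⟨hv0, hv⟩)
  have heventually (w : M) : ∀ᶠ k : ℕ in Filter.atTop,
      k • u + w ∈ weightMonoid (Submodule.span {c : ℚ // 0 ≤ c} (s : Set (NQ M))) := by
    simp only [mem_weightMonoid_span_iff]
    exact (Filter.eventually_all_finset s).mpr fun v hv ↦ eventually_nonneg_nsmul_add (hpos v hv) w
  refine ⟨u, ⟨mem_weightMonoid_span_iff.mpr fun v hv ↦ ?_, fun w _ ↦ ?_⟩, heventually⟩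
  · obtain rfl | hv0 := eq_or_ne v 0
    · simp
    · exact (hpos v hv hv0).le
  · obtain ⟨n, hn⟩ := (heventually (-w)).exists
    exact ⟨n, by rwa [sub_eq_add_neg]⟩

end Cones

/-! ## Group algebras of lattices are normal -/

section Laurent

open AddMonoidAlgebra

theorem twoUniqueSums_of_free (M : Type*) [AddCommGroup M] [Module.Free ℤ M] : TwoUniqueSums M :=
  (Module.Free.chooseBasis ℤ M).repr.toAddEquiv.twoUniqueSums_iff.mpr inferInstance

variable (R ι : Type*) [CommRing R]

/-- The inclusion of the polynomial ring into the Laurent polynomial ring in the same variables. -/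
def mvPolynomialToLaurent : MvPolynomial ι R →+* AddMonoidAlgebra R (ι →₀ ℤ) :=
  mapDomainRingHom R (Finsupp.mapRange.addMonoidHom (Nat.castAddMonoidHom ℤ))

variable {R ι} in
theorem mvPolynomialToLaurent_monomial (m : ι →₀ ℕ) (r : R) :
    mvPolynomialToLaurent R ι (MvPolynomial.monomial m r) =
      single (m.mapRange (Nat.cast : ℕ → ℤ) Nat.cast_zero) r :=
  mapDomain_single

theorem mvPolynomialToLaurent_injective : Function.Injective (mvPolynomialToLaurent R ι) :=
  mapDomain_injective (Finsupp.mapRange_injective _ Nat.cast_zero Nat.cast_injective)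

theorem mem_mrange_monomialOneHom (m : ι →₀ ℕ) :
    MvPolynomial.monomial m 1 ∈ MonoidHom.mrange (MvPolynomial.monomialOneHom R ι) :=
  ⟨Multiplicative.ofAdd m, rfl⟩

variable {R ι} in
theorem exists_mul_monomial_eq (a : AddMonoidAlgebra R (ι →₀ ℤ)) :
    ∃ (x : MvPolynomial ι R) (m : ι →₀ ℕ),
      a * mvPolynomialToLaurent R ι (MvPolynomial.monomial m 1) = mvPolynomialToLaurent R ι x := by
  induction a using AddMonoidAlgebra.induction_linear with
  | zero => exact ⟨0, 0, by simp⟩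
  | add a b ha hb =>
    obtain ⟨x, m, hx⟩ := ha
    obtain ⟨y, n, hy⟩ := hb
    refine ⟨x * MvPolynomial.monomial n 1 + y * MvPolynomial.monomial m 1, m + n, ?_⟩
    rw [← one_mul (1 : R), ← MvPolynomial.monomial_mul]
    simp only [map_add, map_mul, mul_one, ← hx, ← hy]
    ring
  | single m r =>
    refine ⟨MvPolynomial.monomial (m.mapRange Int.toNat rfl) r,
      m.mapRange (fun z ↦ (-z).toNat) rfl, ?_⟩
    rw [mvPolynomialToLaurent_monomial, mvPolynomialToLaurent_monomial, single_mul_single, mul_one]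
    congr 1
    ext i
    simp only [Finsupp.coe_add, Pi.add_apply, Finsupp.mapRange_apply]
    omega

theorem isLocalization_mvPolynomialToLaurent :
    letI := (mvPolynomialToLaurent R ι).toAlgebra
    IsLocalization (MonoidHom.mrange (MvPolynomial.monomialOneHom R ι))
      (AddMonoidAlgebra R (ι →₀ ℤ)) := by
  let := (mvPolynomialToLaurent R ι).toAlgebra
  refine ⟨⟨?_, fun a ↦ ?_, fun h ↦ ⟨1, by rw [mvPolynomialToLaurent_injective R ι h]⟩⟩⟩
  · rintro ⟨_, m, rfl⟩
    change IsUnit (mvPolynomialToLaurent R ι (MvPolynomial.monomial m.toAdd 1))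
    rw [mvPolynomialToLaurent_monomial]
    refine IsUnit.of_mul_eq_one (single (-m.toAdd.mapRange (Nat.cast : ℕ → ℤ) Nat.cast_zero) 1) ?_
    rw [single_mul_single, add_neg_cancel, one_mul, AddMonoidAlgebra.one_def]
  · obtain ⟨x, m, h⟩ := exists_mul_monomial_eq a
    exact ⟨(x, ⟨_, mem_mrange_monomialOneHom R ι m⟩), h⟩

variable [IsDomain R] [UniqueFactorizationMonoid R]

theorem isIntegrallyClosed_laurent : IsIntegrallyClosed (AddMonoidAlgebra R (ι →₀ ℤ)) := by
  let := (mvPolynomialToLaurent R ι).toAlgebra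
  have := isLocalization_mvPolynomialToLaurent R ι
  refine isIntegrallyClosed_of_isLocalization (R := MvPolynomial ι R) _
    (MonoidHom.mrange (MvPolynomial.monomialOneHom R ι)) ?_
  rintro _ ⟨m, rfl⟩
  exact mem_nonZeroDivisors_of_ne_zero (MvPolynomial.monomial_eq_zero.not.mpr one_ne_zero)

theorem isIntegrallyClosed_addMonoidAlgebra (M : Type*) [AddCommGroup M] [Module.Free ℤ M] :
    IsIntegrallyClosed (AddMonoidAlgebra R M) :=
  have := isIntegrallyClosed_laurent R (Module.Free.ChooseBasisIndex ℤ M)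
  .of_equiv (domCongr R R (Module.Free.chooseBasis ℤ M).repr.symm.toAddEquiv).toRingEquiv

end Laurent

/-! ## Functions with a single pole -/

section Pole

open Polynomial Filter

theorem dimensionLEOne_of_isIntegral (A B : Type*) [CommRing A] [CommRing B] [Algebra A B]
    [FaithfulSMul A B] [Algebra.IsIntegral A B] [Ring.DimensionLEOne B] :
    Ring.DimensionLEOne A where
  maximalOfPrime {p} hp0 hp := by
    have hinj := (RingHom.injective_iff_ker_eq_bot _).mp (FaithfulSMul.algebraMap_injective A B)
    obtain ⟨Q, -, hQ, rfl⟩ := Ideal.exists_ideal_over_prime_of_isIntegral p (⊥ : Ideal B) (by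
      rw [← RingHom.ker_eq_comap_bot, hinj]
      exact bot_le)
    have hQ0 : Q ≠ ⊥ := by
      rintro rfl
      exact hp0 (by rw [← RingHom.ker_eq_comap_bot, hinj])
    have := hQ.isMaximal hQ0
    exact Ideal.isMaximal_comap_of_isIntegral_of_isMaximal Q

theorem card_le_one_of_dimensionLEOne_mvPolynomial (k ι : Type*) [Field k] [Finite ι]
    [Ring.DimensionLEOne (MvPolynomial ι k)] : Nat.card ι ≤ 1 := by
  have hdim : ringKrullDim (MvPolynomial ι k) ≤ 1 := Order.KrullDimLE.krullDim_le
  rw [MvPolynomial.ringKrullDim_of_isNoetherianRing, ringKrullDim_eq_zero_of_field, zero_add]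
    at hdim
  exact_mod_cast hdim

variable {k : Type*} [Field k]

theorem exists_finite_aeval (k B : Type*) [Field k] [CommRing B] [IsDomain B] [Algebra k B]
    [Algebra.FiniteType k B] [Ring.DimensionLEOne B] (hB : ¬ IsField B) :
    ∃ x : B, Function.Injective (aeval (R := k) x) ∧ (aeval (R := k) x).Finite := by
  obtain ⟨n, g, hg, hfin⟩ := exists_finite_inj_algHom_of_fg k B
  algebraize [g.toRingHom]
  have : Module.Finite (MvPolynomial (Fin n) k) B := hfin
  have : FaithfulSMul (MvPolynomial (Fin n) k) B :=
    (faithfulSMul_iff_algebraMap_injective _ _).mpr hg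
  have := dimensionLEOne_of_isIntegral (MvPolynomial (Fin n) k) B
  have hn := card_le_one_of_dimensionLEOne_mvPolynomial k (Fin n)
  rw [Nat.card_fin] at hn
  interval_cases n
  · refine absurd (isField_of_isIntegral_of_isField' (R := MvPolynomial (Fin 0) k) ?_) hB
    exact (MvPolynomial.isEmptyAlgEquiv k (Fin 0)).toMulEquiv.isField (Field.toIsField k)
  · let e := (MvPolynomial.uniqueAlgEquiv k (Fin 1)).symm
    have he : aeval (g (e X)) = g.comp e := algHom_ext (by simp)
    refine ⟨g (e X), ?_, ?_⟩
    · rw [he]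
      exact hg.comp e.injective
    · rw [he]
      exact hfin.comp (.of_surjective e.toAlgHom e.surjective)

theorem isIntegralElem_of_aeval_eq {R A : Type*} [CommRing R] [Nontrivial R] [CommRing A]
    [Algebra k R] [Algebra k A] (i : R →ₐ[k] A) {f : k[X]} (hf : f.natDegree ≠ 0) {x : A} {r : R}
    (h : aeval x f = i r) : i.toRingHom.IsIntegralElem x := by
  algebraize [i.toRingHom]
  have hf0 : f ≠ 0 := ne_zero_of_natDegree_gt (Nat.pos_of_ne_zero hf)
  have hc0 : f.leadingCoeff⁻¹ ≠ 0 := inv_ne_zero (leadingCoeff_ne_zero.mpr hf0)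
  have hmonic := monic_mul_leadingCoeff_inv hf0
  refine IsIntegral.of_aeval_monic (R := R) (hmonic.map (algebraMap k R)) ?_ ?_
  · rwa [hmonic.natDegree_map, natDegree_mul_C hc0]
  · rw [aeval_map_algebraMap, map_mul, h, aeval_C, ← i.commutes, ← map_mul]
    exact isIntegral_algebraMap

theorem finite_aeval_of_natDegree_ne_zero {q : k[X]} (hq : q.natDegree ≠ 0) :
    (aeval (R := k) q).Finite := by
  have hX : (aeval (R := k) q).toRingHom.IsIntegralElem X :=
    isIntegralElem_of_aeval_eq (aeval q) hq (aeval_X_left_apply q |>.trans (aeval_X q).symm)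
  refine RingHom.IsIntegral.to_finite (fun f ↦ ?_) ?_
  · induction f using Polynomial.induction_on with
    | C a =>
      have := RingHom.isIntegralElem_map (aeval (R := k) q).toRingHom (x := C a)
      rwa [show (aeval (R := k) q).toRingHom (C a) = C a from aeval_C q a] at this
    | add f g hf hg => exact hf.add _ hg
    | monomial n a h =>
      rw [pow_succ, ← mul_assoc]
      exact h.mul _ hX
  · refine RingHom.FiniteType.of_comp_finiteType (f := algebraMap k k[X]) ?_
    rw [show (aeval (R := k) q).toRingHom.comp (algebraMap k k[X]) = algebraMap k k[X] from
      (aeval (R := k) q).comp_algebraMap]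
    exact RingHom.finiteType_algebraMap.mpr inferInstance

/-- By Noether normalization `B` is finite over some `k[x]`, and the ideal `(t)` meets `k[x]` in a
nonzero polynomial. -/
theorem exists_mul_ne_zero_and_finite_aeval {B : Type*} [CommRing B] [IsDomain B] [Algebra k B]
    [Algebra.FiniteType k B] [Ring.DimensionLEOne B] {t : B} (ht0 : t ≠ 0) (ht : ¬ IsUnit t) :
    ∃ a : B, a * t ≠ 0 ∧ (aeval (R := k) (a * t)).Finite := by
  obtain ⟨x, hinj, hfin⟩ := exists_finite_aeval k B fun h ↦
    ht (isUnit_iff_exists_inv.mpr (h.mul_inv_cancel ht0))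
  algebraize [(aeval (R := k) x).toRingHom]
  obtain ⟨q, hq, hq0⟩ := Submodule.exists_mem_ne_zero_of_ne_bot <|
    Ideal.comap_ne_bot_of_integral_mem (R := k[X]) ht0 (Ideal.mem_span_singleton_self t)
      (RingHom.Finite.to_isIntegral hfin t)
  obtain ⟨a, ha : a * t = aeval x q⟩ := Ideal.mem_span_singleton'.mp hq
  have hqdeg : q.natDegree ≠ 0 := by
    intro h
    obtain ⟨c, rfl⟩ := natDegree_eq_zero.mp h
    have hc : IsUnit (algebraMap k B c) := (IsUnit.mk0 c (by simpa using hq0)).map _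
    rw [aeval_C] at ha
    exact ht (isUnit_of_mul_isUnit_right (ha ▸ hc))
  refine ⟨a, ?_, ?_⟩
  · rw [ha]
    exact (map_ne_zero_iff _ hinj).mpr hq0
  · have : aeval (a * t) = (aeval (R := k) x).comp (aeval q) := algHom_ext (by simp [ha])
    rw [this]
    exact hfin.comp (finite_aeval_of_natDegree_ne_zero hqdeg)

theorem eventually_isIntegralElem_inv_pow_mul {R A : Type*} [CommRing R] [CommRing A] [Algebra R A]
    (w : Aˣ) {x : A} (hx : (aeval (R := R) w.val).toRingHom.IsIntegralElem x) :
    ∀ᶠ n : ℕ in atTop,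
      (aeval (R := R) w⁻¹.val).toRingHom.IsIntegralElem (w⁻¹.val ^ n * x) := by
  let φ : LaurentPolynomial R →+* A := LaurentPolynomial.eval₂ (algebraMap R A) w⁻¹
  have hφ : φ.IsIntegralElem x := by
    let f : R[X] →+* LaurentPolynomial R :=
      (LaurentPolynomial.invert (R := R)).toRingEquiv.toRingHom.comp toLaurent
    have hcomp : φ.comp f = (aeval (R := R) w.val).toRingHom := by
      ext <;> simp [φ, f]
    exact RingHom.IsIntegralElem.of_comp (f := f) (hcomp ▸ hx)
  let _ : Algebra R[X] A := (aeval (R := R) w⁻¹.val).toRingHom.toAlgebra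
  let _ : Algebra (LaurentPolynomial R) A := φ.toAlgebra
  have _ : IsScalarTower R[X] (LaurentPolynomial R) A := .of_algebraMap_eq fun p ↦
    (LaurentPolynomial.eval₂_toLaurent (algebraMap R A) w⁻¹ p).symm
  obtain ⟨⟨_, m, rfl⟩, hm⟩ :=
    IsIntegral.exists_multiple_integral_of_isLocalization (Submonoid.powers (X : R[X])) x hφ
  filter_upwards [eventually_ge_atTop m] with n hn
  obtain ⟨l, rfl⟩ := Nat.exists_eq_add_of_le' hn
  have hsmul : w⁻¹.val ^ (l + m) * x = (X : R[X]) ^ l • (X : R[X]) ^ m • x := by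
    rw [smul_smul, ← pow_add, Algebra.smul_def]
    exact congrArg (· * x) (aeval_X_pow w⁻¹.val).symm
  rw [hsmul]
  exact hm.smul _

/-- The elements of `A` that are integral over `R[z]`. -/
def integralSubmodule (R : Type*) {A : Type*} [CommRing R] [CommRing A] [Algebra R A] (z : A) :
    Submodule R A where
  carrier := {x | (aeval (R := R) z).toRingHom.IsIntegralElem x}
  add_mem' hx hy := hx.add _ hy
  zero_mem' := RingHom.isIntegralElem_zero _
  smul_mem' c x hx := by
    have hc := RingHom.isIntegralElem_map (aeval (R := R) z).toRingHom (x := C c)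
    rw [Algebra.smul_def, ← aeval_C z]
    exact hc.mul _ hx

theorem isIntegralElem_aeval_coe {R A : Type*} [CommRing R] [CommRing A] [Algebra R A]
    {B : Subalgebra R A} {v : B} (hv : (aeval (R := R) v).Finite) (y : B) :
    (aeval (R := R) (v : A)).toRingHom.IsIntegralElem (y : A) := by
  have hcomp : (aeval (R := R) (v : A)).toRingHom =
      B.val.toRingHom.comp (aeval (R := R) v).toRingHom :=
    RingHom.ext fun p ↦ aeval_algebraMap_apply A v p
  rw [hcomp]
  exact (RingHom.Finite.to_isIntegral hv y).map B.val.toRingHom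

theorem exists_finite_forall_inv_pow_mul_mem {R A : Type*} [CommRing R] [CommRing A] [Algebra R A]
    {B : Subalgebra R A} {v : B} (hv : (aeval (R := R) v).Finite) {w : Aˣ} (hw : w.val = v) :
    ∃ F : Set A, F.Finite ∧ ∀ (n : ℕ) (y : B), w⁻¹.val ^ n * y ∈
      B.toSubmodule ⊔ integralSubmodule R w⁻¹.val ⊔ Submodule.span R F := by
  algebraize [(aeval (R := R) v).toRingHom]
  obtain ⟨E, hE⟩ : (⊤ : Submodule R[X] B).FG := hv.fg_top
  have hint (e : B) :
      ∀ᶠ n : ℕ in cofinite, w⁻¹.val ^ n * (e : A) ∈ integralSubmodule R w⁻¹.val := by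
    rw [Nat.cofinite_eq_atTop]
    exact eventually_isIntegralElem_inv_pow_mul w (hw ▸ isIntegralElem_aeval_coe hv e)
  let F : Set A := ⋃ e ∈ E, (fun n : ℕ ↦ w⁻¹.val ^ n * (e : A)) ''
    {n | w⁻¹.val ^ n * (e : A) ∉ integralSubmodule R w⁻¹.val}
  refine ⟨F, E.finite_toSet.biUnion fun e _ ↦ (hint e).image _, fun n y ↦ ?_⟩
  have hy : y ∈ Submodule.span R[X] (E : Set B) := hE ▸ Submodule.mem_top
  induction hy using Submodule.span_induction generalizing n with
  | mem e he =>
    by_cases hn : w⁻¹.val ^ n * (e : A) ∈ integralSubmodule R w⁻¹.val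
    · exact Submodule.mem_sup_left (Submodule.mem_sup_right hn)
    · exact Submodule.mem_sup_right (Submodule.subset_span (Set.mem_biUnion he ⟨n, hn, rfl⟩))
  | zero => simp
  | add y z _ _ hy hz => exact mul_add (w⁻¹.val ^ n) (y : A) z ▸ add_mem (hy n) (hz n)
  | smul f y _ hy =>
    have hsmul (f : R[X]) : f • y = aeval v f * y := rfl
    induction f using Polynomial.induction_on generalizing n with
    | C a =>
      rw [hsmul, aeval_C, ← Algebra.smul_def, Subalgebra.coe_smul, mul_smul_comm]
      exact Submodule.smul_mem _ a (hy n)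
    | add f g hf hg =>
      rw [add_smul, Subalgebra.coe_add, mul_add]
      exact add_mem (hf n) (hg n)
    | monomial m a h =>
      have hstep : ((C a * X ^ (m + 1)) • y : B) = v * ((C a * X ^ m) • y) := by
        simp only [hsmul, map_mul, map_pow, aeval_X]
        ring
      rw [hstep]
      cases n with
      | zero =>
        rw [pow_zero, one_mul]
        exact Submodule.mem_sup_left (Submodule.mem_sup_left (SetLike.coe_mem _))
      | succ n =>
        rw [Subalgebra.coe_mul, ← hw, pow_succ, mul_assoc, Units.inv_mul_cancel_left]
        exact h n

theorem mem_of_isIntegralElem {R K : Type*} [CommRing R] [Field K] (O : ValuationSubring K)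
    {f : R →+* K} (hf : ∀ r, f r ∈ O) {x : K} (hx : f.IsIntegralElem x) : x ∈ O := by
  obtain ⟨p, hp, hpx⟩ := hx
  have hint : IsIntegral O x := ⟨p.map (f.codRestrict O.toSubring hf), hp.map _, by
    rw [eval₂_map]
    exact hpx⟩
  obtain ⟨y, rfl⟩ := IsIntegrallyClosed.isIntegral_iff.mp hint
  exact y.2

section

variable {K : Type*} [Field K] [Algebra k K]

theorem aeval_mem_valuationSubring {O : ValuationSubring K} (hO : ∀ c : k, algebraMap k K c ∈ O)
    {x : K} (hx : x ∈ O) (f : k[X]) : aeval x f ∈ O := by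
  rw [aeval_eq_sum_range]
  refine sum_mem fun n _ ↦ ?_
  rw [Algebra.smul_def]
  exact mul_mem (hO _) (pow_mem hx n)

theorem exists_natDegree_ne_zero_aeval_mem {A : Type*} [CommRing A] [Algebra k A] (y : A)
    (L : Submodule k A) {F : Set A} (hF : F.Finite) (h : ∀ n : ℕ, y ^ n ∈ L ⊔ Submodule.span k F) :
    ∃ f : k[X], f.natDegree ≠ 0 ∧ aeval y f ∈ L := by
  let W : Submodule k (A ⧸ L) := (Submodule.span k F).map L.mkQ
  have : FiniteDimensional k (Submodule.span k F) := FiniteDimensional.span_of_finite k hF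
  have hW (n : ℕ) : L.mkQ (y ^ (n + 1)) ∈ W := by
    have := Submodule.mem_map_of_mem (f := L.mkQ) (h (n + 1))
    rwa [Submodule.map_sup, Submodule.mkQ_map_self, bot_sup_eq] at this
  have hdep : ¬ LinearIndependent k fun n : ℕ ↦ (⟨_, hW n⟩ : W) := fun hli ↦
    have := hli.finite
    not_finite ℕ
  obtain ⟨s, g, hs, i, hi, hgi⟩ := not_linearIndependent_iff.mp hdep
  refine ⟨∑ n ∈ s, monomial (n + 1) (g n), ?_, ?_⟩
  · have hcoeff : (∑ n ∈ s, monomial (n + 1) (g n)).coeff (i + 1) = g i := by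
      simp [finsetSum_coeff, coeff_monomial, hi]
    intro hdeg
    rw [coeff_eq_zero_of_natDegree_lt (by lia)] at hcoeff
    exact hgi hcoeff.symm
  · rw [← Submodule.Quotient.mk_eq_zero, ← Submodule.mkQ_apply]
    simpa [aeval_monomial, ← Algebra.smul_def] using congrArg Subtype.val hs

/-- `b` is the polar part, away from the curve, of a polynomial in `t⁻¹`; it exists because the
powers of `t⁻¹` span a finite-dimensional space modulo functions that are regular on the curve and
functions that are regular at infinity. -/
theorem exists_pole (B : Subalgebra k K) [Algebra.FiniteType k B] [Ring.DimensionLEOne B] {t : K}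
    (htB : t ∈ B) (ht0 : t ≠ 0) (ht : t⁻¹ ∉ B) :
    ∃ b : K, (∀ R : Subalgebra k K, B ≤ R → b ∈ R → IsIntegral R t⁻¹) ∧
      ∀ O : ValuationSubring K, (∀ c : k, algebraMap k K c ∈ O) →
        b ∈ O ∨ ((B : Set K) ⊆ O ∧ t⁻¹ ∉ O) := by
  have hunit : ¬ IsUnit (⟨t, htB⟩ : B) := fun h ↦ by
    obtain ⟨s, hs⟩ := isUnit_iff_exists_inv.mp h
    exact ht (inv_eq_of_mul_eq_one_right (congrArg Subtype.val hs) ▸ s.2)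
  obtain ⟨a, ha0, hfin⟩ := exists_mul_ne_zero_and_finite_aeval (k := k)
    (Subtype.coe_ne_coe.mp ht0 : (⟨t, htB⟩ : B) ≠ 0) hunit
  let w : Kˣ := Units.mk0 (a * t) (Subtype.coe_ne_coe.mpr ha0)
  obtain ⟨F, hF, hFB⟩ := exists_finite_forall_inv_pow_mul_mem hfin (w := w) rfl
  have htw : t⁻¹ = w⁻¹.val * a := by
    rw [Units.val_inv_eq_inv_val, inv_mul_eq_div, eq_div_iff w.ne_zero, Units.val_mk0,
      mul_comm a.1, inv_mul_cancel_left₀ ht0]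
  obtain ⟨f, hf, hfL⟩ := exists_natDegree_ne_zero_aeval_mem t⁻¹
    (B.toSubmodule ⊔ integralSubmodule k w⁻¹.val) hF fun n ↦ by
      rw [htw, mul_pow]
      exact hFB n (a ^ n)
  obtain ⟨b', hb' : b' ∈ B, b, hb, hbf⟩ := Submodule.mem_sup.mp hfL
  refine ⟨b, fun R hBR hbR ↦ ?_, fun O hO ↦ ?_⟩
  · exact isIntegralElem_of_aeval_eq R.val hf (r := ⟨b' + b, add_mem (hBR hb') hbR⟩) hbf.symm
  rcases O.mem_or_inv_mem w.val with hwO | hwO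
  · have hBO : (B : Set K) ⊆ O := fun y hy ↦ mem_of_isIntegralElem O
      (aeval_mem_valuationSubring hO hwO) (isIntegralElem_aeval_coe hfin ⟨y, hy⟩)
    by_cases htO : t⁻¹ ∈ O
    · left
      rw [← add_sub_cancel_left b' b, hbf]
      exact sub_mem (aeval_mem_valuationSubring hO htO f) (hBO hb')
    · exact .inr ⟨hBO, htO⟩
  · exact .inl (mem_of_isIntegralElem O (aeval_mem_valuationSubring hO hwO) hb)

end

end Pole

/-! ## Rational functions on integral schemes -/

section IntegralScheme

variable {X : Scheme.{u}}

theorem genericPoint_mem [IrreducibleSpace X] {V : X.Opens} [Nonempty V] : genericPoint X ∈ V :=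
  ((genericPoint_spec X).mem_open_set_iff V.isOpen).mpr (by simpa using ‹Nonempty V›)

theorem germToFunctionField_map [IrreducibleSpace X] {V W : X.Opens} [Nonempty V] [Nonempty W]
    (h : V ≤ W) (g : Γ(X, W)) :
    X.germToFunctionField V (X.presheaf.map (homOfLE h).op g) = X.germToFunctionField W g :=
  X.presheaf.germ_res_apply (homOfLE h) _ _ _

variable [IsIntegral X]

theorem genericPoint_mem_basicOpen_iff {V : X.Opens} [Nonempty V] {t : Γ(X, V)} :
    genericPoint X ∈ X.basicOpen t ↔ t ≠ 0 := by
  rw [X.mem_basicOpen _ _ genericPoint_mem]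
  refine isUnit_iff_ne_zero.trans (not_congr ?_)
  exact map_eq_zero_iff _ (X.germToFunctionField_injective V)

theorem exists_germToFunctionField_mul_eq {V : X.Opens} (hV : IsAffineOpen V) [Nonempty V] {x : X}
    (hx : x ∈ V) (a : X.presheaf.stalk x) :
    ∃ t s : Γ(X, V), x ∈ X.basicOpen t ∧
      X.germToFunctionField V t * algebraMap (X.presheaf.stalk x) X.functionField a =
        X.germToFunctionField V s := by
  let _ : Algebra Γ(X, V) (X.presheaf.stalk x) := (X.presheaf.germ V x hx).hom.toAlgebra
  have := hV.isLocalization_stalk ⟨x, hx⟩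
  obtain ⟨⟨s, t⟩, hst⟩ := IsLocalization.surj (hV.primeIdealOf ⟨x, hx⟩).asIdeal.primeCompl a
  refine ⟨t, s, ?_, ?_⟩
  · rw [X.mem_basicOpen _ _ hx]
    exact IsLocalization.map_units (X.presheaf.stalk x) t
  · rw [← X.algebraMap_germ_eq_germToFunctionField hx,
      ← X.algebraMap_germ_eq_germToFunctionField hx, ← map_mul, mul_comm]
    exact congrArg _ hst

end IntegralScheme

section Order

variable {X : Scheme.{u}} [IsIntegral X] [IsLocallyNoetherian X]

theorem ord_one (x : X) : Scheme.ord (1 : X.functionField) x = 0 := by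
  have h := Scheme.ord_mul (x := x) (one_ne_zero (α := X.functionField)) one_ne_zero
  rwa [mul_one, left_eq_add] at h

theorem ord_pow {f : X.functionField} (hf : f ≠ 0) (n : ℕ) (x : X) :
    Scheme.ord (f ^ n) x = n * Scheme.ord f x := by
  induction n with
  | zero => simp [ord_one]
  | succ n ih => rw [pow_succ, Scheme.ord_mul (pow_ne_zero _ hf) hf, ih]; push_cast; ring

theorem ord_inv {f : X.functionField} (hf : f ≠ 0) (x : X) :
    Scheme.ord f⁻¹ x = -Scheme.ord f x := by
  have h := Scheme.ord_mul (x := x) hf (inv_ne_zero hf)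
  rw [mul_inv_cancel₀ hf, ord_one] at h
  linarith

theorem ord_nonneg_iff {x : X} [IsDiscreteValuationRing (X.presheaf.stalk x)]
    {f : X.functionField} (hf : f ≠ 0) :
    0 ≤ Scheme.ord f x ↔ ∃ a, algebraMap (X.presheaf.stalk x) X.functionField a = f := by
  have hx : Order.coheight x = 1 := by
    have h := ringKrullDim_stalk_eq_coheight x
    rw [IsDiscreteValuationRing.ringKrullDim_eq_one] at h
    exact_mod_cast h.symm
  have hord : 0 ≤ Scheme.ord f x ↔ 1 ≤ Ring.ordFrac (X.presheaf.stalk x) f := by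
    rw [Scheme.le_ord_iff hx hf]; rfl
  rw [hord, Ring.ordFrac_eq_valuation_inv, one_le_inv₀ (zero_lt_iff.mpr (by simpa using hf))]
  refine ⟨IsDiscreteValuationRing.exists_lift_of_le_one, ?_⟩
  rintro ⟨a, rfl⟩
  exact IsDedekindDomain.HeightOneSpectrum.valuation_le_one _ a

end Order

section Curve

variable {Y : Scheme.{0}} [Y.Over SpecC] [IsNonsingularCurve Y]

theorem exists_algebraMap_stalk_eq {y : Y} {f : Y.functionField} (hf : f ≠ 0)
    (h : y ∈ closedPoints Y → 0 ≤ Scheme.ord f y) :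
    ∃ a, algebraMap (Y.presheaf.stalk y) Y.functionField a = f := by
  by_cases hy : y ∈ closedPoints Y
  · have := isDVR_curve Y ⟨y, hy⟩
    exact (ord_nonneg_iff hf).mp (h hy)
  · obtain rfl : y = genericPoint Y := not_not.mp fun hne ↦ hy (mem_closedPoints_of_ne hne)
    obtain ⟨W, hW, g, rfl⟩ := Y.presheaf.exists_germ_eq f
    have : Nonempty W := ⟨⟨_, hW⟩⟩
    exact ⟨_, Y.algebraMap_germ_eq_germToFunctionField hW g⟩

theorem single_mem_gradedSections {M : Type} [AddCommGroup M] {S : AddSubmonoid M}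
    {E : M → closedPoints Y → ℚ} {h0 : ∀ P, 0 ≤ E 0 P}
    {hE : ∀ u ∈ S, ∀ w ∈ S, ∀ P, E u P + E w P ≤ E (u + w) P} {V : Y.Opens} {u : M} (hu : u ∈ S)
    {f : Y.functionField} (hf : f ∈ divisorSections (E u) V) :
    AddMonoidAlgebra.single u f ∈ gradedSections S E h0 hE V := by
  classical
  intro w hw
  rw [AddMonoidAlgebra.coeff_single, Finsupp.single_apply] at hw ⊢
  split_ifs at hw ⊢ with h
  · subst h; exact ⟨hu, hf⟩
  · exact absurd rfl hw

end Curve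

namespace PolyhedralDivisor

variable {M : Type} [AddCommGroup M] {Y : Scheme.{0}} {σ : PointedCone ℚ (NQ M)}
  (D : PolyhedralDivisor Y σ)

theorem nsmul_eval_le {u : M} (hu : u ∈ weightMonoid σ) (n : ℕ) (P : closedPoints Y) :
    n * D.eval u P ≤ D.eval (n • u) P := by
  induction n with
  | zero => simp [D.eval_zero]
  | succ n ih =>
    have := D.eval_add_le (nsmul_mem hu n) hu P
    rw [succ_nsmul]
    push_cast
    linarith

variable [Y.Over SpecC] [IsNonsingularCurve Y]

theorem single_mem_sections {V : Y.Opens} {u : M} (hu : u ∈ weightMonoid σ) {f : Y.functionField}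
    (hf : f ∈ divisorSections (D.eval u) V) : AddMonoidAlgebra.single u f ∈ D.sections V :=
  single_mem_gradedSections hu hf

theorem divisorSections_nsmul_eval_le {u : M} (hu : u ∈ weightMonoid σ) (n : ℕ) (V : Y.Opens) :
    divisorSections (n • D.eval u) V ≤ divisorSections (D.eval (n • u)) V := by
  intro g hg hg0 P hP
  have hgP := hg hg0 P hP
  have hle := D.nsmul_eval_le hu n P
  simp only [Pi.smul_apply, nsmul_eq_mul] at hgP
  linarith

end PolyhedralDivisor

/-! ## Semiampleness and integrality -/

theorem mem_of_span_setOf_mul_mem_eq_top {A B : Type*} [CommRing A] [CommRing B] {φ : A →+* B}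
    {R : Subring B} (hφ : ∀ a, φ a ∈ R) {b : B} (h : Ideal.span {a | φ a * b ∈ R} = ⊤) :
    b ∈ R := by
  have hmul (a : A) (ha : a ∈ Ideal.span {a | φ a * b ∈ R}) : φ a * b ∈ R := by
    induction ha using Submodule.span_induction with
    | mem _ ha => exact ha
    | zero => simp [R.zero_mem]
    | add a a' _ _ ha ha' => rw [map_add, add_mul]; exact add_mem ha ha'
    | smul c a _ ha => rw [smul_eq_mul, map_mul, mul_assoc]; exact mul_mem (hφ c) ha
  simpa using hmul 1 (h ▸ Submodule.mem_top)

section Curve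

variable {Y : Scheme.{0}} [Y.Over SpecC] [IsNonsingularCurve Y]

theorem exists_germToFunctionField_mul_eq_mul {E : closedPoints Y → ℚ} {V : Y.Opens}
    (hV : IsAffineOpen V) [Nonempty V] {y : Y} (hy : y ∈ V) {f g : Y.functionField}
    (hf : f ∈ divisorSections E V) (hg : g ≠ 0) (hyg : y ∈ nonvanishingLocus E g) :
    ∃ t s : Γ(Y, V), y ∈ Y.basicOpen t ∧
      Y.germToFunctionField V t * f = Y.germToFunctionField V s * g := by
  obtain rfl | hf0 := eq_or_ne f 0
  · exact ⟨1, 0, by simpa using hy, by simp⟩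
  obtain ⟨a, ha⟩ := exists_algebraMap_stalk_eq (y := y) (div_ne_zero hf0 hg) fun hyc ↦ by
    rw [div_eq_mul_inv, Scheme.ord_mul hf0 (inv_ne_zero hg), ord_inv hg]
    have hfy := hf hf0 ⟨y, hyc⟩ hy
    have hgy := hyg hyc
    have : (Scheme.ord g y : ℚ) ≤ Scheme.ord f y := by linarith
    have : Scheme.ord g y ≤ Scheme.ord f y := by exact_mod_cast this
    linarith
  obtain ⟨t, s, hyt, hts⟩ := exists_germToFunctionField_mul_eq hV hy a
  refine ⟨t, s, hyt, ?_⟩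
  rw [← hts, ha, mul_assoc, div_mul_cancel₀ f hg]

end Curve

namespace PolyhedralDivisor

variable {M : Type} [AddCommGroup M] {Y : Scheme.{0}} {σ : PointedCone ℚ (NQ M)}
  (D : PolyhedralDivisor Y σ) [Y.Over SpecC] [IsNonsingularCurve Y] {V : Y.Opens}
  {R : Subring (AddMonoidAlgebra Y.functionField M)}

theorem isIntegral_single_of_isSemiample {u : M} (hu : u ∈ weightMonoid σ)
    (hDu : IsSemiample (D.eval u)) (hV : IsAffineOpen V) [Nonempty V] (hR : D.sections ⊤ ≤ R)
    (hR' : ∀ g : Γ(Y, V), AddMonoidAlgebra.single 0 (Y.germToFunctionField V g) ∈ R)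
    {f : Y.functionField} (hf : f ∈ divisorSections (D.eval u) V) :
    IsIntegral R (AddMonoidAlgebra.single u f) := by
  obtain ⟨n, hn, hcov⟩ := hDu
  let φ : Γ(Y, V) →+* AddMonoidAlgebra Y.functionField M :=
    AddMonoidAlgebra.singleZeroRingHom.comp (Y.germToFunctionField V).hom
  have hfn : f ^ n ∈ divisorSections (n • D.eval u) V := by
    intro hfn0 P hP
    have hf0 : f ≠ 0 := by rintro rfl; exact hfn0 (zero_pow hn.ne')
    have hle := nsmul_nonneg (hf hf0 P hP) n
    rw [nsmul_add, nsmul_eq_mul] at hle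
    rw [ord_pow hf0]
    exact_mod_cast hle
  suffices hmem : AddMonoidAlgebra.single u f ^ n ∈ R from
    .of_pow hn (isIntegral_algebraMap (x := (⟨_, hmem⟩ : R)))
  refine mem_of_span_setOf_mul_mem_eq_top (φ := φ) hR' (hV.self_le_iSup_basicOpen_iff.mp ?_)
  intro y hy
  obtain ⟨g, hg0, hg, hyg⟩ := hcov y
  obtain ⟨t, s, hyt, hts⟩ := exists_germToFunctionField_mul_eq_mul hV hy hfn hg0 hyg
  refine Opens.mem_iSup.mpr ⟨⟨t, ?_⟩, hyt⟩
  have hφ : φ t * AddMonoidAlgebra.single u f ^ n = φ s * AddMonoidAlgebra.single (n • u) g := by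
    rw [AddMonoidAlgebra.single_pow]
    exact (AddMonoidAlgebra.single_mul_single ..).trans
      ((congrArg _ hts).trans (AddMonoidAlgebra.single_mul_single ..).symm)
  rw [Set.mem_ofPred_eq, hφ]
  exact mul_mem (hR' s) (hR (D.single_mem_sections (nsmul_mem hu n)
    (D.divisorSections_nsmul_eval_le hu n ⊤ hg)))

theorem isIntegral_of_mem_sections (hD : ∀ u ∈ weightMonoid σ, IsSemiample (D.eval u))
    (hV : IsAffineOpen V) [Nonempty V] (hR : D.sections ⊤ ≤ R)
    (hR' : ∀ g : Γ(Y, V), AddMonoidAlgebra.single 0 (Y.germToFunctionField V g) ∈ R)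
    {a : AddMonoidAlgebra Y.functionField M} (ha : a ∈ D.sections V) : IsIntegral R a := by
  rw [← AddMonoidAlgebra.sum_coeff_single a, Finsupp.sum]
  refine IsIntegral.sum _ fun u hu ↦ ?_
  have hau := ha u (Finsupp.mem_support_iff.mp hu)
  exact D.isIntegral_single_of_isSemiample hau.1 (hD u hau.1) hV hR hR' hau.2

end PolyhedralDivisor

/-! ## Regular functions on a curve and on an open subset -/

theorem dimensionLEOne_of_surjective {A B : Type*} [CommRing A] [Ring.DimensionLEOne A]
    [CommRing B] (f : A →+* B) (hf : Function.Surjective f) : Ring.DimensionLEOne B where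
  maximalOfPrime {p} hp0 hp := by
    have hcomap : p.comap f ≠ ⊥ := fun h ↦ hp0 <| by
      rw [← Ideal.map_comap_of_surjective f hf p, h, Ideal.map_bot]
    have hmap := Ideal.map_eq_top_or_isMaximal_of_surjective f hf
      (Ring.DimensionLEOne.maximalOfPrime hcomap (Ideal.comap_isPrime f p))
    rw [Ideal.map_comap_of_surjective f hf] at hmap
    exact hmap.resolve_left hp.ne_top

theorem isDominant_specMap_of_injective {R S : CommRingCat.{u}} (f : R ⟶ S)
    (hf : Function.Injective f) : IsDominant (Spec.map f) := by
  refine ⟨(PrimeSpectrum.denseRange_comap_iff_ker_le_nilRadical f.hom).mpr ?_⟩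
  rw [(RingHom.injective_iff_ker_eq_bot f.hom).mp hf]
  exact bot_le

section OpenSubcurve

variable {C : Scheme.{0}} [C.Over SpecC] [IsNonsingularCurve C]

theorem dimensionLEOne_of_isAffineOpen {V : C.Opens} (hV : IsAffineOpen V) [Nonempty V] :
    Ring.DimensionLEOne Γ(C, V) where
  maximalOfPrime {p} hp0 hp := by
    let q : PrimeSpectrum Γ(C, V) := ⟨p, hp⟩
    have hne : hV.fromSpec q ≠ genericPoint C := by
      intro h
      have hq : hV.primeIdealOf ⟨genericPoint C, genericPoint_mem⟩ = q :=
        hV.fromSpec.isOpenEmbedding.injective ((hV.fromSpec_primeIdealOf _).trans h.symm)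
      rw [hV.primeIdealOf_genericPoint, genericPoint_eq_bot_of_affine] at hq
      exact hp0 (congrArg PrimeSpectrum.asIdeal hq).symm
    have hclosed := (mem_closedPoints_iff.mp (mem_closedPoints_of_ne hne)).preimage
      hV.fromSpec.continuous
    have hpre : hV.fromSpec ⁻¹' {hV.fromSpec q} = {q} :=
      Set.ext fun _ ↦ hV.fromSpec.isOpenEmbedding.injective.eq_iff
    rw [hpre] at hclosed
    exact (PrimeSpectrum.isClosed_singleton_iff_isMaximal q).mp hclosed

theorem exists_isAffineOpen_forall_ne_mem {c : C} {W G : C.Opens} (hc : c ∈ W)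
    (hG : genericPoint C ∈ G) :
    ∃ V : C.Opens, IsAffineOpen V ∧ c ∈ V ∧ V ≤ W ∧ ∀ x ∈ V, x ≠ c → x ∈ G := by
  have hclosed : IsClosed ((G : Set C)ᶜ \ {c}) := by
    rw [← Set.biUnion_of_singleton ((G : Set C)ᶜ \ {c})]
    refine ((finite_compl hG).subset Set.sdiff_subset).isClosed_biUnion fun x hx ↦
      mem_closedPoints_iff.mp (mem_closedPoints_of_ne ?_)
    rintro rfl
    exact hx.1 hG
  obtain ⟨V, hV, hcV, hVW⟩ := exists_isAffineOpen_mem_and_subset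
    (U := W ⊓ ⟨_, hclosed.isOpen_compl⟩) (x := c) ⟨hc, fun h ↦ h.2 rfl⟩
  refine ⟨V, hV, hcV, fun x hx ↦ (hVW hx).1, fun x hx hxc ↦ ?_⟩
  by_contra hxG
  exact (hVW hx).2 ⟨hxG, hxc⟩

theorem exists_isAffineOpen_single_zero {c : C} (hc : c ∈ closedPoints C) {G : C.Opens}
    (hG : genericPoint C ∈ G) :
    ∃ (V : C.Opens) (t : Γ(C, V)), IsAffineOpen V ∧ c ∈ V ∧ c ∉ C.basicOpen t ∧
      ∀ x ∈ V, x ≠ c → x ∈ C.basicOpen t ∧ x ∈ G := by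
  have : IsDiscreteValuationRing (C.presheaf.stalk c) := isDVR_curve C ⟨c, hc⟩
  obtain ⟨ϖ, hϖ⟩ := IsDiscreteValuationRing.exists_irreducible (C.presheaf.stalk c)
  obtain ⟨W, hcW, t, rfl⟩ := C.presheaf.exists_germ_eq ϖ
  have : Nonempty W := ⟨⟨c, hcW⟩⟩
  have ht : genericPoint C ∈ C.basicOpen t :=
    genericPoint_mem_basicOpen_iff.mpr fun h ↦ hϖ.ne_zero (h ▸ map_zero _)
  obtain ⟨V, hV, hcV, hVW, hVG⟩ :=
    exists_isAffineOpen_forall_ne_mem (G := C.basicOpen t ⊓ G) hcW ⟨ht, hG⟩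
  refine ⟨V, C.presheaf.map (homOfLE hVW).op t, hV, hcV, ?_, fun x hx hxc ↦ ?_⟩ <;>
    rw [Scheme.basicOpen_res]
  · exact fun h ↦ hϖ.not_isUnit ((C.mem_basicOpen _ _ hcW).mp h.2)
  · exact ⟨⟨hx, (hVG x hx hxc).1⟩, (hVG x hx hxc).2⟩

end OpenSubcurve

section Constants

variable {C : Scheme.{0}} [C.Over SpecC]

/-- The structure homomorphism `ℂ → Γ(C, V)`. -/
def constants (V : C.Opens) : ℂ →+* Γ(C, V) :=
  ((C ↘ SpecC).appLE ⊤ V le_top).hom.comp (Scheme.ΓSpecIso (CommRingCat.of ℂ)).inv.hom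

theorem finiteType_constants [LocallyOfFiniteType (C ↘ SpecC)] {V : C.Opens}
    (hV : IsAffineOpen V) : (constants V).FiniteType :=
  ((C ↘ SpecC).finiteType_appLE (isAffineOpen_top _) hV le_top).comp
    (.of_surjective _ (ConcreteCategory.bijective_of_isIso
      (Scheme.ΓSpecIso (CommRingCat.of ℂ)).inv).2)

theorem map_constants_top (V : C.Opens) (z : ℂ) :
    C.presheaf.map (homOfLE le_top).op (constants ⊤ z) = constants V z :=
  congr($((C ↘ SpecC).appLE_map (U := ⊤) (V := ⊤) le_top (homOfLE le_top).op)
    ((Scheme.ΓSpecIso (CommRingCat.of ℂ)).inv z))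

end Constants

/-- The local ring of a regular point of codimension one, as a valuation ring of the field of
rational functions. -/
def stalkValuationSubring {X : Scheme.{u}} [IsIntegral X] (x : X)
    [ValuationRing (X.presheaf.stalk x)] : ValuationSubring X.functionField :=
  (ValuationRing.valuation (X.presheaf.stalk x) X.functionField).valuationSubring

theorem mem_stalkValuationSubring_iff {X : Scheme.{u}} [IsIntegral X] {x : X}
    [ValuationRing (X.presheaf.stalk x)] {f : X.functionField} :
    f ∈ stalkValuationSubring x ↔
      ∃ a, algebraMap (X.presheaf.stalk x) X.functionField a = f :=
  ValuationRing.mem_integer_iff _ _ f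

section Pullback

variable {Y C : Scheme.{u}} [IsIntegral Y] (j : Y ⟶ C)

/-- Pullback of regular functions on an open of `C` to rational functions on `Y`. -/
def pullbackFunction (V : C.Opens) [Nonempty (j ⁻¹ᵁ V)] : Γ(C, V) →+* Y.functionField :=
  (Y.germToFunctionField (j ⁻¹ᵁ V)).hom.comp (j.app V).hom

theorem pullbackFunction_apply (V : C.Opens) [Nonempty (j ⁻¹ᵁ V)] (g : Γ(C, V)) :
    pullbackFunction j V g = Y.germToFunctionField (j ⁻¹ᵁ V) (j.app V g) := rfl

theorem pullbackFunction_map {V W : C.Opens} [Nonempty (j ⁻¹ᵁ V)] [Nonempty (j ⁻¹ᵁ W)] (h : V ≤ W)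
    (g : Γ(C, W)) : pullbackFunction j V (C.presheaf.map (homOfLE h).op g) =
      pullbackFunction j W g := by
  rw [pullbackFunction_apply, pullbackFunction_apply,
    ← germToFunctionField_map (show j ⁻¹ᵁ V ≤ j ⁻¹ᵁ W from fun x hx ↦ h hx)]
  exact congrArg _ congr($(j.naturality (homOfLE h).op).hom g)

theorem exists_pullbackFunction_mul_pow [IsOpenImmersion j] {V : C.Opens} (hV : IsAffineOpen V)
    [Nonempty (j ⁻¹ᵁ V)] {t : Γ(C, V)} (ht : C.basicOpen t ≤ j.opensRange)
    (htV : j ⁻¹ᵁ V ≤ j ⁻¹ᵁ C.basicOpen t) (x : Γ(Y, j ⁻¹ᵁ V)) :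
    ∃ (n : ℕ) (s : Γ(C, V)), Y.germToFunctionField _ x * pullbackFunction j V t ^ n =
      pullbackFunction j V s := by
  have hle : j ⁻¹ᵁ C.basicOpen t ≤ j ⁻¹ᵁ V := fun x hx ↦ C.basicOpen_le t hx
  have : Nonempty (j ⁻¹ᵁ C.basicOpen t) := by
    rw [le_antisymm hle htV]; infer_instance
  have : IsIso (j.app (C.basicOpen t)) := j.isIso_app _ ht
  obtain ⟨z, hz⟩ := (ConcreteCategory.bijective_of_isIso (j.app (C.basicOpen t))).2
    (Y.presheaf.map (homOfLE hle).op x)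
  have := hV.isLocalization_basicOpen t
  obtain ⟨⟨s, ⟨_, n, rfl⟩⟩, hs⟩ := IsLocalization.surj (Submonoid.powers t) z
  refine ⟨n, s, ?_⟩
  rw [← germToFunctionField_map hle x, ← hz, ← map_pow, ← pullbackFunction_map j (C.basicOpen_le t),
    ← pullbackFunction_map j (C.basicOpen_le t), ← pullbackFunction_apply, ← map_mul]
  exact congrArg _ hs

theorem exists_algebraMap_eq_pullbackFunction {V : C.Opens} [Nonempty (j ⁻¹ᵁ V)] {y : Y}
    (hy : j y ∈ V) (g : Γ(C, V)) : ∃ a, algebraMap (Y.presheaf.stalk y) Y.functionField a =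
      pullbackFunction j V g :=
  ⟨_, Y.algebraMap_germ_eq_germToFunctionField (U := j ⁻¹ᵁ V) hy (j.app V g)⟩

theorem exists_algebraMap_eq_inv_pullbackFunction {V : C.Opens} [Nonempty (j ⁻¹ᵁ V)] {t : Γ(C, V)}
    {y : Y} (hy : j y ∈ C.basicOpen t) : ∃ a, algebraMap (Y.presheaf.stalk y) Y.functionField a =
      (pullbackFunction j V t)⁻¹ := by
  have hyV : y ∈ j ⁻¹ᵁ V := C.basicOpen_le t hy
  have hyt : y ∈ j ⁻¹ᵁ C.basicOpen t := hy
  rw [Scheme.preimage_basicOpen, Y.mem_basicOpen _ _ hyV] at hyt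
  obtain ⟨w, hw⟩ := hyt
  refine ⟨↑w⁻¹, eq_inv_of_mul_eq_one_left ?_⟩
  rw [pullbackFunction_apply, ← Y.algebraMap_germ_eq_germToFunctionField hyV, ← hw,
    ← map_mul, Units.inv_mul, map_one]

theorem mem_of_forall_exists_algebraMap_eq [C.IsSeparated] {V : C.Opens} (hV : IsAffineOpen V)
    [Nonempty (j ⁻¹ᵁ V)] (hW : IsAffineOpen (j ⁻¹ᵁ V)) {y : Y}
    (h : ∀ g : Γ(C, V), ∃ a, algebraMap (Y.presheaf.stalk y) Y.functionField a =
      pullbackFunction j V g) : j y ∈ V := by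
  let i := algebraMap (Y.presheaf.stalk y) Y.functionField
  have hi : Function.Injective i := IsFractionRing.injective _ _
  let e := RingEquiv.ofBijective i.rangeRestrict
    ⟨fun _ _ hab ↦ hi (congrArg Subtype.val hab), i.rangeRestrict_surjective⟩
  let β : Γ(C, V) →+* Y.presheaf.stalk y :=
    (e.symm : i.range →+* _).comp ((pullbackFunction j V).codRestrict i.range h)
  have hβ (g) : i (β g) = pullbackFunction j V g := congrArg Subtype.val (e.apply_symm_apply _)
  have hgen : genericPoint Y ⤳ y := (genericPoint_spec Y).specializes trivial
  let ι := Spec.map (Y.presheaf.stalkSpecializes hgen)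
  have : IsDominant ι := isDominant_specMap_of_injective _ hi
  have hfac : Spec.map (CommRingCat.ofHom β) ≫ hV.fromSpec = Y.fromSpecStalk y ≫ j := by
    refine ext_of_isDominant (ι := ι) ?_
    rw [Scheme.SpecMap_stalkSpecializes_fromSpecStalk_assoc,
      ← hW.fromSpecStalk_eq_fromSpecStalk genericPoint_mem, IsAffineOpen.fromSpecStalk,
      Category.assoc, ← IsAffineOpen.SpecMap_appLE_fromSpec j hV hW le_rfl, ← Spec.map_comp_assoc,
      ← Spec.map_comp_assoc]
    congr 2
    ext g
    exact (hβ g).trans (by rw [pullbackFunction_apply, Scheme.Hom.app_eq_appLE]; rfl)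
  have hy := congr($hfac (IsLocalRing.closedPoint (Y.presheaf.stalk y)))
  change hV.fromSpec _ = j (Y.fromSpecStalk y _) at hy
  rw [Scheme.fromSpecStalk_closedPoint] at hy
  rw [← hy, ← SetLike.mem_coe, ← hV.range_fromSpec]
  exact Set.mem_range_self _

end Pullback

section IntegralOverPullback

variable {Y C : Scheme.{0}} [Y.Over SpecC] [IsNonsingularCurve Y] [C.Over SpecC]
  (j : Y ⟶ C)

theorem constants_mem_stalkValuationSubring {V : C.Opens} [Nonempty (j ⁻¹ᵁ V)]
    (P : closedPoints Y) (z : ℂ) :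
    pullbackFunction j V (constants V z) ∈ stalkValuationSubring P.1 := by
  have : Nonempty (j ⁻¹ᵁ (⊤ : C.Opens)) := ⟨⟨P.1, trivial⟩⟩
  rw [← map_constants_top, pullbackFunction_map j le_top, mem_stalkValuationSubring_iff]
  exact exists_algebraMap_eq_pullbackFunction j (V := ⊤) trivial _

variable [IsNonsingularCurve C]

theorem isIntegral_inv_pullbackFunction {V : C.Opens} (hV : IsAffineOpen V)
    [Nonempty (j ⁻¹ᵁ V)] (hW : IsAffineOpen (j ⁻¹ᵁ V)) {t : Γ(C, V)}
    (ht : j ⁻¹ᵁ V ≤ j ⁻¹ᵁ C.basicOpen t) {R : Subring Y.functionField}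
    (hR : ∀ g, pullbackFunction j V g ∈ R) (hRY : ∀ b ∈ divisorSections (Y := Y) 0 ⊤, b ∈ R) :
    IsIntegral R (pullbackFunction j V t)⁻¹ := by
  by_cases h0 : pullbackFunction j V t = 0
  · rw [h0, inv_zero]
    exact isIntegral_zero
  let _ : Algebra ℂ Γ(C, V) := (constants V).toAlgebra
  have : Algebra.FiniteType ℂ Γ(C, V) := finiteType_constants hV
  let _ : Algebra ℂ Y.functionField := ((pullbackFunction j V).comp (constants V)).toAlgebra
  let ρ : Γ(C, V) →ₐ[ℂ] Y.functionField := ⟨pullbackFunction j V, fun _ ↦ rfl⟩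
  let R' : Subalgebra ℂ Y.functionField := { R with algebraMap_mem' := fun _ ↦ hR _ }
  have hρR : ρ.range ≤ R' := by
    rintro _ ⟨g, rfl⟩
    exact hR g
  by_cases htB : (pullbackFunction j V t)⁻¹ ∈ ρ.range
  · exact isIntegral_algebraMap (x := (⟨_, hρR htB⟩ : R))
  have : Nonempty V := ‹Nonempty (j ⁻¹ᵁ V)›.map fun y ↦ ⟨j y.1, y.2⟩
  have := dimensionLEOne_of_isAffineOpen hV
  have : Algebra.FiniteType ℂ ρ.range := .of_surjective _ ρ.rangeRestrict_surjective
  have : Ring.DimensionLEOne ρ.range :=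
    dimensionLEOne_of_surjective ρ.rangeRestrict.toRingHom ρ.rangeRestrict_surjective
  obtain ⟨b, hb, hbO⟩ := exists_pole ρ.range (t := pullbackFunction j V t) ⟨t, rfl⟩ h0 htB
  refine hb R' hρR (hRY b fun hb0 P _ ↦ ?_)
  suffices hord : 0 ≤ Scheme.ord b P.1 by simpa using hord
  rw [ord_nonneg_iff hb0, ← mem_stalkValuationSubring_iff]
  refine (hbO _ (constants_mem_stalkValuationSubring j P)).resolve_right fun ⟨hV', ht'⟩ ↦ ht' ?_
  have hPV : j P.1 ∈ V := mem_of_forall_exists_algebraMap_eq j hV hW fun g ↦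
    mem_stalkValuationSubring_iff.mp (hV' ⟨g, rfl⟩)
  rw [mem_stalkValuationSubring_iff]
  exact exists_algebraMap_eq_inv_pullbackFunction j (ht hPV)

/-- Near a point outside `Y`, functions on `V ∩ Y` only have poles at that point, and these are
controlled by a global function on `Y` with a pole there. -/
theorem exists_isAffineOpen_isIntegral [IsOpenImmersion j] (c : C) :
    ∃ (V : C.Opens) (_ : c ∈ V) (_ : IsAffineOpen V) (_ : IsAffineOpen (j ⁻¹ᵁ V))
      (_ : Nonempty (j ⁻¹ᵁ V)),
      ∀ R : Subring Y.functionField, (∀ g, pullbackFunction j V g ∈ R) →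
        (∀ b ∈ divisorSections (Y := Y) 0 ⊤, b ∈ R) →
          ∀ x : Γ(Y, j ⁻¹ᵁ V), IsIntegral R (Y.germToFunctionField _ x) := by
  have : Nonempty j.opensRange := ⟨⟨j (genericPoint Y), Set.mem_range_self _⟩⟩
  by_cases hc : c ∈ j.opensRange
  · obtain ⟨V, hV, hcV, hVj⟩ := exists_isAffineOpen_mem_and_subset hc
    obtain ⟨y, rfl⟩ := hc
    refine ⟨V, hcV, hV, hV.preimage_of_isOpenImmersion j hVj, ⟨⟨y, hcV⟩⟩, fun R hR _ x ↦ ?_⟩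
    have : IsIso (j.app V) := j.isIso_app _ hVj
    obtain ⟨z, rfl⟩ := (ConcreteCategory.bijective_of_isIso (j.app V)).2 x
    exact isIntegral_algebraMap (x := (⟨_, hR z⟩ : R))
  have hcc : c ∈ closedPoints C := mem_closedPoints_of_ne (by rintro rfl; exact hc genericPoint_mem)
  obtain ⟨V, t, hV, hcV, hct, hVt⟩ :=
    exists_isAffineOpen_single_zero hcc (G := j.opensRange) genericPoint_mem
  have htj : C.basicOpen t ≤ j.opensRange := fun x hx ↦
    (hVt x (C.basicOpen_le t hx) (by rintro rfl; exact hct hx)).2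
  have ht : j ⁻¹ᵁ V ≤ j ⁻¹ᵁ C.basicOpen t := fun y hy ↦
    (hVt (j y) hy (by rintro rfl; exact hc (Set.mem_range_self _))).1
  have hW : IsAffineOpen (j ⁻¹ᵁ V) := by
    rw [le_antisymm ht fun x hx ↦ C.basicOpen_le t hx]
    exact (hV.basicOpen t).preimage_of_isOpenImmersion j htj
  have hWn : Nonempty (j ⁻¹ᵁ V) := by
    have : Nonempty V := ⟨⟨c, hcV⟩⟩
    obtain ⟨y, hy⟩ : genericPoint C ∈ j.opensRange := genericPoint_mem
    exact ⟨⟨y, (hy ▸ genericPoint_mem : j y ∈ V)⟩⟩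
  refine ⟨V, hcV, hV, hW, hWn, fun R hR hRY x ↦ ?_⟩
  obtain ⟨n, s, hs⟩ := exists_pullbackFunction_mul_pow j hV htj ht x
  have ht0 : pullbackFunction j V t ≠ 0 := by
    have hgen : genericPoint Y ∈ j ⁻¹ᵁ C.basicOpen t := ht genericPoint_mem
    rw [Scheme.preimage_basicOpen, Y.mem_basicOpen _ _ genericPoint_mem] at hgen
    exact hgen.ne_zero
  rw [eq_div_of_mul_eq (pow_ne_zero n ht0) hs, div_eq_mul_inv, ← inv_pow]
  exact (isIntegral_algebraMap (x := (⟨_, hR s⟩ : R))).mul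
    ((isIntegral_inv_pullbackFunction j hV hW ht hR hRY).pow n)

end IntegralOverPullback

/-! ## Orders of vanishing and integral closedness -/

section AddValuation

variable {K G : Type*} [Field K] [AddCommGroup G] [LinearOrder G] [IsOrderedAddMonoid G]

/-- The additive valuation of a field `K` with prescribed values on `K \ {0}`. -/
def addValuationOfNeZero (o : K → G) (h_one : o 1 = 0)
    (h_add : ∀ f g, f + g ≠ 0 → min (o f) (o g) ≤ o (f + g))
    (h_mul : ∀ f g, f ≠ 0 → g ≠ 0 → o (f * g) = o f + o g) : AddValuation K (WithTop G) :=
  haveI := Classical.decEq K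
  AddValuation.of (fun f ↦ if f = 0 then ⊤ else o f) (by simp) (by simp [h_one])
    (fun f g ↦ by
      by_cases hf : f = 0
      · simp [hf]
      by_cases hg : g = 0
      · simp [hg]
      by_cases hfg : f + g = 0
      · simp [hfg]
      simp only [hf, hg, hfg, if_false]
      exact_mod_cast h_add f g hfg)
    (fun f g ↦ by
      by_cases hf : f = 0
      · simp [hf]
      by_cases hg : g = 0
      · simp [hg]
      simp only [hf, hg, mul_eq_zero, or_self, if_false, h_mul f g hf hg, WithTop.coe_add])

theorem addValuationOfNeZero_apply {o : K → G} {h_one : o 1 = 0}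
    {h_add : ∀ f g, f + g ≠ 0 → min (o f) (o g) ≤ o (f + g)}
    {h_mul : ∀ f g, f ≠ 0 → g ≠ 0 → o (f * g) = o f + o g} {f : K} (hf : f ≠ 0) :
    addValuationOfNeZero o h_one h_add h_mul f = o f :=
  if_neg hf

variable (K) in
/-- The trivial additive valuation of a field. -/
def trivialAddValuation : AddValuation K (WithTop ℚ) :=
  addValuationOfNeZero (fun _ ↦ 0) rfl (by simp) (by simp)

theorem trivialAddValuation_apply {x : K} (hx : x ≠ 0) : trivialAddValuation K x = 0 :=
  addValuationOfNeZero_apply hx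

end AddValuation

section Order

variable {X : Scheme.{u}} [IsIntegral X] [IsLocallyNoetherian X]

theorem ord_eq_zero_of_mem_basicOpen {V : X.Opens} [Nonempty V] {h : Γ(X, V)} {x : X}
    (hx : x ∈ X.basicOpen h) : Scheme.ord (X.germToFunctionField V h) x = 0 := by
  have : Nonempty (X.basicOpen h) := ⟨⟨x, hx⟩⟩
  rw [← germToFunctionField_map (V := X.basicOpen h) (X.basicOpen_le h)]
  exact Scheme.ord_of_isUnit (U := X.basicOpen h) (RingedSpace.isUnit_res_basicOpen _ h) hx

variable {x : X} [IsDiscreteValuationRing (X.presheaf.stalk x)]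

theorem ord_pos_of_notMem_basicOpen {V : X.Opens} [Nonempty V] {h : Γ(X, V)} (hxV : x ∈ V)
    (h0 : X.germToFunctionField V h ≠ 0) (hx : x ∉ X.basicOpen h) :
    0 < Scheme.ord (X.germToFunctionField V h) x := by
  by_contra! hle
  refine hx ((X.mem_basicOpen _ _ hxV).mpr ?_)
  obtain ⟨a, ha⟩ := (ord_nonneg_iff (x := x) (inv_ne_zero h0)).mp (by rw [ord_inv h0]; lia)
  refine .of_mul_eq_one a (IsFractionRing.injective (X.presheaf.stalk x) X.functionField ?_)
  rw [map_mul, ha, X.algebraMap_germ_eq_germToFunctionField, mul_inv_cancel₀ h0, map_one]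

variable (x) in
/-- The order of vanishing of rational functions at a regular point of codimension one. -/
def ordAddValuation : AddValuation X.functionField (WithTop ℚ) :=
  addValuationOfNeZero (fun f ↦ (Scheme.ord f x : ℚ)) (by simp [ord_one])
    (fun _ _ hfg ↦ by exact_mod_cast Scheme.ord_add hfg)
    (fun _ _ hf hg ↦ by rw [Scheme.ord_mul hf hg, Int.cast_add])

theorem ordAddValuation_apply {f : X.functionField} (hf : f ≠ 0) :
    ordAddValuation x f = (Scheme.ord f x : ℚ) :=
  addValuationOfNeZero_apply hf

end Order

theorem isIntegrallyClosed_of_forall_isIntegral {A : Type*} [CommRing A] [IsDomain A]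
    [IsIntegrallyClosed A] {R : Subring A} (hR : ∀ a : A, IsIntegral R a → a ∈ R) :
    IsIntegrallyClosed R := by
  let L := FractionRing A
  have hinj : Function.Injective (algebraMap R L) :=
    (IsFractionRing.injective A L).comp Subtype.val_injective
  have : FaithfulSMul R L := (faithfulSMul_iff_algebraMap_injective _ _).mpr hinj
  let ψ : FractionRing R →ₐ[R] L := IsFractionRing.liftAlgHom (g := Algebra.ofId R L) hinj
  refine (isIntegrallyClosed_iff (FractionRing R)).mpr fun {x} hx ↦ ?_
  have hψx : IsIntegral R (ψ x) := hx.map ψ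
  obtain ⟨a, ha⟩ := IsIntegrallyClosed.isIntegral_iff.mp (hψx.tower_top (A := A))
  rw [← ha, isIntegral_algebraMap_iff (IsFractionRing.injective A L)] at hψx
  exact ⟨⟨a, hR a hψx⟩, ψ.toRingHom.injective ((ψ.commutes _).trans ha)⟩

theorem isDomain_addMonoidAlgebra (R M : Type*) [CommRing R] [IsDomain R] [AddCommGroup M]
    [Module.Free ℤ M] : IsDomain (AddMonoidAlgebra R M) :=
  have := twoUniqueSums_of_free M
  { }

theorem eventually_pos_natCast_mul_add {a : ℚ} (ha : 0 < a) (b : ℚ) :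
    ∀ᶠ k : ℕ in Filter.atTop, 0 < k * a + b :=
  (Filter.tendsto_atTop_add_const_right _ b
    (tendsto_natCast_atTop_atTop.atTop_mul_const ha)).eventually_gt_atTop 0

section Curve

variable {Y : Scheme.{0}} [Y.Over SpecC] [IsNonsingularCurve Y]

theorem genericPoint_notMem_closedPoints : genericPoint Y ∉ closedPoints Y := fun h ↦
  have := isDVR_curve Y ⟨_, h⟩
  IsDiscreteValuationRing.not_isField (Y.presheaf.stalk (genericPoint Y))
    (Field.toIsField Y.functionField)

theorem finite_closedPoints_notMem (U : Y.Opens) [Nonempty U] :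
    {P : closedPoints Y | P.1 ∉ U}.Finite :=
  (finite_compl (genericPoint_mem (V := U))).preimage Subtype.val_injective.injOn

theorem IsBig.exists_isAffineOpen_le {E : closedPoints Y → ℚ} (hE : IsBig E) (G : Y.Opens)
    [Nonempty G] :
    ∃ U ≤ G, IsAffineOpen U ∧ Nonempty U ∧ ∃ (m : ℕ) (g : Y.functionField), 0 < m ∧ g ≠ 0 ∧
      (∀ P : closedPoints Y, P.1 ∉ U → 0 < (Scheme.ord g P.1 : ℚ) + m * E P) ∧
      ∀ P : closedPoints Y, P.1 ∈ U → (Scheme.ord g P.1 : ℚ) + m * E P = 0 := by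
  obtain ⟨n, hn, f, hf0, hf, W, hWf, hW⟩ := hE
  have hgW : genericPoint Y ∈ W := by
    rw [← SetLike.mem_coe, hWf]
    exact fun h ↦ absurd h genericPoint_notMem_closedPoints
  have : Nonempty W := ⟨⟨_, hgW⟩⟩
  have hfW (P : closedPoints Y) : P.1 ∈ W ↔ (Scheme.ord f P.1 : ℚ) + n * E P = 0 := by
    rw [← SetLike.mem_coe, hWf]
    exact ⟨fun h ↦ by simpa using h P.2, fun h _ ↦ by simpa using h⟩
  have hfW' (P : closedPoints Y) (hP : P.1 ∉ W) : 0 < (Scheme.ord f P.1 : ℚ) + n * E P := by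
    refine lt_of_le_of_ne ?_ fun h ↦ hP ((hfW P).mpr h.symm)
    simpa using hf hf0 P trivial
  obtain ⟨h, hhG, hgh⟩ := hW.exists_basicOpen_le ⟨genericPoint Y, genericPoint_mem (V := G)⟩ hgW
  let t := Y.germToFunctionField W h
  have ht0 : t ≠ 0 := (map_ne_zero_iff _ (Y.germToFunctionField_injective W)).mpr
    (genericPoint_mem_basicOpen_iff.mp hgh)
  obtain ⟨k, hk, hkP⟩ := ((Filter.eventually_gt_atTop 0).and
    ((Filter.eventually_all_finite (finite_closedPoints_notMem W)).mpr fun P hP ↦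
      eventually_pos_natCast_mul_add (hfW' P hP) (Scheme.ord t P.1))).exists
  have hord (P : closedPoints Y) : (Scheme.ord (f ^ k * t) P.1 : ℚ) + (k * n : ℕ) * E P =
      k * ((Scheme.ord f P.1 : ℚ) + n * E P) + Scheme.ord t P.1 := by
    rw [Scheme.ord_mul (pow_ne_zero _ hf0) ht0, ord_pow hf0]
    push_cast
    ring
  refine ⟨Y.basicOpen h, hhG, hW.basicOpen h, ⟨⟨_, hgh⟩⟩, k * n, f ^ k * t, Nat.mul_pos hk hn,
    mul_ne_zero (pow_ne_zero _ hf0) ht0, fun P hP ↦ ?_, fun P hP ↦ ?_⟩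
  · rw [hord]
    by_cases hPW : P.1 ∈ W
    · rw [(hfW P).mp hPW, mul_zero, zero_add]
      exact_mod_cast ord_pos_of_notMem_basicOpen hPW ht0 hP
    · exact hkP P hPW
  · rw [hord, (hfW P).mp (Y.basicOpen_le h hP), ord_eq_zero_of_mem_basicOpen hP]
    simp

end Curve

namespace PolyhedralDivisor

variable {M : Type} [AddCommGroup M] {Y : Scheme.{0}} {σ : PointedCone ℚ (NQ M)}
  (D : PolyhedralDivisor Y σ)

theorem IsTrivialOn.eval_eq_zero {D : PolyhedralDivisor Y σ} {U : Y.Opens}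
    (h : D.IsTrivialOn U) {u : M} (hu : u ∈ weightMonoid σ) {P : closedPoints Y} (hP : P.1 ∈ U) :
    D.eval u P = 0 := by
  have hleast := (D.isPolyhedron P).isLeast hu
  rw [h P hP] at hleast
  rw [eval, h P hP]
  exact hleast.unique ⟨⟨0, σ.zero_mem, rfl⟩, by rintro _ ⟨v, hv, rfl⟩; exact hu v hv⟩

theorem eventually_nonneg_add_eval {u w : M} (hu : u ∈ weightMonoid σ)
    (hw : ∀ᶠ k : ℕ in Filter.atTop, k • u + w ∈ weightMonoid σ) {P : closedPoints Y} {a : ℚ}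
    (ha : 0 < a + D.eval u P) (b : ℚ) :
    ∀ᶠ k : ℕ in Filter.atTop, 0 ≤ k * a + b + D.eval (k • u + w) P := by
  obtain ⟨n, hn⟩ := hw.exists
  filter_upwards [Filter.eventually_ge_atTop n,
    eventually_pos_natCast_mul_add ha (b + D.eval (n • u + w) P - n * D.eval u P)] with k hnk hk
  obtain ⟨l, rfl⟩ := Nat.exists_eq_add_of_le' hnk
  have hadd := D.eval_add_le (nsmul_mem hu l) hn P
  have hsmul := D.nsmul_eval_le hu l P
  rw [← add_assoc, ← add_smul] at hadd
  push_cast at hk ⊢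
  linarith

variable [Y.Over SpecC] [IsNonsingularCurve Y]

theorem mem_sections_iff_gaussMin {V : Y.Opens} {a : AddMonoidAlgebra Y.functionField M} :
    a ∈ D.sections V ↔
      (∀ v ∈ σ, 0 ≤ gaussMin (trivialAddValuation Y.functionField) v.toAddMonoidHom a) ∧
      ∀ P : closedPoints Y, P.1 ∈ V → ∀ v ∈ D.coeff P,
        0 ≤ gaussMin (ordAddValuation P.1) v.toAddMonoidHom a := by
  simp only [le_gaussMin_iff]
  constructor
  · refine fun h ↦ ⟨fun v hv u ↦ ?_, fun P hP v hv u ↦ ?_⟩ <;>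
      obtain hu | hu := eq_or_ne (a.coeff u) 0
    · simp [hu]
    · rw [trivialAddValuation_apply hu, zero_add]
      exact_mod_cast (h u hu).1 v hv
    · simp [hu]
    · have hord := (h u hu).2 hu P hP
      have hmin : D.eval u P ≤ v u := ((D.isPolyhedron P).isLeast (h u hu).1).2 ⟨v, hv, rfl⟩
      have hnonneg : 0 ≤ (Scheme.ord (a.coeff u) P.1 : ℚ) + v u := by linarith
      rw [ordAddValuation_apply hu]
      exact_mod_cast hnonneg
  · rintro ⟨hσ, hcoeff⟩ u hu
    have huσ : u ∈ weightMonoid σ := fun v hv ↦ by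
      have hvu := hσ v hv u
      rw [trivialAddValuation_apply hu, zero_add] at hvu
      exact_mod_cast hvu
    refine ⟨huσ, fun _ P hP ↦ ?_⟩
    obtain ⟨v, hv, hmin⟩ := ((D.isPolyhedron P).isLeast huσ).1
    have hvu := hcoeff P hP v hv u
    rw [ordAddValuation_apply hu] at hvu
    rw [eval, ← hmin]
    exact_mod_cast hvu

variable {D} in
theorem IsTrivialOn.exists_pow_mul_mem_sections {U : Y.Opens} [Nonempty U] (hT : D.IsTrivialOn U)
    {u : M} (hu : u ∈ weightMonoid σ)
    (hu' : ∀ w : M, ∀ᶠ k : ℕ in Filter.atTop, k • u + w ∈ weightMonoid σ) {g : Y.functionField}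
    (hg : g ≠ 0) (hgU : ∀ P : closedPoints Y, P.1 ∈ U → Scheme.ord g P.1 = 0)
    (hgU' : ∀ P : closedPoints Y, P.1 ∉ U → 0 < (Scheme.ord g P.1 : ℚ) + D.eval u P)
    {b : AddMonoidAlgebra Y.functionField M} (hb : b ∈ torusSections M U) :
    ∃ N : ℕ, AddMonoidAlgebra.single u g ^ N * b ∈ D.sections ⊤ := by
  obtain ⟨N, hN⟩ := ((Filter.eventually_all_finset b.coeff.support).mpr fun w _ ↦
    (hu' w).and ((Filter.eventually_all_finite (finite_closedPoints_notMem U)).mpr fun P hP ↦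
      D.eventually_nonneg_add_eval hu (hu' w) (hgU' P hP) (Scheme.ord (b.coeff w) P.1))).exists
  refine ⟨N, ?_⟩
  rw [← AddMonoidAlgebra.sum_coeff_single b, Finsupp.sum, Finset.mul_sum]
  refine sum_mem fun w hw ↦ ?_
  have hbw := Finsupp.mem_support_iff.mp hw
  rw [AddMonoidAlgebra.single_pow, AddMonoidAlgebra.single_mul_single]
  refine D.single_mem_sections (hN w hw).1 fun _ P _ ↦ ?_
  rw [Scheme.ord_mul (pow_ne_zero _ hg) hbw, ord_pow hg]
  push_cast
  by_cases hP : P.1 ∈ U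
  · rw [hgU P hP, hT.eval_eq_zero (hN w hw).1 hP]
    simpa using (hb w hbw).2 hbw P hP
  · exact (hN w hw).2 P hP

theorem exists_isTrivialOn : ∃ G : Y.Opens, Nonempty G ∧ D.IsTrivialOn G := by
  let nontrivial : Set Y := Subtype.val '' {P : closedPoints Y | D.coeff P ≠ (σ : Set (NQ M))}
  have hclosed : IsClosed nontrivial := by
    rw [← Set.biUnion_of_singleton nontrivial]
    refine (D.finite_nontrivial.image _).isClosed_biUnion ?_
    rintro _ ⟨P, -, rfl⟩
    exact mem_closedPoints_iff.mp P.2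
  refine ⟨⟨nontrivialᶜ, hclosed.isOpen_compl⟩, ⟨genericPoint Y, ?_⟩, fun P hP ↦ ?_⟩
  · rintro ⟨P, -, hP⟩
    exact genericPoint_notMem_closedPoints (hP ▸ P.2)
  · by_contra hne
    exact hP ⟨P, hne, rfl⟩

theorem exists_section_localizing (hσ : σ.FG)
    (hσ' : (σ : ConvexCone ℚ (NQ M)).Salient)
    (hD : ∀ u ∈ interiorWeights σ, IsBig (D.eval u)) :
    ∃ (U : Y.Opens) (_ : IsAffineOpen U) (_ : Nonempty U) (_ : D.IsTrivialOn U) (w : M)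
      (g : Y.functionField), g ≠ 0 ∧ AddMonoidAlgebra.single w g ∈ D.sections ⊤ ∧
      AddMonoidAlgebra.single (-w) g⁻¹ ∈ torusSections M U ∧
      ∀ b ∈ torusSections M U, ∃ N : ℕ, AddMonoidAlgebra.single w g ^ N * b ∈ D.sections ⊤ := by
  obtain ⟨u, hu, hu'⟩ := exists_mem_interiorWeights hσ hσ'
  obtain ⟨G, _, hG⟩ := D.exists_isTrivialOn
  obtain ⟨U, hUG, hU, hUn, m, g, hm, hg0, hpos, hzero⟩ := (hD u hu).exists_isAffineOpen_le G
  have hT : D.IsTrivialOn U := fun P hP ↦ hG P (hUG hP)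
  have hmu : m • u ∈ weightMonoid σ := nsmul_mem hu.1 m
  have hgU (P : closedPoints Y) (hP : P.1 ∈ U) : Scheme.ord g P.1 = 0 := by
    simpa [hT.eval_eq_zero hu.1 hP] using hzero P hP
  have hgU' (P : closedPoints Y) (hP : P.1 ∉ U) :
      0 < (Scheme.ord g P.1 : ℚ) + D.eval (m • u) P :=
    (hpos P hP).trans_le (by gcongr; exact D.nsmul_eval_le hu.1 m P)
  refine ⟨U, hU, hUn, hT, m • u, g, hg0, D.single_mem_sections hmu fun _ P _ ↦ ?_,
    single_mem_gradedSections (AddSubmonoid.mem_top _) fun _ P hP ↦ ?_, fun b hb ↦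
    hT.exists_pow_mul_mem_sections hmu (fun w ↦ ?_) hg0 hgU hgU' hb⟩
  · by_cases hP : P.1 ∈ U
    · simp [hgU P hP, hT.eval_eq_zero hmu hP]
    · exact (hgU' P hP).le
  · simp [ord_inv hg0, hgU P hP]
  · simp only [smul_smul]
    exact (Filter.tendsto_id.atTop_mul_const' hm).eventually (hu' w)

variable [Module.Free ℤ M]

theorem mem_sections_of_isIntegral {V : Y.Opens} {a : AddMonoidAlgebra Y.functionField M}
    (ha : IsIntegral (D.sections V) a) : a ∈ D.sections V := by
  have := twoUniqueSums_of_free M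
  rw [mem_sections_iff_gaussMin]
  exact ⟨fun v hv ↦ gaussMin_nonneg_of_isIntegral
      (fun b hb ↦ (D.mem_sections_iff_gaussMin.mp hb).1 v hv) ha,
    fun P hP v hv ↦ gaussMin_nonneg_of_isIntegral
      (fun b hb ↦ (D.mem_sections_iff_gaussMin.mp hb).2 P hP v hv) ha⟩

theorem isIntegrallyClosed_sections (V : Y.Opens) : IsIntegrallyClosed (D.sections V) :=
  have := isDomain_addMonoidAlgebra Y.functionField M
  have := isIntegrallyClosed_addMonoidAlgebra Y.functionField M
  isIntegrallyClosed_of_forall_isIntegral fun _ ↦ D.mem_sections_of_isIntegral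

end PolyhedralDivisor

/-! ## Charts of the relative spectrum -/

theorem irreducibleSpace_of_denseRange {X Y : Type*} [TopologicalSpace X] [TopologicalSpace Y]
    [IrreducibleSpace X] {f : X → Y} (hf : Continuous f) (hf' : DenseRange f) :
    IrreducibleSpace Y := by
  rw [irreducibleSpace_def, Set.top_eq_univ, ← hf'.closure_range, ← Set.image_univ]
  exact ((IrreducibleSpace.isIrreducible_univ X).image f hf.continuousOn).closure

theorem isIntegral_of_isDominant {Z W : Scheme.{u}} (f : Z ⟶ W) [IsDominant f] [IrreducibleSpace Z]
    [IsReduced W] : IsIntegral W :=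
  have := irreducibleSpace_of_denseRange f.continuous f.denseRange
  isIntegral_of_irreducibleSpace_of_isReduced W

variable (M : Type) [AddCommGroup M] (Y : Scheme.{0})

/-- The torus `T` over the generic point of `Y`, namely `Spec K(Y)[M]`. -/
abbrev genericTorus [IsIntegral Y] : Scheme.{0} :=
  Spec (CommRingCat.of (AddMonoidAlgebra Y.functionField M))

instance isIntegral_genericTorus [IsIntegral Y] [Module.Free ℤ M] : IsIntegral (genericTorus M Y) :=
  have := isDomain_addMonoidAlgebra Y.functionField M
  inferInstance

namespace PolyhedralDivisor

variable {M Y} {σ : PointedCone ℚ (NQ M)} [Y.Over SpecC] [IsNonsingularCurve Y]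
  (D : PolyhedralDivisor Y σ)

/-- The inclusion `Γ(V, 𝒜) ⊆ K(Y)[M]` for nonempty `V`, as evaluation of constant functions at the
generic point. -/
def evalGeneric (V : Y.Opens) [Nonempty V] :
    D.sheafSections V →+* AddMonoidAlgebra Y.functionField M :=
  (Pi.evalRingHom (fun _ : V ↦ AddMonoidAlgebra Y.functionField M)
    ⟨genericPoint Y, genericPoint_mem⟩).comp (D.sheafSections V).subtype

section evalGeneric

variable (V : Y.Opens) [Nonempty V]

theorem evalGeneric_injective : Function.Injective (D.evalGeneric V) := by
  rintro ⟨_, a, ha, rfl⟩ ⟨_, b, hb, rfl⟩ (rfl : a = b)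
  rfl

theorem range_evalGeneric : (D.evalGeneric V).range = D.sections V := by
  ext a
  constructor
  · rintro ⟨⟨_, a, ha, rfl⟩, rfl⟩
    exact ha
  · exact fun ha ↦ ⟨⟨_, a, ha, rfl⟩, rfl⟩

theorem evalGeneric_res {V W : Y.Opens} [Nonempty V] [Nonempty W] (h : V ≤ W)
    (a : D.sheafSections W) : D.evalGeneric V (D.res h a) = D.evalGeneric W a :=
  rfl

theorem evalGeneric_structureMap (f : Γ(Y, V)) :
    D.evalGeneric V (D.structureMap V f) =
      AddMonoidAlgebra.single 0 (Y.germToFunctionField V f) := by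
  rw [← Y.algebraMap_germ_eq_germToFunctionField genericPoint_mem]
  rfl

/-- The ring `Γ(V, 𝒜)` for nonempty `V` as a subring of `K(Y)[M]`. -/
def sectionsEquiv : D.sheafSections V ≃+* D.sections V :=
  (RingEquiv.ofBijective (D.evalGeneric V).rangeRestrict
    ⟨fun _ _ h ↦ D.evalGeneric_injective V (congrArg Subtype.val h),
      (D.evalGeneric V).rangeRestrict_surjective⟩).trans
    (RingEquiv.subringCongr (D.range_evalGeneric V))

theorem isDomain_sheafSections [Module.Free ℤ M] : IsDomain (D.sheafSections V) :=
  have := isDomain_addMonoidAlgebra Y.functionField M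
  (D.evalGeneric_injective V).isDomain _

theorem isIntegrallyClosed_sheafSections [Module.Free ℤ M] :
    IsIntegrallyClosed (D.sheafSections V) :=
  have := D.isIntegrallyClosed_sections V
  .of_equiv (D.sectionsEquiv V).symm

end evalGeneric

section Chart

variable {V : Y.Opens} (hV : IsAffineOpen V)

/-- The open subscheme `Spec Γ(V, 𝒜)` of `X̃`. -/
def chart : Spec (CommRingCat.of (D.sheafSections V)) ⟶ D.Xtilde :=
  colimit.ι D.glueData.functor ⟨V, hV⟩

instance : IsOpenImmersion (D.chart hV) :=
  D.glueData.cover.map_prop ⟨V, hV⟩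

theorem chart_contraction :
    D.chart hV ≫ D.contraction = Spec.map (CommRingCat.ofHom (D.res le_top)) :=
  colimit.ι_desc _ _

theorem chart_π :
    D.chart hV ≫ D.π = Spec.map (CommRingCat.ofHom (D.structureMap V)) ≫ hV.fromSpec :=
  (D.glueData.ι_toBase ⟨V, hV⟩).trans (Category.assoc _ hV.isoSpec.inv V.ι)

theorem opensRange_chart : (D.chart hV).opensRange = D.π ⁻¹ᵁ V := by
  refine (D.glueData.toBase_preimage_eq_opensRange_ι ⟨V, hV⟩).symm.trans ?_
  change D.π ⁻¹ᵁ V.ι.opensRange = _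
  rw [Scheme.Opens.opensRange_ι]

theorem map_chart (f : Γ(Y, V)) :
    Spec.map (CommRingCat.ofHom (D.res (Y.basicOpen_le f))) ≫ D.chart hV =
      D.chart (hV.basicOpen f) :=
  colimit.w D.glueData.functor (homOfLE (Scheme.AffineZariskiSite.basicOpen_le ⟨V, hV⟩ f))

theorem exists_mem_range_chart (x : D.Xtilde) :
    ∃ (V : Y.Opens) (hV : IsAffineOpen V) (_ : Nonempty V), x ∈ Set.range (D.chart hV) := by
  obtain ⟨V, hV, hxV, -⟩ := exists_isAffineOpen_mem_and_subset (U := ⊤) (x := D.π x) trivial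
  refine ⟨V, hV, ⟨⟨_, hxV⟩⟩, ?_⟩
  rwa [← Scheme.Hom.coe_opensRange, opensRange_chart]

variable [Nonempty V]

/-- The inclusion of the generic torus into `Spec Γ(V, 𝒜) ⊆ X̃`. -/
def fromTorus : genericTorus M Y ⟶ D.Xtilde :=
  Spec.map (CommRingCat.ofHom (D.evalGeneric V)) ≫ D.chart hV

theorem fromTorus_basicOpen (f : Γ(Y, V)) [Nonempty (Y.basicOpen f)] :
    D.fromTorus (hV.basicOpen f) = D.fromTorus hV := by
  rw [fromTorus, fromTorus, ← D.map_chart hV f, ← Spec.map_comp_assoc]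
  rfl

theorem fromTorus_eq {W : Y.Opens} (hW : IsAffineOpen W) [Nonempty W] :
    D.fromTorus hV = D.fromTorus hW := by
  obtain ⟨f, g, h, hf⟩ := exists_basicOpen_le_affine_inter hV hW (genericPoint Y)
    ⟨genericPoint_mem, genericPoint_mem⟩
  have : Nonempty (Y.basicOpen f) := ⟨⟨_, hf⟩⟩
  have : Nonempty (Y.basicOpen g) := ⟨⟨_, h ▸ hf⟩⟩
  rw [← D.fromTorus_basicOpen hV f, ← D.fromTorus_basicOpen hW g]
  congr 1

instance isDominant_fromTorus : IsDominant (D.fromTorus hV) := by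
  refine ⟨fun x ↦ ?_⟩
  obtain ⟨W, hW, _, y, rfl⟩ := D.exists_mem_range_chart x
  have : IsDominant (Spec.map (CommRingCat.ofHom (D.evalGeneric W))) :=
    isDominant_specMap_of_injective _ (D.evalGeneric_injective W)
  rw [D.fromTorus_eq hV hW]
  refine map_mem_closure (D.chart hW).continuous (this.denseRange y) ?_
  rintro _ ⟨z, rfl⟩
  exact ⟨z, rfl⟩

end Chart

variable [Module.Free ℤ M]

theorem isReduced_sheafSections (V : Y.Opens) : _root_.IsReduced (D.sheafSections V) :=
  have := isDomain_addMonoidAlgebra Y.functionField M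
  isReduced_of_injective (D.sheafSections V).subtype Subtype.val_injective

instance isReduced_Xtilde : IsReduced D.Xtilde :=
  have (V : D.glueData.cover.I₀) : IsReduced (D.glueData.cover.X V) :=
    have := D.isReduced_sheafSections V.1
    inferInstanceAs (IsReduced (Spec (CommRingCat.of (D.sheafSections V.1))))
  .of_openCover _ D.glueData.cover

instance isIntegral_Xtilde : IsIntegral D.Xtilde := by
  obtain ⟨V, hV, hgV, -⟩ :=
    exists_isAffineOpen_mem_and_subset (U := ⊤) (x := genericPoint Y) trivial
  have : Nonempty V := ⟨⟨_, hgV⟩⟩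
  exact isIntegral_of_isDominant (D.fromTorus hV)

end PolyhedralDivisor

/-! ## The rational quotient map -/

instance nonempty_top_opens (X : Scheme.{u}) [Nonempty X] : Nonempty (⊤ : X.Opens) :=
  ⟨⟨Classical.arbitrary X, trivial⟩⟩

theorem toRationalMap_eq_of_isDominant {X C Z : Scheme.{u}} [IsReduced X] [C.IsSeparated]
    {f f' : X.PartialMap C} (ε : Z ⟶ X) [IsDominant ε] {k : Z ⟶ f.domain} {k' : Z ⟶ f'.domain}
    (hk : k ≫ f.domain.ι = ε) (hk' : k' ≫ f'.domain.ι = ε) (h : k ≫ f.hom = k' ≫ f'.hom) :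
    f.toRationalMap = f'.toRationalMap := by
  have hdense : Dense ((f.domain ⊓ f'.domain : X.Opens) : Set X) :=
    f.dense_domain.inter_of_isOpen_left f'.dense_domain f.domain.2
  have hrange : Set.range ε ⊆ Set.range (f.domain ⊓ f'.domain).ι := by
    rw [Scheme.Opens.range_ι]
    rintro _ ⟨z, rfl⟩
    exact ⟨by rw [← hk]; exact (k z).2, by rw [← hk']; exact (k' z).2⟩
  obtain ⟨l, hl⟩ : ∃ l, l ≫ (f.domain ⊓ f'.domain).ι = ε :=
    ⟨_, IsOpenImmersion.lift_fac (f.domain ⊓ f'.domain).ι ε hrange⟩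
  have hlk : l ≫ X.homOfLE inf_le_left = k := by
    rw [← cancel_mono f.domain.ι, Category.assoc, Scheme.homOfLE_ι, hl, hk]
  have hlk' : l ≫ X.homOfLE inf_le_right = k' := by
    rw [← cancel_mono f'.domain.ι, Category.assoc, Scheme.homOfLE_ι, hl, hk']
  have : IsDominant (l ≫ (f.domain ⊓ f'.domain).ι) := by rwa [hl]
  have : IsDominant l := .of_comp_of_isOpenImmersion l (f.domain ⊓ f'.domain).ι
  have heq : X.homOfLE inf_le_left ≫ f.hom =
      X.homOfLE (inf_le_right : f.domain ⊓ f'.domain ≤ _) ≫ f'.hom :=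
    ext_of_isDominant (ι := l) (by rw [reassoc_of% hlk, reassoc_of% hlk', h])
  exact Scheme.PartialMap.toRationalMap_eq_iff.mpr
    ⟨f.domain ⊓ f'.domain, hdense, inf_le_left, inf_le_right, heq⟩

section GenericProjection

variable (M : Type) [AddCommGroup M]

/-- The projection of the generic torus to the generic point of `Y`. -/
def genericProj (Y : Scheme.{0}) [IsIntegral Y] : genericTorus M Y ⟶ Y :=
  Spec.map (CommRingCat.ofHom AddMonoidAlgebra.singleZeroRingHom) ≫
    Y.fromSpecStalk (genericPoint Y)

theorem specMap_subtype_torusProj {Y : Scheme.{0}} [Y.Over SpecC] [IsNonsingularCurve Y]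
    {U : Y.Opens} (hU : IsAffineOpen U) [Nonempty U] :
    Spec.map (CommRingCat.ofHom (torusSections M U).subtype) ≫ torusProj M hU =
      genericProj M Y := by
  rw [genericProj, torusProj, ← hU.fromSpecStalk_eq_fromSpecStalk genericPoint_mem,
    IsAffineOpen.fromSpecStalk]
  erw [← Spec.map_comp_assoc, ← Spec.map_comp_assoc]
  rfl

end GenericProjection

namespace PolyhedralDivisor

variable {M : Type} [AddCommGroup M] {Y : Scheme.{0}} {σ : PointedCone ℚ (NQ M)}
  [Y.Over SpecC] [IsNonsingularCurve Y] (D : PolyhedralDivisor Y σ)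

/-- The morphism from the generic torus to `X` given by `Γ(Y, 𝒜) ⊆ K(Y)[M]`. -/
def toX : genericTorus M Y ⟶ D.X :=
  Spec.map (CommRingCat.ofHom (D.evalGeneric ⊤))

instance : IsDominant D.toX := isDominant_specMap_of_injective _ (D.evalGeneric_injective ⊤)

theorem fromTorus_contraction {V : Y.Opens} (hV : IsAffineOpen V) [Nonempty V] :
    D.fromTorus hV ≫ D.contraction = D.toX := by
  rw [fromTorus, Category.assoc, chart_contraction]
  exact (Spec.map_comp _ _).symm

theorem fromTorus_π {V : Y.Opens} (hV : IsAffineOpen V) [Nonempty V] :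
    D.fromTorus hV ≫ D.π = genericProj M Y := by
  rw [fromTorus, Category.assoc, chart_π, genericProj,
    ← hV.fromSpecStalk_eq_fromSpecStalk genericPoint_mem, IsAffineOpen.fromSpecStalk,
    ← Spec.map_comp_assoc, ← Spec.map_comp_assoc]
  congr 2
  exact CommRingCat.hom_ext (RingHom.ext (D.evalGeneric_structureMap V))

theorem specMap_subtype_torusToX {U : Y.Opens} (h : D.IsTrivialOn U) :
    Spec.map (CommRingCat.ofHom (torusSections M U).subtype) ≫ D.torusToX h = D.toX :=
  (Spec.map_comp _ _).symm

theorem specMap_fromSpec_over {R : CommRingCat.{0}} {U : Y.Opens} (hU : IsAffineOpen U)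
    (α : Γ(Y, U) ⟶ R) (β : CommRingCat.of (D.sheafSections ⊤) ⟶ R)
    (h : ∀ x : Γ(Y, ⊤), α (Y.presheaf.map (homOfLE (le_top : U ≤ ⊤)).op x) =
      β (D.structureMap ⊤ x)) :
    (Spec.map α ≫ hU.fromSpec) ≫ (Y ↘ SpecC) =
      (show _ ⟶ D.X from Spec.map β) ≫ (D.X ↘ SpecC) := by
  have hover := IsAffineOpen.SpecMap_appLE_fromSpec (Y ↘ SpecC) (isAffineOpen_top _) hU le_top
  rw [IsAffineOpen.fromSpec_top, Scheme.isoSpec_Spec_inv, ← Spec.map_comp] at hover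
  rw [Category.assoc, ← hover]
  refine (Spec.map_comp _ _).symm.trans (Eq.trans ?_ (Spec.map_comp _ _))
  exact congrArg Spec.map (CommRingCat.hom_ext (RingHom.ext fun c ↦
    h ((Y ↘ SpecC).app ⊤ ((Scheme.ΓSpecIso (CommRingCat.of ℂ)).inv c))))

theorem torusToX_over {U : Y.Opens} (hU : IsAffineOpen U) [Nonempty U] (h : D.IsTrivialOn U) :
    torusProj M hU ≫ (Y ↘ SpecC) = D.torusToX h ≫ (D.X ↘ SpecC) := by
  refine D.specMap_fromSpec_over hU (CommRingCat.ofHom (toTorusSections M U)) _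
    fun x ↦ Subtype.ext ?_
  change AddMonoidAlgebra.single (0 : M) (Y.germToFunctionField U
    (Y.presheaf.map (homOfLE (le_top : U ≤ ⊤)).op x)) = D.evalGeneric ⊤ (D.structureMap ⊤ x)
  rw [evalGeneric_structureMap, germToFunctionField_map]

theorem chart_over {U : Y.Opens} (hU : IsAffineOpen U) :
    D.chart hU ≫ D.π ≫ (Y ↘ SpecC) = D.chart hU ≫ D.contraction ≫ (D.X ↘ SpecC) := by
  rw [← Category.assoc, ← Category.assoc, chart_π, chart_contraction]
  exact D.specMap_fromSpec_over hU _ _ fun x ↦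
    congr($(D.structureHom.naturality (homOfLE (le_top : U ≤ ⊤)).op).hom x)

theorem isOpenImmersion_torusToX {U : Y.Opens} (hT : D.IsTrivialOn U) {w : M}
    {g : Y.functionField} (hg0 : g ≠ 0) (hg : AddMonoidAlgebra.single w g ∈ D.sections ⊤)
    (hg' : AddMonoidAlgebra.single (-w) g⁻¹ ∈ torusSections M U)
    (h : ∀ b ∈ torusSections M U, ∃ N : ℕ, AddMonoidAlgebra.single w g ^ N * b ∈ D.sections ⊤) :
    IsOpenImmersion (D.torusToX hT) := by
  let ρ : D.sheafSections ⊤ →+* torusSections M U := (D.evalGeneric ⊤).codRestrict _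
    fun a ↦ hT.mem_torusSections ((D.range_evalGeneric ⊤).le ⟨a, rfl⟩)
  let _ : Algebra (D.sheafSections ⊤) (torusSections M U) := ρ.toAlgebra
  have : IsLocalization.Away (⟨_, _, hg, rfl⟩ : D.sheafSections ⊤) (torusSections M U) := by
    refine .mk _ ?_ ?_ ?_
    · refine .of_mul_eq_one ⟨_, hg'⟩ (Subtype.ext ?_)
      change AddMonoidAlgebra.single w g * AddMonoidAlgebra.single (-w) g⁻¹ = 1
      rw [AddMonoidAlgebra.single_mul_single, add_neg_cancel, mul_inv_cancel₀ hg0]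
      rfl
    · rintro ⟨b, hb⟩
      obtain ⟨N, hN⟩ := h b hb
      exact ⟨N, ⟨_, _, hN, rfl⟩, Subtype.ext (mul_comm b _)⟩
    · exact fun a b hab ↦ ⟨0, by rw [D.evalGeneric_injective ⊤ congr(($hab).1)]⟩
  exact IsOpenImmersion.of_isLocalization (⟨_, _, hg, rfl⟩ : D.sheafSections ⊤)

variable {D} in
theorem IsRationalQuotientMap.exists_partialMap_lift {C : Scheme.{0}} {j : Y ⟶ C} {p : D.X ⤏ C}
    (hp : D.IsRationalQuotientMap j p) :
    ∃ f : D.X.PartialMap C, f.toRationalMap = p ∧ ∃ k : genericTorus M Y ⟶ f.domain,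
      k ≫ f.domain.ι = D.toX ∧ k ≫ f.hom = genericProj M Y ≫ j := by
  obtain ⟨U, hU, hUn, hT, -, f, rfl, g, hg, hg'⟩ := hp
  refine ⟨f, rfl, Spec.map (CommRingCat.ofHom (torusSections M U).subtype) ≫ g, ?_, ?_⟩
  · rw [← D.specMap_subtype_torusToX hT, ← hg]
    exact Category.assoc _ _ _
  · rw [← specMap_subtype_torusProj M hU]
    exact (Category.assoc _ _ _).trans
      ((congrArg (Spec.map _ ≫ ·) hg').trans (Category.assoc _ _ _).symm)

variable [Module.Free ℤ M]

section IsRationalQuotientMap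

variable {D} {C : Scheme.{0}} [C.IsSeparated] {j : Y ⟶ C} {p p' : D.X ⤏ C}

theorem IsRationalQuotientMap.exists_toPartialMap_lift (hp : D.IsRationalQuotientMap j p) :
    ∃ k : genericTorus M Y ⟶ p.toPartialMap.domain,
      k ≫ p.toPartialMap.domain.ι = D.toX ∧ k ≫ p.toPartialMap.hom = genericProj M Y ≫ j := by
  obtain ⟨f, rfl, k, hk, hk'⟩ := hp.exists_partialMap_lift
  refine ⟨k ≫ D.X.homOfLE f.le_domain_toRationalMap, ?_, ?_⟩
  · rw [Category.assoc]
    exact (congrArg (k ≫ ·) (Scheme.homOfLE_ι _ _)).trans hk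
  · rw [← hk', Category.assoc]
    exact congrArg (k ≫ ·) f.toPartialMap_toRationalMap_restrict

theorem IsRationalQuotientMap.unique (hp : D.IsRationalQuotientMap j p)
    (hp' : D.IsRationalQuotientMap j p') : p = p' := by
  obtain ⟨f, rfl, k, hk, hkf⟩ := hp.exists_partialMap_lift
  obtain ⟨f', rfl, k', hk', hkf'⟩ := hp'.exists_partialMap_lift
  exact toRationalMap_eq_of_isDominant D.toX hk hk' (hkf.trans hkf'.symm)

end IsRationalQuotientMap

theorem exists_isRationalQuotientMap (hσ : σ.FG) (hσ' : (σ : ConvexCone ℚ (NQ M)).Salient)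
    (hD : ∀ u ∈ interiorWeights σ, IsBig (D.eval u)) {C : Scheme.{0}} [C.Over SpecC] (j : Y ⟶ C)
    [j.IsOver SpecC] : ∃ p : D.X ⤏ C, p.IsOver SpecC ∧ D.IsRationalQuotientMap j p := by
  obtain ⟨U, hU, hUn, hT, w, g, hg0, hg, hg', h⟩ := D.exists_section_localizing hσ hσ' hD
  have hopen := D.isOpenImmersion_torusToX hT hg0 hg hg' h
  have hnonempty : (Set.range (D.torusToX hT)).Nonempty :=
    ⟨_, Spec.map (CommRingCat.ofHom (torusSections M U).subtype) (genericPoint (genericTorus M Y)),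
      rfl⟩
  let f : D.X.PartialMap C :=
    { domain := (D.torusToX hT).opensRange
      dense_domain := (D.torusToX hT).opensRange.2.dense hnonempty
      hom := (D.torusToX hT).isoOpensRange.inv ≫ torusProj M hU ≫ j }
  have hf : f.IsOver SpecC := by
    refine ⟨?_⟩
    change ((D.torusToX hT).isoOpensRange.inv ≫ torusProj M hU ≫ j) ≫ (C ↘ SpecC) =
      (D.torusToX hT).opensRange.ι ≫ (D.X ↘ SpecC)
    rw [Category.assoc, Category.assoc, comp_over, D.torusToX_over hU hT,
      Scheme.Hom.isoOpensRange_inv_comp_assoc]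
  exact ⟨f.toRationalMap, inferInstance, U, hU, hUn, hT, hopen, f, rfl,
    (D.torusToX hT).isoOpensRange.hom, Scheme.Hom.isoOpensRange_hom_ι _, Iso.hom_inv_id_assoc _ _⟩

end PolyhedralDivisor

/-! ## Integrality over `X × C` -/

theorem of_forall_isPullback {P : MorphismProperty Scheme.{u}} [IsZariskiLocalAtTarget P]
    {W Z : Scheme.{u}} (f : W ⟶ Z)
    (H : ∀ z : Z, ∃ (V U : Scheme.{u}) (i : V ⟶ Z) (c : U ⟶ W) (l : U ⟶ V) (_ : IsOpenImmersion i),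
      z ∈ Set.range i ∧ IsPullback c l f i ∧ P l) : P f := by
  choose V U i c l hi hz hpullback hl using H
  refine IsZariskiLocalAtTarget.of_iSup_eq_top (fun z ↦ (i z).opensRange) ?_ fun z ↦ ?_
  · exact top_le_iff.mp fun z _ ↦ Opens.mem_iSup.mpr ⟨z, hz z⟩
  · refine (P.arrow_mk_iso_iff (morphismRestrictOpensRange f _)).mpr ?_
    rw [← (hpullback z).isoPullback_inv_snd]
    exact (P.cancel_left_of_respectsIso _ _).mpr (hl z)

theorem isIntegralElem_of_isIntegral_range {R S T : Type*} [CommRing R] [CommRing S] [CommRing T]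
    (f : R →+* S) (g : S →+* T) (hg : Function.Injective g) {s : S}
    (h : IsIntegral (g.comp f).range (g s)) : f.IsIntegralElem s := by
  obtain ⟨q, hq, hqs⟩ := h
  obtain ⟨q', rfl, -, hq'⟩ := Polynomial.lifts_and_natDegree_eq_and_monic (p := q)
    (f := (g.comp f).rangeRestrict)
    ((Polynomial.lifts_iff_coeff_lifts q).mpr fun n ↦ (g.comp f).rangeRestrict_surjective _) hq
  refine ⟨q', hq', hg ?_⟩
  rw [Polynomial.eval₂_map] at hqs
  rw [map_zero, Polynomial.hom_eval₂]
  exact hqs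

theorem isIntegral_map_of_isIntegral_comap {A B : Type*} [CommRing A] [CommRing B] (f : A →+* B)
    {R : Subring B} {a : A} (ha : IsIntegral (R.comap f) a) : IsIntegral R (f a) := by
  obtain ⟨q, hq, hqa⟩ := ha
  refine ⟨q.map (f.restrict _ R fun _ h ↦ h), hq.map _, ?_⟩
  rw [Polynomial.eval₂_map]
  have heval := congr(f $hqa)
  rw [map_zero, Polynomial.hom_eval₂] at heval
  exact heval

namespace PolyhedralDivisor

variable {M : Type} [AddCommGroup M] {Y : Scheme.{0}} {σ : PointedCone ℚ (NQ M)}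
  [Y.Over SpecC] [IsNonsingularCurve Y] (D : PolyhedralDivisor Y σ)

theorem single_zero_mem_sections {b : Y.functionField} (hb : b ∈ divisorSections (Y := Y) 0 ⊤) :
    AddMonoidAlgebra.single (0 : M) b ∈ D.sections ⊤ :=
  D.single_mem_sections (zero_mem _) (by rwa [show D.eval 0 = 0 from funext D.eval_zero])

theorem isIntegral_of_mem_sections_of_isIntegral
    (hD : ∀ u ∈ weightMonoid σ, IsSemiample (D.eval u)) {V : Y.Opens} (hV : IsAffineOpen V)
    [Nonempty V] {R : Subring (AddMonoidAlgebra Y.functionField M)} (hR : D.sections ⊤ ≤ R)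
    (hR' : ∀ g : Γ(Y, V),
      IsIntegral R (AddMonoidAlgebra.single (0 : M) (Y.germToFunctionField V g)))
    {a : AddMonoidAlgebra Y.functionField M} (ha : a ∈ D.sections V) : IsIntegral R a :=
  isIntegral_trans (A := integralClosure R (AddMonoidAlgebra Y.functionField M)) a <|
    D.isIntegral_of_mem_sections hD hV
      (R := (integralClosure R (AddMonoidAlgebra Y.functionField M)).toSubring)
      (fun b hb ↦ isIntegral_algebraMap (x := (⟨b, hR hb⟩ : R))) hR' ha

variable [Module.Free ℤ M]

theorem contraction_over : D.contraction ≫ (D.X ↘ SpecC) = D.π ≫ (Y ↘ SpecC) := by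
  obtain ⟨V, hV, hxV, -⟩ :=
    exists_isAffineOpen_mem_and_subset (U := ⊤) (x := genericPoint Y) trivial
  have : Nonempty V := ⟨⟨_, hxV⟩⟩
  refine ext_of_isDominant (ι := D.fromTorus hV) ?_
  rw [fromTorus, Category.assoc, Category.assoc, chart_over]

variable {C : Scheme.{0}} [C.Over SpecC] (j : Y ⟶ C) [j.IsOver SpecC]

/-- The morphism `X̃ ⟶ X × C` with components the contraction and `X̃ ⟶ Y ⟶ C`; the graph closure
is the closure of its image. -/
def toProduct : D.Xtilde ⟶ pullback (D.X ↘ SpecC) (C ↘ SpecC) :=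
  pullback.lift D.contraction (D.π ≫ j) (by
    rw [contraction_over, Category.assoc, comp_over j SpecC])

theorem toProduct_fst : D.toProduct j ≫ pullback.fst _ _ = D.contraction :=
  pullback.lift_fst _ _ _

theorem toProduct_snd : D.toProduct j ≫ pullback.snd _ _ = D.π ≫ j :=
  pullback.lift_snd _ _ _

instance : IsAffineHom (pullback.snd (D.X ↘ SpecC) (C ↘ SpecC)) :=
  have : IsAffineHom (D.X ↘ SpecC) := inferInstance
  isAffineHom_isStableUnderBaseChange.of_isPullback
    (IsPullback.of_hasPullback (D.X ↘ SpecC) (C ↘ SpecC)) inferInstance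

section Chart

variable {V : C.Opens} (hV : IsAffineOpen (j ⁻¹ᵁ V))
  (hW : IsAffineOpen (pullback.snd (D.X ↘ SpecC) (C ↘ SpecC) ⁻¹ᵁ V))

theorem exists_isPullback_chart :
    ∃ α, IsPullback (D.chart hV) (Spec.map α) (D.toProduct j) hW.fromSpec := by
  have hrange : D.toProduct j ⁻¹ᵁ hW.fromSpec.opensRange = (D.chart hV).opensRange := by
    rw [hW.opensRange_fromSpec, opensRange_chart, ← Scheme.Hom.comp_preimage,
      ← Scheme.Hom.comp_preimage, toProduct_snd]
  have hsub : Set.range (D.chart hV ≫ D.toProduct j) ⊆ Set.range hW.fromSpec := by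
    rintro _ ⟨x, rfl⟩
    exact hrange.ge ⟨x, rfl⟩
  obtain ⟨α, hα⟩ := Spec.map_surjective
    (IsOpenImmersion.lift hW.fromSpec (D.chart hV ≫ D.toProduct j) hsub)
  refine ⟨α, (IsOpenImmersion.isPullback _ _ _ _ ?_ hrange).flip⟩
  rw [hα, IsOpenImmersion.lift_fac]

variable {D j hV hW}
  {α : Γ(pullback (D.X ↘ SpecC) (C ↘ SpecC), pullback.snd (D.X ↘ SpecC) (C ↘ SpecC) ⁻¹ᵁ V) ⟶
    CommRingCat.of (D.sheafSections (j ⁻¹ᵁ V))}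
  (hα : D.chart hV ≫ D.toProduct j = Spec.map α ≫ hW.fromSpec)

variable [Nonempty (j ⁻¹ᵁ V)]

include hα

theorem sections_le_range_evalGeneric_comp :
    D.sections ⊤ ≤ ((D.evalGeneric (j ⁻¹ᵁ V)).comp α.hom).range := by
  obtain ⟨μ, hμ⟩ := Spec.map_surjective (R := CommRingCat.of (D.sheafSections ⊤))
    (hW.fromSpec ≫ pullback.fst (D.X ↘ SpecC) (C ↘ SpecC))
  have hμα : μ ≫ α = CommRingCat.ofHom (D.res le_top) := by
    refine Spec.map_injective ((Spec.map_comp _ _).trans ?_)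
    rw [hμ]
    exact (Category.assoc _ _ _).symm.trans ((congrArg (· ≫ pullback.fst _ _) hα.symm).trans
      ((Category.assoc _ _ _).trans
        ((congrArg (D.chart hV ≫ ·) (D.toProduct_fst j)).trans (D.chart_contraction hV))))
  rw [← range_evalGeneric]
  rintro _ ⟨b, rfl⟩
  have hb : α (μ b) = D.res le_top b := congr($hμα b)
  exact ⟨μ b, (congrArg (D.evalGeneric _) hb).trans (D.evalGeneric_res _ b)⟩

theorem single_zero_pullbackFunction_mem_range (hV' : IsAffineOpen V)
    (f : Γ(C, V)) : AddMonoidAlgebra.single (0 : M) (pullbackFunction j V f) ∈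
      ((D.evalGeneric (j ⁻¹ᵁ V)).comp α.hom).range := by
  let snd := pullback.snd (D.X ↘ SpecC) (C ↘ SpecC)
  have hαV : snd.appLE V (snd ⁻¹ᵁ V) le_rfl ≫ α =
      j.app V ≫ CommRingCat.ofHom (D.structureMap (j ⁻¹ᵁ V)) := by
    refine Spec.map_injective ?_
    rw [← cancel_mono hV'.fromSpec, Spec.map_comp, Spec.map_comp, Category.assoc, Category.assoc,
      IsAffineOpen.SpecMap_appLE_fromSpec _ hV' hW le_rfl, Scheme.Hom.app_eq_appLE,
      IsAffineOpen.SpecMap_appLE_fromSpec _ hV' hV le_rfl, ← reassoc_of% hα, toProduct_snd,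
      ← Category.assoc, ← Category.assoc, chart_π]
  have hf : α (snd.appLE V (snd ⁻¹ᵁ V) le_rfl f) = D.structureMap (j ⁻¹ᵁ V) (j.app V f) :=
    congr($hαV f)
  exact ⟨_, (congrArg (D.evalGeneric _) hf).trans (D.evalGeneric_structureMap _ _)⟩

end Chart

theorem isIntegralHom_toProduct [IsNonsingularCurve C] [IsOpenImmersion j]
    (hD : ∀ u ∈ weightMonoid σ, IsSemiample (D.eval u)) : IsIntegralHom (D.toProduct j) := by
  have : IsZariskiLocalAtTarget (@IsIntegralHom : MorphismProperty Scheme.{0}) :=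
    (HasAffineProperty.iff.mp IsIntegralHom.hasAffineProperty).1
  refine of_forall_isPullback (P := @IsIntegralHom) _ fun z ↦ ?_
  obtain ⟨V, hzV, hV, hjV, _, hint⟩ :=
    exists_isAffineOpen_isIntegral j (pullback.snd (D.X ↘ SpecC) (C ↘ SpecC) z)
  have hW : IsAffineOpen (pullback.snd (D.X ↘ SpecC) (C ↘ SpecC) ⁻¹ᵁ V) := hV.preimage _
  obtain ⟨α, hα⟩ := D.exists_isPullback_chart j hjV hW
  refine ⟨_, _, hW.fromSpec, D.chart hjV, _, inferInstance, hW.range_fromSpec.ge hzV, hα,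
    IsIntegralHom.SpecMap_iff.mpr fun a ↦ ?_⟩
  have hsections := sections_le_range_evalGeneric_comp hα.w
  refine isIntegralElem_of_isIntegral_range α.hom _ (D.evalGeneric_injective _) <|
    D.isIntegral_of_mem_sections_of_isIntegral hD hjV hsections (fun g ↦ ?_)
      ((D.range_evalGeneric _).le ⟨a, rfl⟩)
  let single₀ : Y.functionField →+* AddMonoidAlgebra Y.functionField M :=
    AddMonoidAlgebra.singleZeroRingHom
  have hg := hint (((D.evalGeneric _).comp α.hom).range.comap single₀)
    (single_zero_pullbackFunction_mem_range hα.w hV)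
    (fun b hb ↦ hsections (D.single_zero_mem_sections hb)) g
  exact isIntegral_map_of_isIntegral_comap single₀ hg

end PolyhedralDivisor

/-! ## Birational morphisms and normalization -/

theorem exists_lift_of_isClosedImmersion {V W P : Scheme.{u}} [IsReduced W] (i : V ⟶ P)
    [IsClosedImmersion i] (g : W ⟶ P) (h : Set.range g ⊆ Set.range i) : ∃ f, f ≫ i = g := by
  have : Surjective (pullback.fst g i) := by
    refine ⟨fun w ↦ ?_⟩
    obtain ⟨v, hv⟩ := h ⟨w, rfl⟩
    obtain ⟨t, ht, -⟩ := Scheme.Pullback.exists_preimage_pullback w v hv.symm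
    exact ⟨t, ht⟩
  have := isIso_of_isClosedImmersion_of_surjective (pullback.fst g i)
  refine ⟨inv (pullback.fst g i) ≫ pullback.snd g i, ?_⟩
  rw [Category.assoc, ← pullback.condition, IsIso.inv_hom_id_assoc]

theorem map_genericPoint_of_isDominant {W Z : Scheme.{u}} [IrreducibleSpace W] [IrreducibleSpace Z]
    (f : W ⟶ Z) [IsDominant f] : f (genericPoint W) = genericPoint Z := by
  have h := (genericPoint_spec W).image f.continuous
  rw [Set.image_univ, f.denseRange.closure_range] at h
  exact h.eq (genericPoint_spec Z)

instance isDominant_fromGenericPoint (W : Scheme.{0}) [IsIntegral W] :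
    IsDominant (fromGenericPoint W) := by
  refine ⟨dense_iff_closure_eq.mpr (Set.univ_subset_iff.mp ?_)⟩
  rw [← (genericPoint_spec W).def]
  exact closure_mono (Set.singleton_subset_iff.mpr ⟨_, Scheme.fromSpecStalk_closedPoint⟩)

section Birational

variable {V W Z : Scheme.{0}} [IsIntegral V] [IsIntegral W] [IsIntegral Z]

theorem specMap_stalkMap_fromGenericPoint {f : W ⟶ Z} (hf : f (genericPoint W) = genericPoint Z) :
    Spec.map ((Z.presheaf.stalkCongr (.of_eq hf.symm)).hom ≫ f.stalkMap (genericPoint W)) ≫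
      fromGenericPoint Z = fromGenericPoint W ≫ f := by
  refine Eq.trans ?_ (Scheme.SpecMap_stalkMap_fromSpecStalk f)
  rw [Spec.map_comp, Category.assoc]
  exact congrArg (Spec.map (f.stalkMap (genericPoint W)) ≫ ·)
    (Scheme.SpecMap_stalkSpecializes_fromSpecStalk (specializes_of_eq hf))

theorem exists_comp_fromGenericPoint_eq (f : W ⟶ Z) [IsDominant f] :
    ∃ k, k ≫ fromGenericPoint Z = fromGenericPoint W ≫ f :=
  ⟨_, specMap_stalkMap_fromGenericPoint (map_genericPoint_of_isDominant f)⟩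

/-- A morphism of integral schemes is birational if it restricts to an isomorphism of generic
points; this is formulated through `Spec K(W) ≅ Spec K(Z)` to avoid transporting stalks along the
equality `f (genericPoint W) = genericPoint Z`. -/
def IsBirational (f : W ⟶ Z) : Prop :=
  ∃ k : Spec W.functionField ≅ Spec Z.functionField,
    k.hom ≫ fromGenericPoint Z = fromGenericPoint W ≫ f

theorem isBirational_of_surjective {f : W ⟶ Z} {κ : Z.functionField ⟶ W.functionField}
    (h : Spec.map κ ≫ fromGenericPoint Z = fromGenericPoint W ≫ f)
    (hκ : Function.Surjective κ) : IsBirational f := by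
  have : IsIso κ := (ConcreteCategory.isIso_iff_bijective κ).mpr
    ⟨RingHom.injective (R := Z.functionField) (S := W.functionField) κ.hom, hκ⟩
  exact ⟨asIso (Spec.map κ), h⟩

theorem isBirational_of_isOpenImmersion (f : W ⟶ Z) [IsOpenImmersion f] : IsBirational f :=
  ⟨asIso (Spec.map _), specMap_stalkMap_fromGenericPoint (genericPoint_eq_of_isOpenImmersion f)⟩

theorem IsBirational.of_isOpenImmersion_comp {c : V ⟶ W} [IsOpenImmersion c] {f : W ⟶ Z}
    (h : IsBirational (c ≫ f)) : IsBirational f := by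
  obtain ⟨k, hk⟩ := isBirational_of_isOpenImmersion c
  obtain ⟨l, hl⟩ := h
  exact ⟨k.symm ≪≫ l, by
    rw [Iso.trans_hom, Iso.symm_hom, Category.assoc, Iso.inv_comp_eq, hl, reassoc_of% hk]⟩

theorem IsBirational.isDominant {f : W ⟶ Z} (h : IsBirational f) : IsDominant f := by
  obtain ⟨k, hk⟩ := h
  have : IsDominant (fromGenericPoint W ≫ f) := hk ▸ inferInstance
  exact .of_comp (fromGenericPoint W) f

theorem IsBirational.of_comp {f : V ⟶ W} {g : W ⟶ Z} [IsDominant f]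
    (h : IsBirational (f ≫ g)) : IsBirational f := by
  have := h.isDominant
  have : IsDominant g := .of_comp f g
  obtain ⟨k, hk⟩ := exists_comp_fromGenericPoint_eq f
  obtain ⟨l, hl⟩ := exists_comp_fromGenericPoint_eq g
  obtain ⟨m, hm⟩ := h
  have hkl : k ≫ l = m.hom := by
    rw [← cancel_mono (fromGenericPoint Z), Category.assoc, hl, reassoc_of% hk, hm]
  obtain ⟨κ, rfl⟩ := Spec.map_surjective k
  obtain ⟨l, rfl⟩ := Spec.map_surjective l
  have hlκ : IsIso (Spec.map (l ≫ κ)) := by rw [Spec.map_comp, hkl]; infer_instance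
  exact isBirational_of_surjective hk (.of_comp (g := l) (isIso_SpecMap_iff.mp hlκ).2)

theorem IsBirational.hom_ext {f : W ⟶ Z} [IsSeparated f] (hf : IsBirational f) {g h : V ⟶ W}
    [IsDominant g] [IsDominant h] (hgh : g ≫ f = h ≫ f) : g = h := by
  refine ext_of_isDominant_of_isSeparated f hgh (fromGenericPoint V) ?_
  obtain ⟨k, hk⟩ := exists_comp_fromGenericPoint_eq g
  obtain ⟨l, hl⟩ := exists_comp_fromGenericPoint_eq h
  obtain ⟨m, hm⟩ := hf
  have : Mono (fromGenericPoint W ≫ f) := hm ▸ inferInstance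
  have hkl : k = l := by
    rw [← cancel_mono (fromGenericPoint W ≫ f), reassoc_of% hk, reassoc_of% hl, hgh]
  rw [← hk, ← hl, hkl]

theorem fromGenericPoint_spec (A : CommRingCat.{0}) [IsDomain A] : fromGenericPoint (Spec A) =
    Spec.map (CommRingCat.ofHom (algebraMap A (Spec A).functionField)) :=
  Spec.fromSpecStalk_eq' _ _

theorem isBirational_specMap {A B : CommRingCat.{0}} [IsDomain A] [IsDomain B] (ψ : A ⟶ B)
    (hψ : Function.Injective ψ) (h : ∀ b : B, ∃ s t : A, ψ s ≠ 0 ∧ ψ s * b = ψ t) :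
    IsBirational (Spec.map ψ) := by
  have := isDominant_specMap_of_injective ψ hψ
  obtain ⟨k, hk⟩ := exists_comp_fromGenericPoint_eq (Spec.map ψ)
  obtain ⟨κ, rfl⟩ := Spec.map_surjective k
  refine isBirational_of_surjective hk fun z ↦ ?_
  rw [fromGenericPoint_spec, fromGenericPoint_spec, ← Spec.map_comp, ← Spec.map_comp] at hk
  let θ : (Spec A).functionField →+* (Spec B).functionField := κ.hom
  have hθ (a : A) : θ (algebraMap A _ a) = algebraMap B _ (ψ a) := congr($(Spec.map_injective hk) a)
  have hB (b : B) : ∃ x, θ x = algebraMap B _ b := by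
    obtain ⟨s, t, hs, hst⟩ := h b
    have hs' : algebraMap B (Spec B).functionField (ψ s) ≠ 0 := by simpa using hs
    exact ⟨algebraMap A _ t / algebraMap A _ s, by
      rw [map_div₀, hθ, hθ, div_eq_iff hs', ← hst, map_mul, mul_comm]⟩
  obtain ⟨b, c, -, rfl⟩ := IsFractionRing.div_surjective (A := B) (z : (Spec B).functionField)
  obtain ⟨x, hx⟩ := hB b
  obtain ⟨y, hy⟩ := hB c
  exact ⟨x / y, (map_div₀ θ x y).trans (by rw [hx, hy])⟩

theorem fromGenericPoint_preimage (U : W.Opens) [Nonempty U] : fromGenericPoint W ⁻¹ᵁ U = ⊤ := by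
  refine top_le_iff.mp fun x _ ↦ ?_
  rw [Subsingleton.elim (α := PrimeSpectrum W.functionField) x (IsLocalRing.closedPoint _)]
  have hclosed : fromGenericPoint W (IsLocalRing.closedPoint _) = genericPoint W :=
    Scheme.fromSpecStalk_closedPoint
  change fromGenericPoint W (IsLocalRing.closedPoint _) ∈ U
  rw [hclosed]
  exact genericPoint_mem

theorem exists_fromGenericPoint_app_eq (U : W.Opens) [Nonempty U] :
    ∃ ψ : W.functionField ≅ Γ(Spec W.functionField, fromGenericPoint W ⁻¹ᵁ U),
      (fromGenericPoint W).app U = W.germToFunctionField U ≫ ψ.hom :=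
  ⟨(Scheme.ΓSpecIso W.functionField).symm ≪≫
    (Spec W.functionField).presheaf.mapIso (eqToIso (fromGenericPoint_preimage U)).op,
    Scheme.fromSpecStalk_app genericPoint_mem⟩

theorem injective_app_comp_fromGenericPoint {T : Scheme.{0}} (k : T ⟶ Spec W.functionField)
    [IsIso k] (U : W.Opens) [Nonempty U] :
    Function.Injective ((k ≫ fromGenericPoint W).app U) := by
  obtain ⟨ψ, hψ⟩ := exists_fromGenericPoint_app_eq U
  rw [Scheme.Hom.comp_app, hψ]
  have hbij := (ConcreteCategory.isIso_iff_bijective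
    (ψ.hom ≫ k.app (fromGenericPoint W ⁻¹ᵁ U))).mp inferInstance
  exact hbij.1.comp (W.germToFunctionField_injective U)

theorem mem_range_app_comp_fromGenericPoint {T : Scheme.{0}} (k : T ⟶ Spec W.functionField)
    [IsIso k] {U : W.Opens} [Nonempty U] (hU : IsAffineOpen U) [IsIntegrallyClosed Γ(W, U)]
    {b : Γ(T, (k ≫ fromGenericPoint W) ⁻¹ᵁ U)}
    (hb : ((k ≫ fromGenericPoint W).app U).hom.IsIntegralElem b) :
    b ∈ Set.range ((k ≫ fromGenericPoint W).app U) := by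
  have := functionField_isFractionRing_of_isAffineOpen W U hU
  obtain ⟨ψ, hψ⟩ := exists_fromGenericPoint_app_eq U
  rw [Scheme.Hom.comp_app, hψ] at hb ⊢
  have hbij := (ConcreteCategory.isIso_iff_bijective
    (ψ.hom ≫ k.app (fromGenericPoint W ⁻¹ᵁ U))).mp inferInstance
  obtain ⟨x, rfl⟩ := hbij.2 b
  obtain ⟨q, hq, hqx⟩ := hb
  have hx : _root_.IsIntegral Γ(W, U) x := ⟨q, hq, hbij.1 <|
    (Polynomial.hom_eval₂ _ _ (ψ.hom ≫ k.app _).hom _).trans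
      (hqx.trans (map_zero _).symm)⟩
  obtain ⟨a, rfl⟩ := IsIntegrallyClosed.isIntegral_iff.mp hx
  exact ⟨a, rfl⟩

end Birational

theorem isIso_normalizationDesc {T W Z : Scheme.{u}} (g : T ⟶ Z) [QuasiCompact g]
    [QuasiSeparated g] (f₁ : T ⟶ W) (f : W ⟶ Z) [IsIntegralHom f] (H : g = f₁ ≫ f)
    (h : ∀ w : W, ∃ U : W.Opens, w ∈ U ∧ IsAffineOpen U ∧ Function.Injective (f₁.app U) ∧
      ∀ b, (f₁.app U).hom.IsIntegralElem b → b ∈ Set.range (f₁.app U)) :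
    IsIso (g.normalizationDesc f₁ f H) := by
  have hd : g.toNormalization ≫ g.normalizationDesc f₁ f H = f₁ :=
    g.toNormalization_normalizationDesc f₁ f H
  have hdi : IsIntegralHom (g.normalizationDesc f₁ f H) := inferInstance
  generalize g.normalizationDesc f₁ f H = d at hd hdi
  subst hd
  change MorphismProperty.isomorphisms _ d
  refine IsZariskiLocalAtTarget.of_forall_exists_morphismRestrict (P := .isomorphisms _) fun w ↦ ?_
  obtain ⟨U, hwU, hU, hinj, hint⟩ := h w
  refine ⟨U, hwU, (isIso_morphismRestrict_iff_isIso_app d hU).mpr ?_⟩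
  have : IsSchemeTheoreticallyDominant g.toNormalization := ⟨g.ker_toNormalization⟩
  let t := g.toNormalization.app (d ⁻¹ᵁ U)
  have ht : Function.Injective t := g.toNormalization.app_injective _
  rw [Scheme.Hom.comp_app] at hinj hint
  refine (ConcreteCategory.isIso_iff_bijective _).mpr ⟨.of_comp (f := t) hinj, fun b ↦ ?_⟩
  obtain ⟨q, hq, hqb⟩ := d.isIntegral_app U hU b
  obtain ⟨a, ha⟩ := hint (t b) ⟨q, hq,
    (Polynomial.hom_eval₂ _ _ t.hom _).symm.trans (congr(t $hqb).trans (map_zero _))⟩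
  exact ⟨a, ht ha⟩

theorem exists_iso_normalization {W Z : Scheme.{0}} [IsIntegral W] [IsIntegral Z]
    [QuasiSeparatedSpace Z] (f : W ⟶ Z) [IsIntegralHom f] (hf : IsBirational f)
    (hW : ∀ w : W, ∃ U : W.Opens, w ∈ U ∧ IsAffineOpen U ∧ IsIntegrallyClosed Γ(W, U)) :
    ∃ e : W ≅ normalization Z, e.hom ≫ fromNormalization Z = f := by
  obtain ⟨k, hk⟩ := hf
  have hgen : fromGenericPoint Z = (k.inv ≫ fromGenericPoint W) ≫ f := by
    rw [Category.assoc, ← hk, Iso.inv_hom_id_assoc]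
  have : IsIso ((fromGenericPoint Z).normalizationDesc (k.inv ≫ fromGenericPoint W) f hgen) :=
    isIso_normalizationDesc _ _ _ _ fun w ↦ by
      obtain ⟨U, hwU, hU, hc⟩ := hW w
      have : Nonempty U := ⟨⟨w, hwU⟩⟩
      exact ⟨U, hwU, hU, injective_app_comp_fromGenericPoint k.inv U,
        fun b hb ↦ mem_range_app_comp_fromGenericPoint k.inv hU hb⟩
  let e : (fromGenericPoint Z).normalization ≅ W :=
    asIso ((fromGenericPoint Z).normalizationDesc (k.inv ≫ fromGenericPoint W) f hgen)
  exact ⟨e.symm, (Iso.inv_comp_eq e).mpr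
    ((fromGenericPoint Z).normalizationDesc_comp _ f hgen).symm⟩

/-! ## The comparison with the normalized graph closure -/

section Graph

variable {X C : Scheme.{0}} [X.Over SpecC] [C.Over SpecC] [IsIntegral X] [C.IsSeparated]
  (p : X ⤏ C) [p.IsOver SpecC]

theorem graph_fst : graph p ≫ pullback.fst _ _ = p.toPartialMap.domain.ι := pullback.lift_fst _ _ _

theorem graph_snd : graph p ≫ pullback.snd _ _ = p.toPartialMap.hom := pullback.lift_snd _ _ _

theorem range_graphClosureι : Set.range (graphClosureι p) = graphClosureSet p :=
  (Scheme.IdealSheafData.range_subschemeι _).trans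
    (Scheme.IdealSheafData.coe_support_vanishingIdeal _)

theorem exists_lift_graphClosureι {W : Scheme.{0}} [IsReduced W]
    (g : W ⟶ pullback (X ↘ SpecC) (C ↘ SpecC)) (h : Set.range g ⊆ graphClosureSet p) :
    ∃ f : W ⟶ graphClosure p, f ≫ graphClosureι p = g :=
  exists_lift_of_isClosedImmersion (graphClosureι p) g ((range_graphClosureι p).symm ▸ h)

theorem exists_dominant_lift_graph :
    ∃ l : (p.toPartialMap.domain : Scheme.{0}) ⟶ graphClosure p,
      IsDominant l ∧ l ≫ graphClosureι p = graph p := by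
  obtain ⟨l, hl⟩ := exists_lift_graphClosureι p (graph p) subset_closure
  refine ⟨l, ⟨fun z ↦ ?_⟩, hl⟩
  rw [(graphClosureι p).isClosedEmbedding.isInducing.closure_eq_preimage_closure_image,
    ← Set.range_comp]
  change graphClosureι p z ∈ closure (Set.range (l ≫ graphClosureι p))
  rw [hl]
  exact (range_graphClosureι p).le ⟨z, rfl⟩

theorem comp_fromNormalization_eq_iff [IsAffine X] {W : Scheme.{0}} {g : W ⟶ Xdd p}
    {f : W ⟶ graphClosure p} : g ≫ fromNormalization (graphClosure p) = f ↔
      g ≫ XddToX p = f ≫ graphClosureι p ≫ pullback.fst _ _ ∧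
        g ≫ XddToC p = f ≫ graphClosureι p ≫ pullback.snd _ _ := by
  rw [← cancel_mono (graphClosureι p), pullback.hom_ext_iff]
  simp only [XddToX, XddToC, Category.assoc]
  exact Iff.rfl

end Graph

namespace PolyhedralDivisor

variable {M : Type} [AddCommGroup M] {Y : Scheme.{0}} {σ : PointedCone ℚ (NQ M)}
  [Y.Over SpecC] [IsNonsingularCurve Y] (D : PolyhedralDivisor Y σ)

theorem IsTrivialOn.sections_le_torusSections {D : PolyhedralDivisor Y σ} {U : Y.Opens}
    (hT : D.IsTrivialOn U) : D.sections U ≤ torusSections M U := by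
  intro b hb u hu
  refine ⟨trivial, fun h0 P hP ↦ ?_⟩
  have hord := (hb u hu).2 h0 P hP
  rwa [hT.eval_eq_zero (hb u hu).1 hP] at hord

variable [Module.Free ℤ M]

theorem exists_isIntegrallyClosed_nhds (x : D.Xtilde) :
    ∃ U : D.Xtilde.Opens, x ∈ U ∧ IsAffineOpen U ∧ IsIntegrallyClosed Γ(D.Xtilde, U) := by
  obtain ⟨V, hV, hVn, y, rfl⟩ := D.exists_mem_range_chart x
  refine ⟨D.chart hV ''ᵁ ⊤, ⟨y, trivial, rfl⟩,
    (isAffineOpen_top _).image_of_isOpenImmersion (D.chart hV), ?_⟩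
  have := D.isIntegrallyClosed_sheafSections V
  exact IsIntegrallyClosed.of_equiv (((D.chart hV).appIso ⊤) ≪≫
    Scheme.ΓSpecIso (CommRingCat.of (D.sheafSections V))).symm.commRingCatIsoToRingEquiv

theorem isBirational_contraction (hσ : σ.FG) (hσ' : (σ : ConvexCone ℚ (NQ M)).Salient)
    (hD : ∀ u ∈ interiorWeights σ, IsBig (D.eval u)) : IsBirational D.contraction := by
  obtain ⟨U, hU, hUn, hT, w, g, hg, hs, -, hloc⟩ := D.exists_section_localizing hσ hσ' hD
  have := D.isDomain_sheafSections ⊤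
  have := D.isDomain_sheafSections U
  have hinj := D.evalGeneric_injective U
  refine .of_isOpenImmersion_comp (c := D.chart hU) ?_
  rw [D.chart_contraction hU]
  refine isBirational_specMap (A := .of (D.sheafSections ⊤)) (B := .of (D.sheafSections U)) _ ?_
    fun b ↦ ?_
  · exact .of_comp (f := D.evalGeneric U) (D.evalGeneric_injective ⊤)
  have hb : D.evalGeneric U b ∈ torusSections M U :=
    hT.sections_le_torusSections ((D.range_evalGeneric U).le ⟨b, rfl⟩)
  obtain ⟨N, hN⟩ := hloc _ hb
  obtain ⟨s, hs⟩ := (D.range_evalGeneric ⊤).ge (pow_mem hs N)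
  obtain ⟨t, ht⟩ := (D.range_evalGeneric ⊤).ge hN
  refine ⟨s, t, fun h0 ↦ ?_, hinj ?_⟩
  · have h1 : D.evalGeneric U (D.res le_top s) = 0 := by
      rw [show D.res le_top s = 0 from h0, map_zero]
    rw [evalGeneric_res, hs, AddMonoidAlgebra.single_pow] at h1
    exact pow_ne_zero N hg (AddMonoidAlgebra.single_eq_zero.mp h1)
  · change D.evalGeneric U (D.res le_top s * b) = D.evalGeneric U (D.res le_top t)
    rw [map_mul, evalGeneric_res, evalGeneric_res, hs, ht]

variable {D} {C : Scheme.{0}} [C.Over SpecC] (j : Y ⟶ C) [j.IsOver SpecC] [C.IsSeparated]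
  {p : D.X ⤏ C} [p.IsOver SpecC]

theorem IsRationalQuotientMap.exists_lift_graphClosure (hp : D.IsRationalQuotientMap j p) :
    ∃ f : D.Xtilde ⟶ graphClosure p, IsDominant f ∧ f ≫ graphClosureι p = D.toProduct j := by
  obtain ⟨k, hk, hk'⟩ := hp.exists_toPartialMap_lift
  obtain ⟨V, hV, hxV, -⟩ :=
    exists_isAffineOpen_mem_and_subset (U := ⊤) (x := genericPoint Y) trivial
  have : Nonempty V := ⟨⟨_, hxV⟩⟩
  have hkgraph : D.fromTorus hV ≫ D.toProduct j = k ≫ graph p := by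
    refine pullback.hom_ext ?_ ?_
    · rw [Category.assoc, Category.assoc, toProduct_fst, fromTorus_contraction, graph_fst, hk]
    · rw [Category.assoc, Category.assoc, toProduct_snd, ← Category.assoc, fromTorus_π, graph_snd,
        hk']
  obtain ⟨l, hl, hlgraph⟩ := exists_dominant_lift_graph p
  have hrange : Set.range (D.toProduct j) ⊆ graphClosureSet p := by
    refine ((D.toProduct j).continuous.range_subset_closure_image_dense
      (D.fromTorus hV).denseRange).trans (closure_mono ?_)
    rintro _ ⟨_, ⟨t, rfl⟩, rfl⟩
    exact ⟨k t, congr($hkgraph t).symm⟩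
  obtain ⟨f, hf⟩ := exists_lift_graphClosureι p (D.toProduct j) hrange
  have hfl : D.fromTorus hV ≫ f = k ≫ l := by
    rw [← cancel_mono (graphClosureι p), Category.assoc, Category.assoc, hlgraph, ← hkgraph, hf]
  have : IsDominant (k ≫ p.toPartialMap.domain.ι) := hk ▸ inferInstance
  have : IsDominant k := .of_comp_of_isOpenImmersion k p.toPartialMap.domain.ι
  have : IsDominant (D.fromTorus hV ≫ f) := hfl ▸ inferInstance
  exact ⟨f, .of_comp (D.fromTorus hV) f, hf⟩

theorem IsRationalQuotientMap.existsUnique_iso (hσ : σ.FG)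
    (hσ' : (σ : ConvexCone ℚ (NQ M)).Salient) [IsNonsingularCurve C] [IsOpenImmersion j]
    (hD : D.IsProper) (hp : D.IsRationalQuotientMap j p) :
    ∃! e : D.Xtilde ≅ Xdd p, e.hom ≫ XddToX p = D.contraction ∧ e.hom ≫ XddToC p = D.π ≫ j := by
  obtain ⟨f, _, hf⟩ := hp.exists_lift_graphClosure j
  have hfst : f ≫ graphClosureι p ≫ pullback.fst _ _ = D.contraction := by
    rw [← Category.assoc, hf, toProduct_fst]
  have hsnd : f ≫ graphClosureι p ≫ pullback.snd _ _ = D.π ≫ j := by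
    rw [← Category.assoc, hf, toProduct_snd]
  have : IsIntegralHom f := by
    have : IsIntegralHom (f ≫ graphClosureι p) := hf ▸ D.isIntegralHom_toProduct j hD.semiample
    exact .of_comp f (graphClosureι p)
  have hbir : IsBirational f := (hfst ▸ D.isBirational_contraction hσ hσ' hD.big).of_comp
  obtain ⟨e, he⟩ : ∃ e : D.Xtilde ≅ Xdd p, e.hom ≫ fromNormalization (graphClosure p) = f :=
    exists_iso_normalization f hbir D.exists_isIntegrallyClosed_nhds
  have hcompat (e' : D.Xtilde ≅ Xdd p) :
      (e'.hom ≫ XddToX p = D.contraction ∧ e'.hom ≫ XddToC p = D.π ≫ j) ↔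
        e'.hom ≫ fromNormalization (graphClosure p) = f := by
    rw [← hfst, ← hsnd, comp_fromNormalization_eq_iff]
  refine ⟨e, (hcompat e).mpr he, fun e' he' ↦ ?_⟩
  have heq : (e'.hom ≫ e.inv) ≫ f = 𝟙 _ ≫ f := by
    rw [Category.assoc, (Iso.inv_comp_eq e).mpr he.symm, (hcompat e').mp he', Category.id_comp]
  exact Iso.ext (((Iso.comp_inv_eq e).mp (hbir.hom_ext heq)).trans (Category.id_comp _))

end PolyhedralDivisor

end PolyDiv

end

theorem mainTheorem2_general {M : Type} [AddCommGroup M] [Module.Free ℤ M]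
    (σ : PointedCone ℚ (PolyDiv.NQ M)) (hσ : σ.FG)
    (hσ' : (σ : ConvexCone ℚ (PolyDiv.NQ M)).Salient)
    {Y C : Scheme.{0}} [Y.Over PolyDiv.SpecC] [C.Over PolyDiv.SpecC]
    [PolyDiv.IsNonsingularCurve Y] [PolyDiv.IsNonsingularCurve C]
    (j : Y ⟶ C) [IsOpenImmersion j] [j.IsOver PolyDiv.SpecC]
    (D : PolyDiv.PolyhedralDivisor Y σ) (hD : D.IsProper) :
    (∃! p : D.X ⤏ C, p.IsOver PolyDiv.SpecC ∧ D.IsRationalQuotientMap j p) ∧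
      ∀ (p : D.X ⤏ C) [p.IsOver PolyDiv.SpecC], D.IsRationalQuotientMap j p →
        ∃! e : D.Xtilde ≅ PolyDiv.Xdd p,
          e.hom ≫ PolyDiv.XddToX p = D.contraction ∧ e.hom ≫ PolyDiv.XddToC p = D.π ≫ j := by
  constructor
  · obtain ⟨p, hp, hq⟩ := D.exists_isRationalQuotientMap hσ hσ' hD.big j
    exact ⟨p, ⟨hp, hq⟩, fun p' hp' ↦ hp'.2.unique hq⟩
  · intro p _ hp
    exact hp.existsUnique_iso j hσ hσ' hD

theorem mainTheorem2 {M : Type} [AddCommGroup M] [Module.Free ℤ M] [Module.Finite ℤ M]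
    (σ : PointedCone ℚ (PolyDiv.NQ M)) (hσ : σ.FG)
    (hσ' : (σ : ConvexCone ℚ (PolyDiv.NQ M)).Salient)
    {Y C : Scheme.{0}} [Y.Over PolyDiv.SpecC] [C.Over PolyDiv.SpecC]
    [PolyDiv.IsNonsingularCurve Y] [PolyDiv.IsNonsingularCurve C] [IsProper (C ↘ PolyDiv.SpecC)]
    (j : Y ⟶ C) [IsOpenImmersion j] [j.IsOver PolyDiv.SpecC]
    (D : PolyDiv.PolyhedralDivisor Y σ) (hD : D.IsProper) :
    (∃! p : D.X ⤏ C, p.IsOver PolyDiv.SpecC ∧ D.IsRationalQuotientMap j p) ∧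
      ∀ (p : D.X ⤏ C) [p.IsOver PolyDiv.SpecC], D.IsRationalQuotientMap j p →
        ∃! e : D.Xtilde ≅ PolyDiv.Xdd p,
          e.hom ≫ PolyDiv.XddToX p = D.contraction ∧ e.hom ≫ PolyDiv.XddToC p = D.π ≫ j :=
  mainTheorem2_general σ hσ hσ' j D hD
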